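/- **Proposition 1.2 (Bound states).** *Setting.* Let $p>0$ and let $g\in C([0,\infty),\mathbb R)\cap C^3((0,\infty),\mathbb R)$ be such that, for some constant $C_g>0$, $|g^{(k)}(s)|\le C_g\,s^{p-k}$ for all $s\in(0,1]$ and $k=0,1,2,3$. Let $H_1=-\partial_x^2-\delta$ on the line, that is, $H_1u=-\partial_x^2u$ on $\mathbb R\setminus\{0\}$ with domain $$D(H_1)=\{u\in H^1(\mathbb R,\mathbb C)\cap H^2(\mathbb R\setminus\{0\},\mathbb C)\;:\;\partial_xu(0^+)-\partial_xu(0^-)=-u(0)\},$$ and let $\varphi(x)=\tfrac1{\sqrt2}e^{-|x|/2}$ be its normalized eigenfunction, with eigenvalue $-\tfrac14$. For $\gamma>0$ let $H^1_\gamma$ be the space of functions $u:\mathbb R\to\mathbb C$ with $\|u\|_{H^1_\gamma}:=\|e^{\gamma|x|}u\|_{H^1}<\infty$. Write $D_1=\partial_{\operatorname{Re}z}$, $D_2=\partial_{\operatorname{Im}z}$ and $D_{\mathbb C}(0,a)=\{z\in\mathbb C:|z|<a\}$. *Claim.* There exist $\gamma_0>0$, $a_0>0$ and $C>0$ with $\varphi\in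 H^1_{\gamma_0}$ such that there is a unique $Q\in C^1(D_{\mathbb C}(0,a_0);H^1_{\gamma_0})$ with all of the following properties, for all $z\in D_{\mathbb C}(0,a_0)$: 1. (gauge covariance) $Q[e^{i\theta}z]=e^{i\theta}Q[z]$ for all $\theta\in\mathbb R$; 2. (normalization) $\int_{\mathbb R}Q[z]\,\varphi\,dx=z$, i.e. $Q[z]-z\varphi$ is $L^2$-orthogonal to $\mathbb C\varphi$; 3. there is $E\in C([0,a_0^2),\mathbb R)$ such that $Q[z]\in D(H_1)$, $\;H_1Q[z]+g(|Q[z]|^2)Q[z]=E(|z|^2)Q[z]$ and $\left|E(|z|^2)+\tfrac14\right|\le C|z|^{2p}$; 4. $\|Q[z]-z\varphi\|_{H^1_{\gamma_0}}\le C|z|^{2p+1}$ and $\|D_jQ[z]-i^{\,j-1}\varphi\|_{H^1_{\gamma_0}}\le C|z|^{2p}$ for $j=1,2$. Moreover, if $2p>1$, then this $Q$ belongs to $C^2(D_{\mathbb C}(0,a_0);H^1_{\gamma_0})$ and $\|D_jD_kQ[z]\|_{H^1_{\gamma_0}}\le C|z|^{2p-1}$ for $j,k=1,2$ and all $z\in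 D_{\mathbb C}(0,a_0)$. -/

import Mathlib

open MeasureTheory Set Filter Topology
open scoped ENNReal ContDiff

noncomputable section

namespace DeltaNLS

/-! ### Weak derivatives and Sobolev spaces on open subsets of the line -/

/-- `w` is the weak (distributional) derivative of `u` on the open set `Ω ⊆ ℝ`. -/
def IsWeakDeriv (Ω : Set ℝ) (u w : ℝ → ℂ) : Prop :=
  LocallyIntegrableOn u Ω ∧ LocallyIntegrableOn w Ω ∧
    ∀ η : ℝ → ℝ, ContDiff ℝ ∞ η → HasCompactSupport η → tsupport η ⊆ Ω →
      ∫ x, deriv η x • u x = -∫ x, η x • w x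

/-- `u ∈ H¹(Ω)`: `u` and its weak derivative on `Ω` are square integrable on `Ω`. -/
def MemH1 (Ω : Set ℝ) (u : ℝ → ℂ) : Prop :=
  MemLp u 2 (volume.restrict Ω) ∧
    ∃ w : ℝ → ℂ, MemLp w 2 (volume.restrict Ω) ∧ IsWeakDeriv Ω u w

theorem integrable_test {η : ℝ → ℝ} (hη : Continuous η) (hc : HasCompactSupport η)
    {u : ℝ → ℂ} (hu : LocallyIntegrableOn u univ) : Integrable (fun x => η x • u x) :=
  (locallyIntegrableOn_univ.1 hu).integrable_smul_left_of_hasCompactSupport hη hc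

theorem IsWeakDeriv.congr_left {Ω : Set ℝ} {u v w : ℝ → ℂ} (h : IsWeakDeriv Ω u w)
    (huv : u =ᵐ[volume] v) : IsWeakDeriv Ω v w := by
  obtain ⟨h1, h2, h3⟩ := h
  refine ⟨?_, h2, fun η a b c => ?_⟩
  · intro x hx
    obtain ⟨t, ht, hi⟩ := h1 x hx
    exact ⟨t, ht, hi.congr_fun_ae (ae_restrict_of_ae huv)⟩
  · rw [← h3 η a b c]
    refine integral_congr_ae ?_
    filter_upwards [huv] with x hx
    rw [hx]

theorem IsWeakDeriv.add {u v w z : ℝ → ℂ} (h : IsWeakDeriv univ u w)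
    (h' : IsWeakDeriv univ v z) : IsWeakDeriv univ (u + v) (w + z) := by
  refine ⟨h.1.add h'.1, h.2.1.add h'.2.1, fun η a b c => ?_⟩
  have ca : Continuous (deriv η) := a.continuous_deriv (by simp)
  simp only [Pi.add_apply, smul_add]
  rw [integral_add (integrable_test ca b.deriv h.1) (integrable_test ca b.deriv h'.1),
    integral_add (integrable_test a.continuous b h.2.1) (integrable_test a.continuous b h'.2.1),
    h.2.2 η a b c, h'.2.2 η a b c]
  ring

theorem IsWeakDeriv.smul {u w : ℝ → ℂ} (c : ℂ) (h : IsWeakDeriv univ u w) :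
    IsWeakDeriv univ (c • u) (c • w) := by
  refine ⟨h.1.smul c, h.2.1.smul c, fun η a b d => ?_⟩
  simp only [Pi.smul_apply, smul_comm _ c]
  rw [integral_smul, integral_smul, h.2.2 η a b d, smul_neg]

theorem IsWeakDeriv.unique {u w z : ℝ → ℂ} (h : IsWeakDeriv univ u w)
    (h' : IsWeakDeriv univ u z) : w =ᵐ[volume] z := by
  refine ae_eq_of_integral_contDiff_smul_eq (locallyIntegrableOn_univ.1 h.2.1)
    (locallyIntegrableOn_univ.1 h'.2.1) fun η a b => ?_
  have := (h.2.2 η a b (subset_univ _)).symm.trans (h'.2.2 η a b (subset_univ _))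
  exact neg_injective this

theorem isWeakDeriv_zero : IsWeakDeriv univ 0 0 := by
  refine ⟨?_, ?_, fun η _ _ _ => by simp⟩ <;>
  exact locallyIntegrableOn_univ.2 (locallyIntegrable_const (0 : ℂ))

theorem MemH1.congr {u v : ℝ → ℂ} (h : MemH1 univ u) (huv : u =ᵐ[volume] v) :
    MemH1 univ v := by
  obtain ⟨h1, w, h2, h3⟩ := h
  exact ⟨h1.ae_eq (ae_restrict_of_ae huv), w, h2, h3.congr_left huv⟩

theorem MemH1.add {u v : ℝ → ℂ} (h : MemH1 univ u) (h' : MemH1 univ v) :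
    MemH1 univ (u + v) := by
  obtain ⟨h1, w, h2, h3⟩ := h
  obtain ⟨k1, z, k2, k3⟩ := h'
  exact ⟨h1.add k1, w + z, h2.add k2, h3.add k3⟩

theorem MemH1.smul {u : ℝ → ℂ} (c : ℂ) (h : MemH1 univ u) : MemH1 univ (c • u) := by
  obtain ⟨h1, w, h2, h3⟩ := h
  exact ⟨h1.const_smul c, c • w, h2.const_smul c, h3.smul c⟩

/-! ### The exponentially weighted space `H¹_γ` -/

/-- The function `e^{γ|x|} u(x)`. -/
def weighted (γ : ℝ) (u : ℝ → ℂ) : ℝ → ℂ := fun x => (Real.exp (γ * |x|) : ℂ) * u x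

theorem weighted_congr (γ : ℝ) {u v : ℝ → ℂ} (h : u =ᵐ[volume] v) :
    weighted γ u =ᵐ[volume] weighted γ v := by
  filter_upwards [h] with x hx
  simp [weighted, hx]

theorem weighted_add (γ : ℝ) (u v : ℝ → ℂ) :
    weighted γ (u + v) = weighted γ u + weighted γ v := by
  ext x; simp [weighted, mul_add]

theorem weighted_smul (γ : ℝ) (c : ℂ) (u : ℝ → ℂ) :
    weighted γ (c • u) = c • weighted γ u := by
  ext x; simp [weighted, mul_left_comm]

/-- The (classes of) functions `u` with `e^{γ|x|} u ∈ H¹(ℝ)`. -/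
def weightedH1Submodule (γ : ℝ) : Submodule ℂ (ℝ →ₘ[volume] ℂ) where
  carrier := {u | MemH1 univ (weighted γ u)}
  add_mem' {u v} hu hv := by
    have h := MemH1.add hu hv
    rw [← weighted_add] at h
    exact h.congr (weighted_congr γ (AEEqFun.coeFn_add u v).symm)
  zero_mem' := by
    have h : MemH1 univ (0 : ℝ → ℂ) :=
      ⟨MemLp.zero, 0, MemLp.zero, isWeakDeriv_zero⟩
    refine h.congr ?_
    filter_upwards [AEEqFun.coeFn_zero (α := ℝ) (β := ℂ) (μ := volume)] with x hx
    simp [weighted, hx]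
  smul_mem' c u hu := by
    have h := MemH1.smul c hu
    rw [← weighted_smul] at h
    exact h.congr (weighted_congr γ (AEEqFun.coeFn_smul c u).symm)

/-- The weighted Sobolev space `H¹_γ`. -/
def WeightedH1 (γ : ℝ) : Type := weightedH1Submodule γ

namespace WeightedH1

variable {γ : ℝ}

instance : AddCommGroup (WeightedH1 γ) := inferInstanceAs (AddCommGroup (weightedH1Submodule γ))

instance : Module ℂ (WeightedH1 γ) := inferInstanceAs (Module ℂ (weightedH1Submodule γ))

/-- The almost-everywhere class underlying an element of `H¹_γ`. -/
def toAEEqFun (u : WeightedH1 γ) : ℝ →ₘ[volume] ℂ := Subtype.val u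

instance : CoeFun (WeightedH1 γ) fun _ => ℝ → ℂ := ⟨fun u => u.toAEEqFun⟩

theorem memH1 (u : WeightedH1 γ) : MemH1 univ (weighted γ u) := u.2

/-- The weak derivative of `e^{γ|x|} u`. -/
def weightedDeriv (u : WeightedH1 γ) : ℝ → ℂ := u.memH1.2.choose

theorem memLp_weighted (u : WeightedH1 γ) : MemLp (weighted γ u) 2 volume := by
  have h := u.memH1.1
  rwa [Measure.restrict_univ] at h

theorem memLp_weightedDeriv (u : WeightedH1 γ) : MemLp u.weightedDeriv 2 volume := by
  have h : MemLp u.weightedDeriv 2 (volume.restrict univ) := u.memH1.2.choose_spec.1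
  rwa [Measure.restrict_univ] at h

theorem isWeakDeriv (u : WeightedH1 γ) : IsWeakDeriv univ (weighted γ u) u.weightedDeriv :=
  u.memH1.2.choose_spec.2

theorem coe_add (u v : WeightedH1 γ) : ⇑(u + v).toAEEqFun =ᵐ[volume] (u : ℝ → ℂ) + v :=
  AEEqFun.coeFn_add u.toAEEqFun v.toAEEqFun

theorem coe_smul (c : ℂ) (u : WeightedH1 γ) :
    ⇑(c • u).toAEEqFun =ᵐ[volume] c • (u : ℝ → ℂ) :=
  AEEqFun.coeFn_smul c u.toAEEqFun

theorem weighted_coe_add (u v : WeightedH1 γ) :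
    weighted γ (u + v : WeightedH1 γ) =ᵐ[volume] weighted γ u + weighted γ v := by
  rw [← weighted_add]; exact weighted_congr γ (coe_add u v)

theorem weighted_coe_smul (c : ℂ) (u : WeightedH1 γ) :
    weighted γ (c • u : WeightedH1 γ) =ᵐ[volume] c • weighted γ u := by
  rw [← weighted_smul]; exact weighted_congr γ (coe_smul c u)

theorem weightedDeriv_add (u v : WeightedH1 γ) :
    (u + v).weightedDeriv =ᵐ[volume] u.weightedDeriv + v.weightedDeriv :=
  ((u + v).isWeakDeriv.congr_left (weighted_coe_add u v)).unique
    (u.isWeakDeriv.add v.isWeakDeriv)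

theorem weightedDeriv_smul (c : ℂ) (u : WeightedH1 γ) :
    (c • u).weightedDeriv =ᵐ[volume] c • u.weightedDeriv :=
  ((c • u).isWeakDeriv.congr_left (weighted_coe_smul c u)).unique (u.isWeakDeriv.smul c)

/-- The map `u ↦ (v, v′)` with `v = e^{γ|x|} u`, into the Hilbert sum `L² ⊕ L²`. -/
def toL2Prod (γ : ℝ) :
    WeightedH1 γ →ₗ[ℂ] WithLp 2 (Lp ℂ 2 (volume : Measure ℝ) × Lp ℂ 2 (volume : Measure ℝ)) where
  toFun u := WithLp.toLp 2 (u.memLp_weighted.toLp _, u.memLp_weightedDeriv.toLp _)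
  map_add' u v := by
    rw [← WithLp.toLp_add, Prod.mk_add_mk, ← MemLp.toLp_add, ← MemLp.toLp_add]
    congr 2
    · exact MemLp.toLp_congr _ _ (weighted_coe_add u v)
    · exact MemLp.toLp_congr _ _ (weightedDeriv_add u v)
  map_smul' c u := by
    rw [RingHom.id_apply, ← WithLp.toLp_smul, Prod.smul_mk, ← MemLp.toLp_const_smul,
      ← MemLp.toLp_const_smul]
    congr 2
    · exact MemLp.toLp_congr _ _ (weighted_coe_smul c u)
    · exact MemLp.toLp_congr _ _ (weightedDeriv_smul c u)

theorem toL2Prod_injective (γ : ℝ) : Function.Injective (toL2Prod γ) := by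
  intro u v h
  have h1 := congrArg (fun y => y.fst) h
  have h2 : weighted γ u =ᵐ[volume] weighted γ v :=
    (MemLp.toLp_eq_toLp_iff u.memLp_weighted v.memLp_weighted).1 h1
  apply Subtype.ext
  apply AEEqFun.ext
  filter_upwards [h2] with x hx
  have hne : (Real.exp (γ * |x|) : ℂ) ≠ 0 := by exact_mod_cast (Real.exp_pos _).ne'
  exact mul_left_cancel₀ hne hx

/-- The norm `‖u‖_{H¹_γ} = ‖e^{γ|x|} u‖_{H¹}`, where `‖v‖_{H¹}² = ‖v‖² + ‖v′‖²` in `L²`. -/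
instance : NormedAddCommGroup (WeightedH1 γ) :=
  NormedAddCommGroup.induced _ _ (toL2Prod γ) (toL2Prod_injective γ)

instance : NormedSpace ℂ (WeightedH1 γ) := NormedSpace.induced ℂ _ _ (toL2Prod γ)

end WeightedH1

/-! ### The Schrödinger operator with a delta potential -/

/-- The relation `u ∈ D(H_q)` and `H_q u = f`, where `H_q = -∂ₓ² - q δ`, that is `H_q = -∂ₓ²` with
domain the `u ∈ H¹(ℝ) ∩ H²(ℝ ∖ {0})` such that `u′(0⁺) - u′(0⁻) = -q u(0)`. Here `u₀` is the
continuous representative of `u`, and `v`, `w` are the first two weak derivatives of `u` on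
`ℝ ∖ {0}`, the representative `v` being one that has one-sided limits at `0`. -/
def IsDeltaHamiltonian (q : ℝ) (u f : ℝ → ℂ) : Prop :=
  MemH1 univ u ∧
  ∃ (u₀ v w : ℝ → ℂ) (ℓp ℓm : ℂ),
    Continuous u₀ ∧ u₀ =ᵐ[volume] u ∧
    IsWeakDeriv {0}ᶜ u v ∧ MemLp v 2 volume ∧
    IsWeakDeriv {0}ᶜ v w ∧ MemLp w 2 volume ∧
    Tendsto v (𝓝[>] 0) (𝓝 ℓp) ∧ Tendsto v (𝓝[<] 0) (𝓝 ℓm) ∧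
    ℓp - ℓm = -(q : ℂ) * u₀ 0 ∧
    f =ᵐ[volume] -w

/-- `φ_q(x) = √(q/2) e^{-q|x|/2}`; for `q > 0` the normalized eigenfunction of `H_q` with
eigenvalue `-q²/4`. -/
def eigenfunction (q : ℝ) (x : ℝ) : ℂ := (Real.sqrt (q / 2) * Real.exp (-(q / 2) * |x|) : ℝ)

/-! ### The nonlinearity and the bound states -/

/-- The hypotheses on the nonlinearity: `g ∈ C([0,∞),ℝ) ∩ C³((0,∞),ℝ)` and, for some constant,
`|g⁽ᵏ⁾(s)| ≤ C s^{p-k}` for `s ∈ (0,1]` and `k = 0,1,2,3`. Only `g` on `[0,∞)` matters. -/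
structure IsNonlinearity (p : ℝ) (g : ℝ → ℝ) : Prop where
  continuousOn : ContinuousOn g (Ici 0)
  contDiffOn : ContDiffOn ℝ 3 g (Ioi 0)
  bound : ∃ C : ℝ, 0 < C ∧ ∀ k : ℕ, k ≤ 3 → ∀ s ∈ Ioc (0 : ℝ) 1,
    |iteratedDeriv k g s| ≤ C * s ^ (p - k)

/-- `H_1 u + g(|u|²) u = E u`, including `u ∈ D(H_1)`. -/
def IsBoundState (g : ℝ → ℝ) (E : ℝ) (u : ℝ → ℂ) : Prop :=
  ∃ f : ℝ → ℂ, IsDeltaHamiltonian 1 u f ∧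
    ∀ᵐ x, f x + (g (‖u x‖ ^ 2) : ℂ) * u x = (E : ℂ) * u x

/-- The partial derivative of `F` in the real direction (`j = 0`) or in the imaginary direction
(`j = 1`). -/
def partialD {X : Type*} [NormedAddCommGroup X] [NormedSpace ℝ X] (j : Fin 2) (F : ℂ → X)
    (z : ℂ) : X :=
  fderiv ℝ F z (Complex.I ^ (j : ℕ))

/-- `Q` is, on the disc `|z| < a`, a `C¹` gauge covariant family of bound states with values in
`H¹_γ`, normalized by `∫ Q[z] φ = z` (so `Q[z] - zφ` has no component along `φ`), and satisfying
the quantitative estimates with the constant `C`. The argument `φ` is the eigenfunction of `H_1`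
as an element of `H¹_γ`. -/
structure IsBoundStateFamily (g : ℝ → ℝ) (p γ a C : ℝ) (φ : WeightedH1 γ)
    (Q : ℂ → WeightedH1 γ) : Prop where
  contDiffOn : ContDiffOn ℝ 1 Q (Metric.ball 0 a)
  gauge : ∀ z ∈ Metric.ball (0 : ℂ) a, ∀ θ : ℝ,
    Q (Complex.exp (Complex.I * θ) * z) = Complex.exp (Complex.I * θ) • Q z
  normalized : ∀ z ∈ Metric.ball (0 : ℂ) a, ∫ x, Q z x * φ x = z
  boundState : ∃ E : ℝ → ℝ, ContinuousOn E (Ico 0 (a ^ 2)) ∧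
    ∀ z ∈ Metric.ball (0 : ℂ) a,
      IsBoundState g (E (‖z‖ ^ 2)) (Q z) ∧ |E (‖z‖ ^ 2) + 1 / 4| ≤ C * ‖z‖ ^ (2 * p)
  norm_sub_le : ∀ z ∈ Metric.ball (0 : ℂ) a, ‖Q z - z • φ‖ ≤ C * ‖z‖ ^ (2 * p + 1)
  norm_partialD_sub_le : ∀ z ∈ Metric.ball (0 : ℂ) a, ∀ j : Fin 2,
    ‖partialD j Q z - Complex.I ^ (j : ℕ) • φ‖ ≤ C * ‖z‖ ^ (2 * p)

end DeltaNLS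

end

noncomputable section

namespace DeltaNLS

/-! ### Classical derivatives are weak derivatives -/

/-! Existence. The bound state is sought as Q = z (φ + w), with w real, orthogonal to φ and
depending only on ρ = |z|; gauge covariance and the normalization are then built in. Dividing the
equation by z and writing E = -1/4 + e turns it into (H_1 + 1/4) w = -N + e (φ + w), where N = ρ⁻¹
G(ρ (φ + w)) and G(u) = g(u²) u. The right side must be orthogonal to φ, which forces e = ⟨φ, N⟩;
inverting H_1 + 1/4 on the complement of φ by the reduced resolvent T leaves the fixed point problem
w = T n with source n = -N + e w. Since G vanishes to order 2p + 1, the map has size and Lipschitz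
constant O(ρ^{2p}) on the unit ball, and Banach's theorem applies for small ρ.

The function space is chosen so that every operator is explicit. Solutions are even, so the problem
lives on the half line, where the delta potential becomes the Robin condition u'(0) = -u(0)/2, and u
is stored through the bounded continuous function v = e^{|x|/4} u. There the superposition operator
is C¹, and C² when 2p > 1, by pointwise estimates (`hasFDerivAt_superposition`), and T comes from
the factorization -u'' + u/4 = (-∂ + 1/2)(∂ + 1/2) u. The functions produced decay like e^{-|x|/4}
together with their derivatives, so they lie in H¹_{1/8}, and `exists_resolventH1` maps the source
linearly and continuously into that space.

Regularity in z. For ρ > 0 the implicit function theorem makes w as smooth as G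
(`IsBranch.contDiffAt`). Differentiating ρ N = G(ρ (φ + w)) and absorbing the derivatives of w by
the contraction bound gives ρ ‖n'‖ = O(ρ^{2p}) and, when 2p > 1, ρ² ‖n''‖ = O(ρ^{2p}). These become
estimates for the derivatives of z ↦ z W(|z|) off the origin, and `contDiffOn_one_of_punctured`
carries them across it.

Uniqueness. The competitors are arbitrary complex families, not assumed even. By ODE regularity each
bound state is classical off the origin (`IsBoundState.exists_classical`). The difference u of two
of them with the same z is orthogonal to φ and satisfies (H_1 + 1/4) u = -(difference of the
nonlinear terms) + (E₁ + 1/4) u + (E₁ - E₂) u₂. Pairing with φ bounds |E₁ - E₂| |z| by a small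
multiple of ‖u‖; the coercivity estimate `integral_norm_sq_sub_le`, which plays the part of the
spectral gap, then gives ‖u‖² ≤ κ ‖u‖² with κ < 1. -/

theorem IsWeakDeriv.of_hasDerivAt {Ω : Set ℝ} {u w : ℝ → ℂ} (hu : LocallyIntegrable u)
    (hw : LocallyIntegrable w) (hd : ∀ x ≠ 0, HasDerivAt u (w x) x)
    (h0 : ContinuousAt u 0 ∨ (0 : ℝ) ∉ Ω) : IsWeakDeriv Ω u w := by
  refine ⟨hu.locallyIntegrableOn _, hw.locallyIntegrableOn _, fun η hη hc hs => ?_⟩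
  have i1 : Integrable (fun x => deriv η x • u x) :=
    integrable_test (hη.continuous_deriv (by simp)) hc.deriv (hu.locallyIntegrableOn _)
  have i2 : Integrable (fun x => η x • w x) :=
    integrable_test hη.continuous hc (hw.locallyIntegrableOn _)
  have dη : ∀ x, HasDerivAt η (deriv η x) x := fun x =>
    (hη.differentiable (by simp) x).hasDerivAt
  have key : ∀ x ≠ 0, HasDerivAt (fun y => η y • u y) (deriv η x • u x + η x • w x) x := by
    intro x hx
    have := (dη x).smul (hd x hx)
    rwa [add_comm] at this
  have hcont : Continuous (fun y => η y • u y) := by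
    rw [continuous_iff_continuousAt]
    intro x
    by_cases hx : x = 0
    · subst hx
      rcases h0 with h0 | h0
      · exact hη.continuous.continuousAt.smul h0
      · have h1 : (0 : ℝ) ∉ tsupport η := fun h => h0 (hs h)
        have h2 : (fun y => η y • u y) =ᶠ[𝓝 0] fun _ => 0 := by
          filter_upwards [notMem_tsupport_iff_eventuallyEq.1 h1] with y hy
          simp [hy]
        exact h2.continuousAt
    · exact (key x hx).continuousAt
  have h3 : ∫ x, (deriv η x • u x + η x • w x) = 0 := by
    have t1 := intervalIntegral_tendsto_integral (i1.add i2) tendsto_neg_atTop_atBot tendsto_id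
    -- The fundamental theorem with a countable exceptional set asks only for continuity of η u at
    -- 0, which is what `h0` secures.
    have t2 : ∀ R : ℝ, ∫ x in (-R)..R, (deriv η x • u x + η x • w x) =
        η R • u R - η (-R) • u (-R) := fun R =>
      integral_eq_of_hasDerivAt_off_countable (fun y => η y • u y) _ (countable_singleton (0 : ℝ))
        hcont.continuousOn (fun x hx => key x hx.2) (i1.add i2).intervalIntegrable
    have t3 : Tendsto (fun R : ℝ => η R • u R - η (-R) • u (-R)) atTop (𝓝 0) := by
      obtain ⟨M, hM⟩ := hc.isCompact.isBounded.subset_closedBall 0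
      refine tendsto_const_nhds.congr' ?_
      filter_upwards [eventually_gt_atTop (max M 0)] with R hR
      have hR0 : 0 < R := (le_max_right _ _).trans_lt hR
      have hR1 : M < R := (le_max_left _ _).trans_lt hR
      have e1 : η R = 0 := by
        apply image_eq_zero_of_notMem_tsupport
        intro h
        have := hM h
        rw [mem_closedBall_zero_iff, Real.norm_eq_abs, abs_of_pos hR0] at this
        linarith
      have e2 : η (-R) = 0 := by
        apply image_eq_zero_of_notMem_tsupport
        intro h
        have := hM h
        rw [mem_closedBall_zero_iff, Real.norm_eq_abs, abs_neg, abs_of_pos hR0] at this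
        linarith
      simp [e1, e2]
    refine tendsto_nhds_unique t1 (t3.congr fun R => ?_)
    simpa using (t2 R).symm
  rw [integral_add i1 i2] at h3
  exact eq_neg_of_add_eq_zero_left h3

theorem locallyIntegrable_of_memLp {u : ℝ → ℂ} (h : MemLp u 2 volume) : LocallyIntegrable u :=
  h.locallyIntegrable (by norm_num)

/-! ### Even extensions of exponentially decaying functions -/

theorem integrable_exp_neg_mul_abs {c : ℝ} (hc : 0 < c) :
    Integrable (fun x : ℝ => Real.exp (-c * |x|)) := by
  have h1 : IntegrableOn (fun x : ℝ => Real.exp (-c * |x|)) (Ioi 0) :=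
    (exp_neg_integrableOn_Ioi 0 hc).congr_fun
      (fun x hx => by simp only [abs_of_pos (mem_Ioi.1 hx)]) measurableSet_Ioi
  have h2 : IntegrableOn (fun x : ℝ => Real.exp (-c * |x|)) (Iic 0) := by
    have h3 : IntegrableOn (fun x : ℝ => Real.exp (-c * |x|)) (Ici 0) :=
      (integrableOn_Ici_iff_integrableOn_Ioi).2 h1
    have h4 := (Measure.measurePreserving_neg (volume : Measure ℝ)).integrableOn_comp_preimage
      (Homeomorph.neg ℝ).measurableEmbedding (f := fun x : ℝ => Real.exp (-c * |x|)) (s := Ici 0)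
    have h5 := h4.2 h3
    simpa [Function.comp_def] using h5
  have := h2.union h1
  rwa [Iic_union_Ioi, integrableOn_univ] at this

theorem memLp_exp_neg_mul_abs {c : ℝ} (hc : 0 < c) :
    MemLp (fun x : ℝ => Real.exp (-c * |x|)) 2 volume := by
  rw [memLp_two_iff_integrable_sq (by fun_prop)]
  refine (integrable_exp_neg_mul_abs (c := 2 * c) (by linarith)).congr
    (Eventually.of_forall fun x => ?_)
  simp only
  rw [← Real.exp_nat_mul]
  congr 1; push_cast; ring

/-- The even extension to the line, with complex values, of a function on the half line. -/
def evenExt (U : ℝ → ℝ) : ℝ → ℂ := fun x => (U |x| : ℂ)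

/-- The odd extension to the line, with complex values, of a function on the half line. -/
def oddExt (U : ℝ → ℝ) : ℝ → ℂ := fun x => ((SignType.sign x : ℝ) * U |x| : ℝ)

theorem continuous_evenExt {U : ℝ → ℝ} (hU : Continuous U) : Continuous (evenExt U) := by
  unfold evenExt; fun_prop

theorem measurable_oddExt {U : ℝ → ℝ} (hU : Continuous U) : Measurable (oddExt U) := by
  unfold oddExt
  have h : Measurable fun x : ℝ => ((SignType.sign x : SignType) : ℝ) := by
    have : (fun x : ℝ => ((SignType.sign x : SignType) : ℝ)) =
        fun x => if 0 < x then 1 else if x < 0 then -1 else 0 := by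
      funext x
      rw [sign_apply]
      split_ifs <;> simp
    rw [this]
    exact Measurable.ite measurableSet_Ioi measurable_const
      (Measurable.ite measurableSet_Iio measurable_const measurable_const)
  exact Complex.measurable_ofReal.comp (h.mul (hU.comp continuous_abs).measurable)

theorem norm_evenExt_le {U : ℝ → ℝ} {M c : ℝ} (h : ∀ x, 0 ≤ x → |U x| ≤ M * Real.exp (-c * x))
    (x : ℝ) : ‖evenExt U x‖ ≤ M * Real.exp (-c * |x|) := by
  simpa [evenExt] using h |x| (abs_nonneg x)

theorem abs_sign_le (x : ℝ) : |((SignType.sign x : SignType) : ℝ)| ≤ 1 := by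
  rcases lt_trichotomy x 0 with h | h | h <;> simp [h]

theorem norm_oddExt_le {U : ℝ → ℝ} {M c : ℝ} (h : ∀ x, 0 ≤ x → |U x| ≤ M * Real.exp (-c * x))
    (x : ℝ) : ‖oddExt U x‖ ≤ M * Real.exp (-c * |x|) := by
  rw [oddExt, Complex.norm_real, Real.norm_eq_abs, abs_mul]
  calc _ ≤ 1 * |U (|x|)| := by gcongr; exact abs_sign_le x
    _ ≤ _ := by simpa using h |x| (abs_nonneg x)

theorem memLp_of_norm_le_exp {u : ℝ → ℂ} {M c : ℝ} (hc : 0 < c) (hu : AEStronglyMeasurable u)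
    (h : ∀ x, ‖u x‖ ≤ M * Real.exp (-c * |x|)) : MemLp u 2 volume :=
  (memLp_exp_neg_mul_abs hc).of_le_mul (c := M) hu
    (Eventually.of_forall fun x => by simpa using h x)

theorem hasDerivAt_evenExt {U V : ℝ → ℝ} (h : ∀ x, HasDerivAt U (V x) x) (x : ℝ) (hx : x ≠ 0) :
    HasDerivAt (evenExt U) (oddExt V x) x := by
  have := ((h |x|).comp x (hasDerivAt_abs hx)).ofReal_comp
  simp only [oddExt]
  rwa [mul_comm] at this

theorem hasDerivAt_oddExt {U V : ℝ → ℝ} (h : ∀ x, HasDerivAt U (V x) x) (x : ℝ) (hx : x ≠ 0) :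
    HasDerivAt (oddExt U) (evenExt V x) x := by
  have h1 := ((h |x|).comp x (hasDerivAt_abs hx))
  have hs : (SignType.sign : ℝ → SignType) =ᶠ[𝓝 x] fun _ => SignType.sign x := by
    rcases hx.lt_or_gt with h | h
    · filter_upwards [Iio_mem_nhds h] with y hy
      rw [sign_neg h, sign_neg hy]
    · filter_upwards [Ioi_mem_nhds h] with y hy
      rw [sign_pos h, sign_pos hy]
  have h2 := (h1.const_mul ((SignType.sign x : SignType) : ℝ)).ofReal_comp
  have h3 : ((SignType.sign x : SignType) : ℝ) * (V |x| * ((SignType.sign x : SignType) : ℝ))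
      = V |x| := by
    rcases hx.lt_or_gt with h | h <;> simp [h]
  rw [h3] at h2
  refine h2.congr_of_eventuallyEq ?_
  filter_upwards [hs] with y hy
  simp only [oddExt, Function.comp_apply, hy]

/-- A `C¹` function on the half line decaying like `e^{-cx}` together with its derivative. -/
structure IsProfile (c M : ℝ) (U V : ℝ → ℝ) : Prop where
  hasDerivAt : ∀ x, HasDerivAt U (V x) x
  continuous : Continuous V
  bound : ∀ x, 0 ≤ x → |U x| ≤ M * Real.exp (-c * x)
  bound_deriv : ∀ x, 0 ≤ x → |V x| ≤ M * Real.exp (-c * x)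

namespace IsProfile

variable {c M γ : ℝ} {U V : ℝ → ℝ}

theorem continuous_self (h : IsProfile c M U V) : Continuous U :=
  continuous_iff_continuousAt.2 fun x => (h.hasDerivAt x).continuousAt

theorem nonneg (h : IsProfile c M U V) : 0 ≤ M := by
  have := (abs_nonneg _).trans (h.bound 0 le_rfl)
  simpa using this

/-- The weight e^{γx} costs γ in the decay rate and the product rule costs the factor 1 + γ. Hence
decay at any rate above γ puts the even extension into the weighted space. -/
theorem weighted_profile (h : IsProfile c M U V) (hγ : 0 ≤ γ) :
    IsProfile (c - γ) ((1 + γ) * M) (fun x => Real.exp (γ * x) * U x)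
      (fun x => Real.exp (γ * x) * (V x + γ * U x)) where
  hasDerivAt x := by
    have h1 : HasDerivAt (fun x => Real.exp (γ * x)) (Real.exp (γ * x) * γ) x := by
      simpa using ((hasDerivAt_id x).const_mul γ).exp
    exact (h1.mul (h.hasDerivAt x)).congr_deriv (by ring)
  continuous := by
    have := h.continuous
    have := h.continuous_self
    fun_prop
  bound x hx := by
    have e : Real.exp (-(c - γ) * x) = Real.exp (γ * x) * Real.exp (-c * x) := by
      rw [← Real.exp_add]; congr 1; ring
    rw [abs_mul, Real.abs_exp, e]
    have h1 := h.bound x hx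
    have h2 := h.nonneg
    calc _ ≤ Real.exp (γ * x) * (M * Real.exp (-c * x)) := by gcongr
      _ ≤ Real.exp (γ * x) * (((1 + γ) * M) * Real.exp (-c * x)) := by gcongr; nlinarith
      _ = _ := by ring
  bound_deriv x hx := by
    have e : Real.exp (-(c - γ) * x) = Real.exp (γ * x) * Real.exp (-c * x) := by
      rw [← Real.exp_add]; congr 1; ring
    rw [abs_mul, Real.abs_exp, e]
    have h1 := h.bound x hx
    have h2 := h.bound_deriv x hx
    have h3 : |V x + γ * U x| ≤ (1 + γ) * M * Real.exp (-c * x) := by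
      calc |V x + γ * U x| ≤ |V x| + γ * |U x| := by
            refine (abs_add_le _ _).trans ?_
            rw [abs_mul, abs_of_nonneg hγ]
        _ ≤ M * Real.exp (-c * x) + γ * (M * Real.exp (-c * x)) := by gcongr
        _ = _ := by ring
    calc _ ≤ Real.exp (γ * x) * ((1 + γ) * M * Real.exp (-c * x)) := by gcongr
      _ = _ := by ring

theorem weighted_evenExt (γ : ℝ) (U : ℝ → ℝ) :
    weighted γ (evenExt U) = evenExt (fun x => Real.exp (γ * x) * U x) := by
  ext x; simp [weighted, evenExt]

theorem isWeakDeriv_evenExt (h : IsProfile c M U V) (hc : 0 < c) (Ω : Set ℝ) :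
    IsWeakDeriv Ω (evenExt U) (oddExt V) :=
  .of_hasDerivAt (continuous_evenExt h.continuous_self).locallyIntegrable
    (locallyIntegrable_of_memLp (memLp_of_norm_le_exp hc
      (measurable_oddExt h.continuous).aestronglyMeasurable (norm_oddExt_le h.bound_deriv)))
    (hasDerivAt_evenExt h.hasDerivAt)
    (.inl (continuous_evenExt h.continuous_self).continuousAt)

theorem memLp_evenExt (h : IsProfile c M U V) (hc : 0 < c) : MemLp (evenExt U) 2 volume :=
  memLp_of_norm_le_exp hc (continuous_evenExt h.continuous_self).aestronglyMeasurable
    (norm_evenExt_le h.bound)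

theorem memLp_oddExt (h : IsProfile c M U V) (hc : 0 < c) : MemLp (oddExt V) 2 volume :=
  memLp_of_norm_le_exp hc (measurable_oddExt h.continuous).aestronglyMeasurable
    (norm_oddExt_le h.bound_deriv)

theorem memH1 (h : IsProfile c M U V) (hc : 0 < c) : MemH1 univ (evenExt U) := by
  refine ⟨?_, oddExt V, ?_, h.isWeakDeriv_evenExt hc _⟩
  · rw [Measure.restrict_univ]; exact h.memLp_evenExt hc
  · rw [Measure.restrict_univ]; exact h.memLp_oddExt hc

theorem memH1_weighted (h : IsProfile c M U V) (hγ : 0 ≤ γ) (hc : γ < c) :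
    MemH1 univ (weighted γ (evenExt U)) := by
  rw [weighted_evenExt]
  exact (h.weighted_profile hγ).memH1 (by linarith)

/-- The even extension as an element of the weighted space. -/
def toWeightedH1 (h : IsProfile c M U V) (hγ : 0 ≤ γ) (hc : γ < c) : WeightedH1 γ :=
  ⟨AEEqFun.mk (evenExt U) (continuous_evenExt h.continuous_self).aestronglyMeasurable,
    (h.memH1_weighted hγ hc).congr (weighted_congr γ (AEEqFun.coeFn_mk _ _).symm)⟩

theorem coe_toWeightedH1 (h : IsProfile c M U V) (hγ : 0 ≤ γ) (hc : γ < c) :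
    (h.toWeightedH1 hγ hc : ℝ → ℂ) =ᵐ[volume] evenExt U :=
  AEEqFun.coeFn_mk _ _

end IsProfile

theorem WeightedH1.ext_ae {γ : ℝ} {u v : WeightedH1 γ} (h : (u : ℝ → ℂ) =ᵐ[volume] v) : u = v :=
  Subtype.ext (AEEqFun.ext h)

theorem WeightedH1.norm_toL2_le {γ : ℝ} (u : WeightedH1 γ) :
    ‖u.memLp_weighted.toLp _‖ ≤ ‖u‖ ∧ ‖u.memLp_weightedDeriv.toLp _‖ ≤ ‖u‖ :=
  ⟨WithLp.norm_fst_le _ (toL2Prod γ u), WithLp.norm_snd_le _ (toL2Prod γ u)⟩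

theorem WeightedH1.norm_le_add {γ : ℝ} (u : WeightedH1 γ) :
    ‖u‖ ≤ ‖u.memLp_weighted.toLp _‖ + ‖u.memLp_weightedDeriv.toLp _‖ := by
  have h : ‖u‖ = ‖toL2Prod γ u‖ := rfl
  rw [h, WithLp.prod_norm_eq_of_L2]
  refine Real.sqrt_le_iff.2 ⟨by positivity, ?_⟩
  have h1 := norm_nonneg (u.memLp_weighted.toLp _)
  have h2 := norm_nonneg (u.memLp_weightedDeriv.toLp _)
  change ‖u.memLp_weighted.toLp _‖ ^ 2 + ‖u.memLp_weightedDeriv.toLp _‖ ^ 2 ≤ _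
  nlinarith [mul_nonneg h1 h2]

/-- The point is that `B` depends only on the two rates. This is what turns pointwise decay
estimates into operator bounds with values in the weighted space. -/
theorem IsProfile.norm_le {c γ : ℝ} (hγ : 0 ≤ γ) (hc : γ < c) :
    ∃ B : ℝ, 0 < B ∧ ∀ (M : ℝ) (U V : ℝ → ℝ), IsProfile c M U V →
      ∀ u : WeightedH1 γ, (u : ℝ → ℂ) =ᵐ[volume] evenExt U → ‖u‖ ≤ B * M := by
  have hc' : 0 < c - γ := by linarith
  set e := (memLp_exp_neg_mul_abs hc').toLp _ with he
  refine ⟨2 * (1 + γ) * (‖e‖ + 1), by positivity, fun M U V h u hu => ?_⟩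
  have hw := h.weighted_profile hγ
  have hM := h.nonneg
  have e1 : weighted γ u =ᵐ[volume] evenExt (fun x => Real.exp (γ * x) * U x) := by
    rw [← IsProfile.weighted_evenExt]; exact weighted_congr γ hu
  have e2 : u.weightedDeriv =ᵐ[volume] oddExt (fun x => Real.exp (γ * x) * (V x + γ * U x)) :=
    (u.isWeakDeriv.congr_left e1).unique (hw.isWeakDeriv_evenExt hc' _)
  have b1 : ‖u.memLp_weighted.toLp _‖ ≤ (1 + γ) * M * ‖e‖ := by
    refine Lp.norm_le_mul_norm_of_ae_le_mul ?_
    filter_upwards [u.memLp_weighted.coeFn_toLp, (memLp_exp_neg_mul_abs hc').coeFn_toLp, e1]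
      with x h1 h2 h3
    rw [h1, h3, he, h2, Real.norm_eq_abs, Real.abs_exp]
    exact norm_evenExt_le hw.bound x
  have b2 : ‖u.memLp_weightedDeriv.toLp _‖ ≤ (1 + γ) * M * ‖e‖ := by
    refine Lp.norm_le_mul_norm_of_ae_le_mul ?_
    filter_upwards [u.memLp_weightedDeriv.coeFn_toLp, (memLp_exp_neg_mul_abs hc').coeFn_toLp, e2]
      with x h1 h2 h3
    rw [h1, h3, he, h2, Real.norm_eq_abs, Real.abs_exp]
    exact norm_oddExt_le hw.bound_deriv x
  have : 0 ≤ (1 + γ) * M := by positivity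
  calc ‖u‖ ≤ _ := u.norm_le_add
    _ ≤ (1 + γ) * M * ‖e‖ + (1 + γ) * M * ‖e‖ := add_le_add b1 b2
    _ ≤ _ := by nlinarith

/-- The derivative of an even extension is odd, so its jump at 0 is twice the one-sided value. The
Robin condition `h0` is therefore exactly the delta jump condition, and away from 0 the second
derivative is again even. -/
theorem isDeltaHamiltonian_smul_evenExt {c M M' : ℝ} {f f₁ f₂ : ℝ → ℝ} (hc : 0 < c)
    (h : IsProfile c M f f₁) (h' : IsProfile c M' f₁ f₂) (h0 : f₁ 0 = -f 0 / 2) (z : ℂ)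
    {u : ℝ → ℂ} (hu : u =ᵐ[volume] z • evenExt f) :
    IsDeltaHamiltonian 1 u (-(z • evenExt f₂)) := by
  have m2 : MemLp (evenExt f₂) 2 volume :=
    memLp_of_norm_le_exp hc (continuous_evenExt h'.continuous).aestronglyMeasurable
      (norm_evenExt_le h'.bound_deriv)
  refine ⟨(MemH1.smul z (h.memH1 hc)).congr hu.symm, z • evenExt f, z • oddExt f₁,
    z • evenExt f₂, z * f₁ 0, z * (-f₁ 0), (continuous_evenExt h.continuous_self).const_smul z,
    hu.symm, ?_, (h.memLp_oddExt hc).const_smul z, ?_, m2.const_smul z, ?_, ?_, ?_,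
    Filter.EventuallyEq.rfl⟩
  · refine IsWeakDeriv.congr_left (u := z • evenExt f) ?_ hu.symm
    exact .of_hasDerivAt
      ((continuous_evenExt h.continuous_self).const_smul z).locallyIntegrable
      (locallyIntegrable_of_memLp ((h.memLp_oddExt hc).const_smul z))
      (fun x hx => (hasDerivAt_evenExt h.hasDerivAt x hx).const_smul z) (.inr (by simp))
  · exact .of_hasDerivAt
      (locallyIntegrable_of_memLp ((h.memLp_oddExt hc).const_smul z))
      (locallyIntegrable_of_memLp (m2.const_smul z))
      (fun x hx => (hasDerivAt_oddExt h'.hasDerivAt x hx).const_smul z) (.inr (by simp))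
  · refine Tendsto.const_mul z ?_
    have : Tendsto (fun x : ℝ => (f₁ x : ℂ)) (𝓝[>] 0) (𝓝 (f₁ 0)) :=
      ((Complex.continuous_ofReal.comp h.continuous).tendsto 0).mono_left nhdsWithin_le_nhds
    refine this.congr' ?_
    filter_upwards [self_mem_nhdsWithin] with x hx
    have hx' : 0 < x := hx
    simp [oddExt, hx', abs_of_pos]
  · refine Tendsto.const_mul z ?_
    have : Tendsto (fun x : ℝ => (-f₁ (-x) : ℂ)) (𝓝[<] 0) (𝓝 (-f₁ 0)) := by
      have h1 : Continuous fun x : ℝ => (-f₁ (-x) : ℂ) := by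
        have := h.continuous
        fun_prop
      simpa using (h1.tendsto 0).mono_left nhdsWithin_le_nhds
    refine this.congr' ?_
    filter_upwards [self_mem_nhdsWithin] with x hx
    have hx' : x < 0 := hx
    simp [oddExt, hx', abs_of_neg]
  · simp only [evenExt, Pi.smul_apply, abs_zero, h0, smul_eq_mul]
    push_cast; ring

end DeltaNLS

namespace DeltaNLS

/-! ### Weak derivatives on intervals -/

theorem integrable_smul_of_locallyIntegrableOn {I : Set ℝ} {η : ℝ → ℝ} (hη : Continuous η)
    (hc : HasCompactSupport η) (hs : tsupport η ⊆ I) {u : ℝ → ℂ} (hu : LocallyIntegrableOn u I) :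
    Integrable (fun x => η x • u x) := by
  have h1 : IntegrableOn u (tsupport η) := hu.integrableOn_compact_subset hs hc.isCompact
  have h2 : IntegrableOn (fun x => η x • u x) (tsupport η) :=
    h1.continuousOn_smul hη.continuousOn hc.isCompact
  refine (integrableOn_iff_integrable_of_support_subset fun x hx => ?_).1 h2
  apply subset_tsupport
  intro h
  exact hx (by simp [h])

theorem integral_deriv_smul_of_hasDerivAt {I : Set ℝ} (hI : IsOpen I) {u w : ℝ → ℂ}
    (hd : ∀ x ∈ I, HasDerivAt u (w x) x) (hw : ContinuousOn w I) {η : ℝ → ℝ}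
    (hη : ContDiff ℝ ∞ η) (hc : HasCompactSupport η) (hs : tsupport η ⊆ I) :
    ∫ x, deriv η x • u x = -∫ x, η x • w x := by
  have hu : ContinuousOn u I := fun x hx => (hd x hx).continuousAt.continuousWithinAt
  have i1 : Integrable (fun x => deriv η x • u x) :=
    integrable_smul_of_locallyIntegrableOn (hη.continuous_deriv (by simp)) hc.deriv
      ((tsupport_deriv_subset).trans hs) (hu.locallyIntegrableOn hI.measurableSet)
  have i2 : Integrable (fun x => η x • w x) :=
    integrable_smul_of_locallyIntegrableOn hη.continuous hc hs
      (hw.locallyIntegrableOn hI.measurableSet)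
  have key : ∀ x, HasDerivAt (fun y => η y • u y) (deriv η x • u x + η x • w x) x := by
    intro x
    by_cases hx : x ∈ tsupport η
    · have := ((hη.differentiable (by simp) x).hasDerivAt).smul (hd x (hs hx))
      rwa [add_comm] at this
    · have h1 := notMem_tsupport_iff_eventuallyEq.1 hx
      have h2 : deriv η x = 0 := by
        rw [h1.deriv_eq]; simp
      have h3 : (fun y => η y • u y) =ᶠ[𝓝 x] fun _ => 0 := by
        filter_upwards [h1] with y hy
        simp [hy]
      rw [h2, h1.self_of_nhds]
      simpa using (hasDerivAt_const x (0 : ℂ)).congr_of_eventuallyEq h3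
  have hcs : HasCompactSupport (fun y => η y • u y) := hc.smul_right
  have i3 : Integrable (fun y => η y • u y) :=
    integrable_smul_of_locallyIntegrableOn hη.continuous hc hs
      (hu.locallyIntegrableOn hI.measurableSet)
  have h3 := integral_eq_zero_of_hasDerivAt_of_integrable key (i1.add i2) i3
  rw [integral_add i1 i2] at h3
  exact eq_neg_of_add_eq_zero_left h3

/-- Integrating from m - 1, left of the support, gives a primitive that vanishes before m, and
beyond M because the total integral is zero. Order-connectedness places the whole hull [m, M] of the
support inside `I`. -/
theorem exists_test_antideriv {I : Set ℝ} (ho : I.OrdConnected) {θ : ℝ → ℝ}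
    (hθ : ContDiff ℝ ∞ θ) (hc : HasCompactSupport θ) (hs : tsupport θ ⊆ I) (h0 : ∫ x, θ x = 0) :
    ∃ η : ℝ → ℝ, ContDiff ℝ ∞ η ∧ HasCompactSupport η ∧ tsupport η ⊆ I ∧ deriv η = θ := by
  rcases (tsupport θ).eq_empty_or_nonempty with he | hne
  · refine ⟨0, contDiff_const, HasCompactSupport.zero, by simp [tsupport], ?_⟩
    rw [tsupport_eq_empty_iff] at he
    rw [he]; funext x; simp
  obtain ⟨m, hm, hm'⟩ := hc.isCompact.exists_isLeast hne
  obtain ⟨M, hM, hM'⟩ := hc.isCompact.exists_isGreatest hne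
  have hz : ∀ x, x < m ∨ M < x → θ x = 0 := by
    intro x hx
    apply image_eq_zero_of_notMem_tsupport
    intro h
    rcases hx with hx | hx
    · exact absurd (hm' h) (not_le.2 hx)
    · exact absurd (hM' h) (not_le.2 hx)
  have hd : ∀ x, HasDerivAt (fun x => ∫ t in (m - 1)..x, θ t) (θ x) x := fun x =>
    intervalIntegral.integral_hasDerivAt_right (hθ.continuous.intervalIntegrable _ _)
      hθ.continuous.stronglyMeasurable.stronglyMeasurableAtFilter hθ.continuous.continuousAt
  have hderiv : deriv (fun x => ∫ t in (m - 1)..x, θ t) = θ := funext fun x => (hd x).deriv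
  have hsupp : Function.support (fun x => ∫ t in (m - 1)..x, θ t) ⊆ Icc m M := by
    intro x hx
    by_contra hcon
    apply hx
    rw [mem_Icc, not_and_or, not_le, not_le] at hcon
    simp only
    rcases hcon with h | h
    · refine intervalIntegral.integral_zero_ae (Eventually.of_forall fun t ht => hz t (.inl ?_))
      rcases mem_uIoc.1 ht with ht | ht <;> linarith [ht.1, ht.2]
    · rw [intervalIntegral.integral_eq_integral_of_support_subset, h0]
      intro t ht
      have h1 : m ≤ t := not_lt.1 fun h' => ht (hz t (.inl h'))
      have h2 : t ≤ M := not_lt.1 fun h' => ht (hz t (.inr h'))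
      exact ⟨by linarith, by linarith⟩
  have hts : tsupport (fun x => ∫ t in (m - 1)..x, θ t) ⊆ Icc m M :=
    closure_minimal hsupp isClosed_Icc
  refine ⟨_, ?_, isCompact_Icc.of_isClosed_subset (isClosed_tsupport _) hts,
    hts.trans (ho.out (hs hm) (hs hM)), hderiv⟩
  rw [contDiff_infty_iff_deriv, hderiv]
  exact ⟨fun x => (hd x).differentiableAt, hθ⟩

/-- The du Bois-Reymond argument: subtracting (∫ψ) ψ₀ from a test function ψ, with ψ₀ a fixed bump
of mass one, leaves a function of mean zero, which is the derivative of a test function. So u pairs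
with every ψ as the constant ∫ψ₀u does. -/
theorem ae_const_of_integral_deriv_smul_eq_zero {I : Set ℝ} (hI : IsOpen I) (ho : I.OrdConnected)
    {u : ℝ → ℂ} (hu : LocallyIntegrableOn u I)
    (h : ∀ η : ℝ → ℝ, ContDiff ℝ ∞ η → HasCompactSupport η → tsupport η ⊆ I →
      ∫ x, deriv η x • u x = 0) : ∃ c : ℂ, ∀ᵐ x, x ∈ I → u x = c := by
  rcases I.eq_empty_or_nonempty with rfl | ⟨x₀, hx₀⟩
  · exact ⟨0, by simp⟩
  obtain ⟨ε, hε, hεI⟩ := Metric.nhds_basis_closedBall.mem_iff.1 (hI.mem_nhds hx₀)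
  let b : ContDiffBump x₀ := ⟨ε / 2, ε, by linarith, by linarith⟩
  set ψ₀ := b.normed volume with hψ₀
  have c0 : ContDiff ℝ ∞ ψ₀ := b.contDiff_normed
  have s0 : HasCompactSupport ψ₀ := b.hasCompactSupport_normed
  have t0 : tsupport ψ₀ ⊆ I := by rw [hψ₀, b.tsupport_normed_eq]; exact hεI
  have i0 : ∫ x, ψ₀ x = 1 := b.integral_normed
  refine ⟨∫ x, ψ₀ x • u x, ?_⟩
  have := hI.ae_eq_zero_of_integral_contDiff_smul_eq_zero (μ := volume)
    (f := fun x => u x - ∫ x, ψ₀ x • u x) (hu.sub (locallyIntegrable_const _ |>.locallyIntegrableOn _)) ?_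
  · filter_upwards [this] with x hx hxI
    exact sub_eq_zero.1 (hx hxI)
  intro ψ hψ hψc hψs
  set c := ∫ x, ψ₀ x • u x
  have iψ : Integrable (fun x => ψ x • u x) :=
    integrable_smul_of_locallyIntegrableOn hψ.continuous hψc hψs hu
  have iψ₀ : Integrable (fun x => ψ₀ x • u x) :=
    integrable_smul_of_locallyIntegrableOn c0.continuous s0 t0 hu
  have jψ : Integrable ψ := hψ.continuous.integrable_of_hasCompactSupport hψc
  have jψ₀ : Integrable ψ₀ := c0.continuous.integrable_of_hasCompactSupport s0
  set d := ∫ x, ψ x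
  obtain ⟨η, e1, e2, e3, e4⟩ := exists_test_antideriv ho (θ := ψ - d • ψ₀) (hψ.sub (c0.const_smul d))
    (hψc.sub (s0.smul_left (f := fun _ => d)))
    ((tsupport_sub _ _).trans (union_subset hψs
      ((closure_mono (Function.support_const_smul_subset d ψ₀)).trans t0)))
    (by
      simp only [Pi.sub_apply, Pi.smul_apply]
      rw [integral_sub jψ (show Integrable (fun x => d • ψ₀ x) from jψ₀.smul d), integral_smul, i0]
      simp [d])
  have h1 := h η e1 e2 e3
  rw [e4] at h1
  simp only [Pi.sub_apply, Pi.smul_apply, sub_smul, smul_assoc] at h1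
  rw [integral_sub iψ (show Integrable (fun x => d • ψ₀ x • u x) from iψ₀.smul d), integral_smul,
    sub_eq_zero] at h1
  simp only [smul_sub]
  rw [integral_sub iψ (jψ.smul_const c), h1, integral_smul_const, sub_self]

/-- A function whose weak derivative is continuous on an interval is classically differentiable
there, up to modification on a null set. -/
theorem IsWeakDeriv.exists_hasDerivAt {Ω I : Set ℝ} (hI : IsOpen I) (ho : I.OrdConnected)
    (hIΩ : I ⊆ Ω) {u w w₀ : ℝ → ℂ} (h : IsWeakDeriv Ω u w) (hw : ∀ᵐ x, x ∈ I → w x = w₀ x)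
    (hc : ContinuousOn w₀ I) :
    ∃ u₀ : ℝ → ℂ, (∀ x ∈ I, HasDerivAt u₀ (w₀ x) x) ∧ ∀ᵐ x, x ∈ I → u x = u₀ x := by
  rcases I.eq_empty_or_nonempty with rfl | ⟨x₀, hx₀⟩
  · exact ⟨0, by simp, by simp⟩
  set W : ℝ → ℂ := fun x => ∫ t in x₀..x, w₀ t
  have hW : ∀ x ∈ I, HasDerivAt W (w₀ x) x := by
    intro x hx
    refine intervalIntegral.integral_hasDerivAt_right ?_
      (hc.stronglyMeasurableAtFilter hI x hx) (hc.continuousAt (hI.mem_nhds hx))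
    exact (hc.mono (ho.uIcc_subset hx₀ hx)).intervalIntegrable
  have hWc : ContinuousOn W I := fun x hx => (hW x hx).continuousAt.continuousWithinAt
  have lW := hWc.locallyIntegrableOn (μ := volume) hI.measurableSet
  have lu := h.1.mono_set hIΩ
  obtain ⟨c, hcon⟩ := ae_const_of_integral_deriv_smul_eq_zero hI ho (lu.sub lW) (by
    intro η e1 e2 e3
    have d1 : Continuous (deriv η) := e1.continuous_deriv (by simp)
    have d2 := (tsupport_deriv_subset).trans e3
    simp only [Pi.sub_apply, smul_sub]
    rw [integral_sub (integrable_smul_of_locallyIntegrableOn d1 e2.deriv d2 lu)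
      (integrable_smul_of_locallyIntegrableOn d1 e2.deriv d2 lW),
      h.2.2 η e1 e2 (e3.trans hIΩ), integral_deriv_smul_of_hasDerivAt hI hW hc e1 e2 e3, sub_eq_zero]
    congr 1
    refine integral_congr_ae ?_
    filter_upwards [hw] with x hx
    by_cases hxI : x ∈ I
    · rw [hx hxI]
    · rw [image_eq_zero_of_notMem_tsupport fun h => hxI (e3 h)]; simp)
  refine ⟨fun x => W x + c, fun x hx => (hW x hx).add_const c, ?_⟩
  filter_upwards [hcon] with x hx hxI
  rw [← hx hxI]
  simp

theorem IsWeakDeriv.ae_eq_of_hasDerivAt {Ω I : Set ℝ} (hI : IsOpen I)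
    (hIΩ : I ⊆ Ω) {u w u₀ w₀ : ℝ → ℂ} (h : IsWeakDeriv Ω u w) (hu : ∀ᵐ x, x ∈ I → u x = u₀ x)
    (hd : ∀ x ∈ I, HasDerivAt u₀ (w₀ x) x) (hc : ContinuousOn w₀ I) :
    ∀ᵐ x, x ∈ I → w x = w₀ x := by
  have lw := h.2.1.mono_set hIΩ
  have lw₀ := hc.locallyIntegrableOn (μ := volume) hI.measurableSet
  have := hI.ae_eq_zero_of_integral_contDiff_smul_eq_zero (lw.sub lw₀) (fun η e1 e2 e3 => by
    simp only [Pi.sub_apply, smul_sub]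
    rw [integral_sub (integrable_smul_of_locallyIntegrableOn e1.continuous e2 e3 lw)
      (integrable_smul_of_locallyIntegrableOn e1.continuous e2 e3 lw₀), sub_eq_zero]
    have h1 := h.2.2 η e1 e2 (e3.trans hIΩ)
    have h2 := integral_deriv_smul_of_hasDerivAt hI hd hc e1 e2 e3
    have h3 : ∫ x, deriv η x • u x = ∫ x, deriv η x • u₀ x := by
      refine integral_congr_ae ?_
      filter_upwards [hu] with x hx
      by_cases hxI : x ∈ I
      · rw [hx hxI]
      · rw [image_eq_zero_of_notMem_tsupport fun h => hxI (e3 (tsupport_deriv_subset h))]; simp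
    rw [h1, h2] at h3
    exact neg_injective h3)
  filter_upwards [this] with x hx hxI
  exact sub_eq_zero.1 (hx hxI)

end DeltaNLS

namespace DeltaNLS

/-! ### Energy identities on the half line -/

-- Integration by parts on a half line. No boundary term appears at infinity: the product and its
-- derivative are both integrable, as products of square integrable functions, so the product tends
-- to 0.
open ComplexConjugate in
theorem integral_Ioi_conj_mul_deriv {u v u₁ v₁ : ℝ → ℂ} {a b : ℂ} {x₀ : ℝ}
    (hu : ∀ x ∈ Ioi x₀, HasDerivAt u (u₁ x) x) (hv : ∀ x ∈ Ioi x₀, HasDerivAt v (v₁ x) x)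
    (mu : MemLp u 2 (volume.restrict (Ioi x₀))) (mv : MemLp v 2 (volume.restrict (Ioi x₀)))
    (mu₁ : MemLp u₁ 2 (volume.restrict (Ioi x₀))) (mv₁ : MemLp v₁ 2 (volume.restrict (Ioi x₀)))
    (la : Tendsto u (𝓝[>] x₀) (𝓝 a)) (lb : Tendsto v (𝓝[>] x₀) (𝓝 b)) :
    IntegrableOn (fun x => conj (u₁ x) * v x) (Ioi x₀) ∧
    IntegrableOn (fun x => conj (u x) * v₁ x) (Ioi x₀) ∧
    (∫ x in Ioi x₀, conj (u₁ x) * v x) + ∫ x in Ioi x₀, conj (u x) * v₁ x = -(conj a * b) := by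
  have i1 : IntegrableOn (fun x => conj (u₁ x) * v x) (Ioi x₀) := mu₁.star.integrable_mul mv
  have i2 : IntegrableOn (fun x => conj (u x) * v₁ x) (Ioi x₀) := mu.star.integrable_mul mv₁
  have i3 : IntegrableOn (fun x => conj (u x) * v x) (Ioi x₀) := mu.star.integrable_mul mv
  have hu' : ∀ x ∈ Ioi x₀, HasDerivAt (fun x => conj (u x)) (conj (u₁ x)) x := fun x hx =>
    (hu x hx).star
  have hinf : Tendsto (fun x => conj (u x) * v x) atTop (𝓝 0) :=
    tendsto_zero_of_hasDerivAt_of_integrableOn_Ioi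
      (fun x hx => (hu' x hx).mul (hv x hx)) (i1.add i2) i3
  have h := integral_Ioi_deriv_mul_eq_sub hu' hv (i1.add i2)
    (((Complex.continuous_conj.tendsto a).comp la).mul lb) hinf
  rw [integral_add i1 i2] at h
  exact ⟨i1, i2, by rw [h, zero_sub]⟩

/-- `u` is twice differentiable on `(0,∞)` with derivatives `v`, `w`, all three square integrable,
and `a`, `ℓ` are the limits of `u`, `v` at `0⁺`. -/
structure IsHalfLineH2 (u v w : ℝ → ℂ) (a ℓ : ℂ) : Prop where
  du : ∀ x ∈ Ioi (0 : ℝ), HasDerivAt u (v x) x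
  dv : ∀ x ∈ Ioi (0 : ℝ), HasDerivAt v (w x) x
  mu : MemLp u 2 (volume.restrict (Ioi 0))
  mv : MemLp v 2 (volume.restrict (Ioi 0))
  mw : MemLp w 2 (volume.restrict (Ioi 0))
  la : Tendsto u (𝓝[>] 0) (𝓝 a)
  lℓ : Tendsto v (𝓝[>] 0) (𝓝 ℓ)

theorem hasDerivAt_exp_neg_half (x : ℝ) :
    HasDerivAt (fun x : ℝ => (Real.exp (-(1 / 2) * x) : ℂ))
      (-(1 / 2) * (Real.exp (-(1 / 2) * x) : ℂ)) x := by
  have h1 : HasDerivAt (fun x : ℝ => Real.exp (-(1 / 2) * x)) (Real.exp (-(1 / 2) * x) * (-(1 / 2)))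
    x := by simpa using ((hasDerivAt_id x).const_mul (-(1 / 2 : ℝ))).exp
  have := h1.ofReal_comp
  convert this using 1
  push_cast; ring

theorem memLp_exp_neg_half :
    MemLp (fun x : ℝ => (Real.exp (-(1 / 2) * x) : ℂ)) 2 (volume.restrict (Ioi 0)) := by
  have h1 := ((memLp_exp_neg_mul_abs (c := 1 / 2) (by norm_num)).restrict (Ioi 0)).ofReal (K := ℂ)
  refine h1.ae_eq ?_
  filter_upwards [ae_restrict_mem measurableSet_Ioi] with x hx
  rw [abs_of_pos (mem_Ioi.1 hx)]
  rfl

namespace IsHalfLineH2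

variable {u v w u' v' w' : ℝ → ℂ} {a ℓ a' ℓ' : ℂ}

theorem sub (h : IsHalfLineH2 u v w a ℓ) (h' : IsHalfLineH2 u' v' w' a' ℓ') :
    IsHalfLineH2 (u - u') (v - v') (w - w') (a - a') (ℓ - ℓ') :=
  ⟨fun x hx => (h.du x hx).sub (h'.du x hx), fun x hx => (h.dv x hx).sub (h'.dv x hx),
    h.mu.sub h'.mu, h.mv.sub h'.mv, h.mw.sub h'.mw, h.la.sub h'.la, h.lℓ.sub h'.lℓ⟩

theorem tendsto_exp_neg_half :
    Tendsto (fun x : ℝ => (Real.exp (-(1 / 2) * x) : ℂ)) (𝓝[>] 0) (𝓝 1) := by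
  have : Continuous (fun x : ℝ => (Real.exp (-(1 / 2) * x) : ℂ)) := by fun_prop
  simpa using (this.tendsto 0).mono_left nhdsWithin_le_nhds

/-- Green's identity against `e^{-x/2}`. -/
theorem integral_exp_mul (h : IsHalfLineH2 u v w a ℓ) :
    ∫ x in Ioi (0 : ℝ), (Real.exp (-(1 / 2) * x) : ℂ) * (u x / 4 - w x) = ℓ + a / 2 := by
  have d := fun (x : ℝ) (_ : x ∈ Ioi (0 : ℝ)) => hasDerivAt_exp_neg_half x
  have m := memLp_exp_neg_half
  have m' := m.const_mul (-(1 / 2) : ℂ)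
  obtain ⟨i1, i2, e1⟩ := integral_Ioi_conj_mul_deriv d h.dv m h.mv m' h.mw tendsto_exp_neg_half h.lℓ
  obtain ⟨-, i3, e2⟩ := integral_Ioi_conj_mul_deriv d h.du m h.mu m' h.mv tendsto_exp_neg_half h.la
  have i4 : IntegrableOn (fun x => (Real.exp (-(1 / 2) * x) : ℂ) * u x) (Ioi 0) :=
    m.integrable_mul h.mu
  simp only [map_mul, Complex.conj_ofReal, map_one, one_mul, map_neg, map_div₀, map_ofNat,
    mul_assoc] at e1 e2 i1 i2 i3
  rw [integral_const_mul] at e1 e2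
  have : ∀ x : ℝ, (Real.exp (-(1 / 2) * x) : ℂ) * (u x / 4 - w x) =
      (1 / 4) * ((Real.exp (-(1 / 2) * x) : ℂ) * u x) - (Real.exp (-(1 / 2) * x) : ℂ) * w x :=
    fun x => by ring
  simp only [this]
  rw [integral_sub (i4.const_mul _) i2, integral_const_mul]
  linear_combination -e1 - (1 / 2) * e2

-- Put e = e^{-x/2} and y = u - a e, so that y vanishes at the end point. As e' + e/2 = 0, one has
-- u' + u/2 = y' + y/2; expanding the squares, the cross terms integrate to -‖a‖²/2 for u and to 0
-- for y. This expresses the right side as ∫|y'|² + ¼∫|y|², and the first term is dropped.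
open ComplexConjugate in
theorem coercive (h : IsHalfLineH2 u v w a ℓ) :
    1 / 4 * ∫ x in Ioi (0 : ℝ), ‖u x - a * (Real.exp (-(1 / 2) * x) : ℂ)‖ ^ 2 ≤
      (∫ x in Ioi (0 : ℝ), (conj (u x) * (u x / 4 - w x)).re) - (conj a * ℓ).re -
        1 / 2 * ‖a‖ ^ 2 := by
  set e : ℝ → ℂ := fun x => (Real.exp (-(1 / 2) * x) : ℂ) with he
  set y : ℝ → ℂ := fun x => u x - a * e x with hy
  set y₁ : ℝ → ℂ := fun x => v x + a / 2 * e x with hy₁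
  have dy : ∀ x ∈ Ioi (0 : ℝ), HasDerivAt y (y₁ x) x := fun x hx =>
    ((h.du x hx).sub ((hasDerivAt_exp_neg_half x).const_mul a)).congr_deriv (by
      simp only [hy₁, he]; ring)
  have my : MemLp y 2 (volume.restrict (Ioi 0)) := h.mu.sub (memLp_exp_neg_half.const_mul a)
  have my₁ : MemLp y₁ 2 (volume.restrict (Ioi 0)) :=
    h.mv.add (memLp_exp_neg_half.const_mul (a / 2))
  have ly : Tendsto y (𝓝[>] 0) (𝓝 0) := by
    have := h.la.sub (tendsto_exp_neg_half.const_mul a)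
    rwa [mul_one, sub_self] at this
  obtain ⟨i1, i2, e1⟩ := integral_Ioi_conj_mul_deriv h.du h.dv h.mu h.mv h.mv h.mw h.la h.lℓ
  obtain ⟨i3, i4, e2⟩ := integral_Ioi_conj_mul_deriv h.du h.du h.mu h.mu h.mv h.mv h.la h.la
  obtain ⟨i5, i6, e3⟩ := integral_Ioi_conj_mul_deriv dy dy my my my₁ my₁ ly ly
  have i7 : IntegrableOn (fun x => conj (u x) * u x) (Ioi 0) := h.mu.star.integrable_mul h.mu
  have i8 : IntegrableOn (fun x => conj (y x) * y x) (Ioi 0) := my.star.integrable_mul my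
  have i9 : IntegrableOn (fun x => conj (y₁ x) * y₁ x) (Ioi 0) := my₁.star.integrable_mul my₁
  -- The expanded form of |u' + u/2|² = |y' + y/2|².
  have pt : ∀ x, conj (v x) * v x + 1 / 4 * (conj (u x) * u x) +
      1 / 2 * (conj (v x) * u x) + 1 / 2 * (conj (u x) * v x) = conj (y₁ x) * y₁ x +
      1 / 4 * (conj (y x) * y x) + 1 / 2 * (conj (y₁ x) * y x) + 1 / 2 * (conj (y x) * y₁ x) := by
    intro x
    have h1 : v x + u x / 2 = y₁ x + y x / 2 := by simp only [hy, hy₁]; ring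
    have h2 := congrArg conj h1
    simp only [map_add, map_div₀, map_ofNat] at h2
    linear_combination (conj (v x) + conj (u x) / 2) * h1 + (y₁ x + y x / 2) * h2
  have E := integral_congr_ae (μ := volume.restrict (Ioi 0)) (Eventually.of_forall pt)
  have q1 : ∀ f : ℝ → ℂ, IntegrableOn f (Ioi 0) → ∀ c : ℂ,
      IntegrableOn (fun x => c * f x) (Ioi 0) := fun f hf c => hf.const_mul c
  have lin : ∀ A B C D : ℝ → ℂ, IntegrableOn A (Ioi 0) → IntegrableOn B (Ioi 0) →
      IntegrableOn C (Ioi 0) → IntegrableOn D (Ioi 0) →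
      ∫ x in Ioi (0 : ℝ), (A x + 1 / 4 * B x + 1 / 2 * C x + 1 / 2 * D x) =
        (∫ x in Ioi (0 : ℝ), A x) + 1 / 4 * (∫ x in Ioi (0 : ℝ), B x) +
          1 / 2 * (∫ x in Ioi (0 : ℝ), C x) + 1 / 2 * ∫ x in Ioi (0 : ℝ), D x := by
    intro A B C D hA hB hC hD
    have k1 : IntegrableOn (fun x => A x + 1 / 4 * B x) (Ioi 0) := hA.add (q1 _ hB _)
    have k2 : IntegrableOn (fun x => A x + 1 / 4 * B x + 1 / 2 * C x) (Ioi 0) := k1.add (q1 _ hC _)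
    rw [integral_add k2 (q1 _ hD _), integral_add k1 (q1 _ hC _), integral_add hA (q1 _ hB _)]
    simp only [integral_const_mul]
  rw [lin _ _ _ _ i1 i7 i3 i4, lin _ _ _ _ i9 i8 i5 i6] at E
  have s1 : (∫ x in Ioi (0 : ℝ), conj (y x) * y x) = ((∫ x in Ioi (0 : ℝ), ‖y x‖ ^ 2 : ℝ) : ℂ) := by
    rw [← integral_complex_ofReal]
    refine integral_congr_ae (Eventually.of_forall fun x => ?_)
    simp [Complex.conj_mul']
  have s2 : (∫ x in Ioi (0 : ℝ), conj (y₁ x) * y₁ x) =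
      ((∫ x in Ioi (0 : ℝ), ‖y₁ x‖ ^ 2 : ℝ) : ℂ) := by
    rw [← integral_complex_ofReal]
    refine integral_congr_ae (Eventually.of_forall fun x => ?_)
    simp [Complex.conj_mul']
  have s3 : 0 ≤ ∫ x in Ioi (0 : ℝ), ‖y₁ x‖ ^ 2 := integral_nonneg fun x => by positivity
  have s4 : (∫ x in Ioi (0 : ℝ), (conj (u x) * (u x / 4 - w x)).re) =
      (1 / 4 * (∫ x in Ioi (0 : ℝ), conj (u x) * u x) - ∫ x in Ioi (0 : ℝ), conj (u x) * w x).re := by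
    rw [← integral_const_mul, ← integral_sub (q1 _ i7 _) i2]
    have := integral_re (𝕜 := ℂ) ((q1 _ i7 (1 / 4)).sub i2)
    simp only [Pi.sub_apply, RCLike.re_eq_complex_re] at this
    rw [← this]
    refine integral_congr_ae (Eventually.of_forall fun x => ?_)
    simp only
    congr 1; ring
  have s5 : conj a * a = ((‖a‖ ^ 2 : ℝ) : ℂ) := by simp [Complex.conj_mul']
  rw [s4]
  rw [s1, s2] at E
  rw [s5] at e2
  simp only [map_zero, zero_mul, neg_zero] at e3
  have K : 1 / 4 * (∫ x in Ioi (0 : ℝ), conj (u x) * u x) - (∫ x in Ioi (0 : ℝ), conj (u x) * w x)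
      - conj a * ℓ - ((1 / 2 * ‖a‖ ^ 2 : ℝ) : ℂ) = ((∫ x in Ioi (0 : ℝ), ‖y₁ x‖ ^ 2 : ℝ) : ℂ) +
      ((1 / 4 * ∫ x in Ioi (0 : ℝ), ‖y x‖ ^ 2 : ℝ) : ℂ) := by
    push_cast at E e2 e3 ⊢
    linear_combination E - e1 - (1 / 2) * e2 + (1 / 2) * e3
  have K' := congrArg Complex.re K
  simp only [Complex.sub_re, Complex.add_re, Complex.ofReal_re] at K'
  simp only [Complex.sub_re]
  linarith

-- One-dimensional Sobolev embedding: |u(x₀)|² is minus the integral of (|u|²)' over (x₀, ∞), and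
-- 2|u||v| ≤ |u|² + |v|².
open ComplexConjugate in
theorem norm_sq_le (h : IsHalfLineH2 u v w a ℓ) {x₀ : ℝ} (hx₀ : 0 < x₀) :
    ‖u x₀‖ ^ 2 ≤ (∫ x in Ioi (0 : ℝ), ‖u x‖ ^ 2) + ∫ x in Ioi (0 : ℝ), ‖v x‖ ^ 2 := by
  have hs : Ioi x₀ ⊆ Ioi (0 : ℝ) := Ioi_subset_Ioi hx₀.le
  have d := fun (x : ℝ) (hx : x ∈ Ioi x₀) => h.du x (hs hx)
  have r : volume.restrict (Ioi x₀) ≤ volume.restrict (Ioi (0 : ℝ)) := Measure.restrict_mono hs le_rfl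
  have l : Tendsto u (𝓝[>] x₀) (𝓝 (u x₀)) :=
    (h.du x₀ hx₀).continuousAt.tendsto.mono_left nhdsWithin_le_nhds
  obtain ⟨i3, i4, e2⟩ := integral_Ioi_conj_mul_deriv d d (h.mu.mono_measure r) (h.mu.mono_measure r)
    (h.mv.mono_measure r) (h.mv.mono_measure r) l l
  have j1 : IntegrableOn (fun x => ‖u x‖ ^ 2) (Ioi 0) := h.mu.norm.integrable_sq
  have j2 : IntegrableOn (fun x => ‖v x‖ ^ 2) (Ioi 0) := h.mv.norm.integrable_sq
  have e3 : ‖u x₀‖ ^ 2 = ‖(∫ x in Ioi x₀, (conj (v x) * u x + conj (u x) * v x))‖ := by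
    rw [integral_add i3 i4, e2]; simp [sq]
  rw [e3, ← integral_add j1 j2]
  refine (norm_integral_le_integral_norm _).trans ?_
  refine (setIntegral_mono_on (i3.add i4).norm ((j1.add j2).mono_set hs) measurableSet_Ioi
    fun x _ => ?_).trans (setIntegral_mono_set (j1.add j2) (Eventually.of_forall fun x => ?_)
      hs.eventuallyLE)
  · refine (norm_add_le _ _).trans ?_
    simp only [norm_mul, RCLike.norm_conj, Pi.add_apply]
    nlinarith [sq_nonneg (‖u x‖ - ‖v x‖)]
  · simp only [Pi.add_apply, Pi.zero_apply]; positivity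

end IsHalfLineH2

end DeltaNLS

namespace DeltaNLS

/-! ### Bound states are classical solutions off the origin -/

theorem ae_comp_neg {p : ℝ → Prop} (h : ∀ᵐ x, p x) : ∀ᵐ x, p (-x) :=
  (Measure.measurePreserving_neg (volume : Measure ℝ)).quasiMeasurePreserving.ae h

theorem integral_eq_Ioi_add_Ioi_neg {E : Type*} [NormedAddCommGroup E] [NormedSpace ℝ E]
    {f : ℝ → E} (hf : Integrable f) :
    ∫ x, f x = (∫ x in Ioi (0 : ℝ), f x) + ∫ x in Ioi (0 : ℝ), f (-x) := by
  rw [integral_comp_neg_Ioi, neg_zero, add_comm, ← compl_Ioi, add_comm,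
    integral_add_compl measurableSet_Ioi hf]

/-- A one-sided limit of a representative passes to a continuous one. A point where v₀ is ε away
from ℓ has a whole open neighbourhood where it is ε/2 away, and a set of full measure meets that
neighbourhood. -/
theorem tendsto_of_ae_eq {I : Set ℝ} (hI : IsOpen I) {v v₀ : ℝ → ℂ} {ℓ : ℂ} {x₀ : ℝ}
    (h : ∀ᵐ x, x ∈ I → v x = v₀ x) (hc : ContinuousOn v₀ I) (hv : Tendsto v (𝓝[I] x₀) (𝓝 ℓ)) :
    Tendsto v₀ (𝓝[I] x₀) (𝓝 ℓ) := by
  rw [Metric.tendsto_nhdsWithin_nhds] at hv ⊢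
  intro ε hε
  obtain ⟨δ, hδ, hδ'⟩ := hv (ε / 2) (by linarith)
  refine ⟨δ, hδ, fun x hx hxδ => ?_⟩
  by_contra hcon
  rw [not_lt] at hcon
  have hx2 : v₀ x ∈ {y : ℂ | ε / 2 < dist y ℓ} := by
    change ε / 2 < dist (v₀ x) ℓ; linarith
  have hopen : IsOpen {y : ℂ | ε / 2 < dist y ℓ} :=
    isOpen_lt continuous_const (continuous_id.dist continuous_const)
  have hV : IsOpen (I ∩ v₀ ⁻¹' {y : ℂ | ε / 2 < dist y ℓ} ∩ Metric.ball x₀ δ) :=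
    (hc.isOpen_inter_preimage hI hopen).inter Metric.isOpen_ball
  obtain ⟨y, hyV, hy⟩ := (Measure.dense_of_ae h).inter_open_nonempty _ hV
    ⟨x, ⟨hx, hx2⟩, hxδ⟩
  have h1 := hδ' hyV.1.1 hyV.2
  have h2 : ε / 2 < dist (v₀ y) ℓ := hyV.1.2
  rw [hy hyV.1.1] at h1
  linarith

/-- The second derivative of a bound state. -/
def boundStateRHS (g : ℝ → ℝ) (E : ℝ) (u : ℝ → ℂ) (x : ℝ) : ℂ :=
  ((g (‖u x‖ ^ 2) : ℂ) - E) * u x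

theorem continuous_nonlinearity {g : ℝ → ℝ} (hg : ContinuousOn g (Ici 0)) {u : ℝ → ℂ}
    (hu : Continuous u) : Continuous fun x => (g (‖u x‖ ^ 2) : ℂ) * u x := by
  have h1 : Continuous fun x => g (‖u x‖ ^ 2) :=
    hg.comp_continuous (by fun_prop) fun x => by simp only [mem_Ici]; positivity
  exact (Complex.continuous_ofReal.comp h1).mul hu

theorem continuous_boundStateRHS {g : ℝ → ℝ} (hg : ContinuousOn g (Ici 0)) (E : ℝ) {u : ℝ → ℂ}
    (hu : Continuous u) : Continuous (boundStateRHS g E u) := by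
  have := continuous_nonlinearity hg hu
  have h2 : boundStateRHS g E u = fun x => (g (‖u x‖ ^ 2) : ℂ) * u x - E * u x := by
    funext x; simp only [boundStateRHS]; ring
  rw [h2]
  fun_prop

/-- A classical bound state: `u` is continuous and solves the equation on both half lines, with
derivatives `vp`, `vm` there, and the jump condition holds at the origin. -/
structure IsClassicalBoundState (g : ℝ → ℝ) (E : ℝ) (u vp vm : ℝ → ℂ) (ℓp ℓm : ℂ) : Prop where
  continuous : Continuous u
  memLp : MemLp u 2 volume
  right : IsHalfLineH2 u vp (boundStateRHS g E u) (u 0) ℓp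
  left : IsHalfLineH2 (fun x => u (-x)) (fun x => -vm (-x)) (fun x => boundStateRHS g E u (-x))
    (u 0) (-ℓm)
  jump : ℓp - ℓm = -u 0

/-- The regularity is climbed from the top: a continuous second derivative makes v classical, hence
continuous up to a null set, which makes u classical. As u is already continuous, almost everywhere
equality becomes equality. -/
theorem hasDerivAt_of_weakDeriv_twice {I : Set ℝ} (hI : IsOpen I) (ho : I.OrdConnected)
    (h0 : I ⊆ {0}ᶜ) {u v w w₀ : ℝ → ℂ} (hu : Continuous u) (h1 : IsWeakDeriv {0}ᶜ u v)
    (h2 : IsWeakDeriv {0}ᶜ v w) (hw : w =ᵐ[volume] w₀) (hw₀ : Continuous w₀) :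
    ∃ v₀ : ℝ → ℂ, (∀ x ∈ I, HasDerivAt u (v₀ x) x) ∧ (∀ x ∈ I, HasDerivAt v₀ (w₀ x) x) ∧
      ∀ᵐ x, x ∈ I → v x = v₀ x := by
  obtain ⟨v₀, dv, ev⟩ := h2.exists_hasDerivAt hI ho h0 (hw.mono fun x hx _ => hx)
    hw₀.continuousOn
  obtain ⟨u₀, du, eu⟩ := h1.exists_hasDerivAt hI ho h0 ev
    fun x hx => (dv x hx).continuousAt.continuousWithinAt
  have heq : EqOn u u₀ I := by
    refine Measure.eqOn_open_of_ae_eq (μ := volume) ?_ hI hu.continuousOn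
      fun x hx => (du x hx).continuousAt.continuousWithinAt
    rw [EventuallyEq, ae_restrict_iff' hI.measurableSet]
    exact eu
  exact ⟨v₀, fun x hx => (du x hx).congr_of_eventuallyEq
    (heq.eventuallyEq_of_mem (hI.mem_nhds hx)), dv, ev⟩

/-- The equation itself supplies the regularity, since it equates the second weak derivative with a
continuous function of the continuous representative. The left half line is reflected onto (0, ∞) so
that a single set of half-line identities serves both sides. -/
theorem IsBoundState.exists_classical {g : ℝ → ℝ} (hg : ContinuousOn g (Ici 0)) {E : ℝ}
    {U : ℝ → ℂ} (h : IsBoundState g E U) : ∃ u vp vm ℓp ℓm,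
      IsClassicalBoundState g E u vp vm ℓp ℓm ∧ u =ᵐ[volume] U := by
  obtain ⟨f, ⟨hU, u, v, w, ℓp, ℓm, hc, hae, wu, mv, wv, mw, lp, lm, jump, hf⟩, heq⟩ := h
  have hw : w =ᵐ[volume] boundStateRHS g E u := by
    filter_upwards [hf, heq, hae] with x h1 h2 h3
    rw [boundStateRHS, h3, sub_mul, ← h2, h1]
    simp
  have hwc := continuous_boundStateRHS hg E hc
  have mu : MemLp u 2 volume := by
    have := hU.1
    rw [Measure.restrict_univ] at this
    exact this.ae_eq hae.symm
  have mw' : MemLp (boundStateRHS g E u) 2 volume := mw.ae_eq hw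
  have hwu : IsWeakDeriv {0}ᶜ u v := wu.congr_left hae.symm
  obtain ⟨vp, p1, p2, p3⟩ := hasDerivAt_of_weakDeriv_twice isOpen_Ioi ordConnected_Ioi
    (I := Ioi 0) (fun x hx => (ne_of_gt hx : x ≠ 0)) hc hwu wv hw hwc
  obtain ⟨vm, m1, m2, m3⟩ := hasDerivAt_of_weakDeriv_twice isOpen_Iio ordConnected_Iio
    (I := Iio 0) (fun x hx => (ne_of_lt hx : x ≠ 0)) hc hwu wv hw hwc
  have mp := Measure.measurePreserving_neg (volume : Measure ℝ)
  have neg_mem : ∀ x : ℝ, x ∈ Ioi (0 : ℝ) → -x ∈ Iio (0 : ℝ) := fun x hx => by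
    simpa using hx
  have tneg : Tendsto (fun x : ℝ => -x) (𝓝[>] 0) (𝓝[<] 0) := by
    have := tendsto_neg_nhdsGT (a := (0 : ℝ))
    rwa [neg_zero] at this
  refine ⟨u, vp, vm, ℓp, ℓm, ⟨hc, mu, ⟨p1, p2, mu.restrict _, ?_, mw'.restrict _, ?_, ?_⟩,
    ⟨?_, ?_, (mu.comp_measurePreserving mp).restrict _, ?_,
      (mw'.comp_measurePreserving mp).restrict _, ?_, ?_⟩, ?_⟩, hae⟩
  · refine (mv.restrict (Ioi 0)).ae_eq ?_
    rw [EventuallyEq, ae_restrict_iff' measurableSet_Ioi]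
    exact p3
  · exact (hc.tendsto 0).mono_left nhdsWithin_le_nhds
  · exact tendsto_of_ae_eq isOpen_Ioi p3 (fun x hx => (p2 x hx).continuousAt.continuousWithinAt) lp
  · intro x hx
    exact ((m1 (-x) (neg_mem x hx)).scomp x (hasDerivAt_neg x)).congr_deriv (by simp)
  · intro x hx
    exact ((m2 (-x) (neg_mem x hx)).scomp x (hasDerivAt_neg x)).neg.congr_deriv (by simp)
  · refine ((mv.comp_measurePreserving mp).restrict (Ioi 0)).neg.ae_eq ?_
    rw [EventuallyEq, ae_restrict_iff' measurableSet_Ioi]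
    filter_upwards [ae_comp_neg m3] with x hx hx0
    simp [hx (neg_mem x hx0)]
  · have := (hc.comp continuous_neg).tendsto (0 : ℝ)
    simp only [Function.comp_apply, neg_zero] at this
    exact this.mono_left nhdsWithin_le_nhds
  · exact ((tendsto_of_ae_eq isOpen_Iio m3
      (fun x hx => (m2 x hx).continuousAt.continuousWithinAt) lm).comp tneg).neg
  · rw [jump]; simp

theorem norm_toLp_sq {u : ℝ → ℂ} (hu : MemLp u 2 volume) :
    ‖hu.toLp u‖ ^ 2 = ∫ x, ‖u x‖ ^ 2 := by
  have h1 : (inner ℂ (hu.toLp u) (hu.toLp u) : ℂ) = ((‖hu.toLp u‖ ^ 2 : ℝ) : ℂ) := by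
    rw [inner_self_eq_norm_sq_to_K]; simp
  rw [L2.inner_def] at h1
  apply Complex.ofReal_injective
  rw [← h1, ← integral_complex_ofReal]
  refine integral_congr_ae ?_
  filter_upwards [hu.coeFn_toLp] with x hx
  rw [hx, inner_self_eq_norm_sq_to_K]; simp

/-! ### Uniform bounds -/

/-- The weak derivative of e^{γ|x|} u is e^{γ|x|} (γ sign(x) u + v). Solving for v costs nothing,
because the weight is at least 1 and γ ≤ 1. -/
theorem norm_sq_deriv_le_of_weighted {γ : ℝ} (hγ : 0 ≤ γ) (hγ1 : γ ≤ 1) (U : WeightedH1 γ)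
    {I : Set ℝ} (hI : IsOpen I) (h0 : I ⊆ {0}ᶜ) {u v : ℝ → ℂ} (hu : u =ᵐ[volume] U)
    (hd : ∀ x ∈ I, HasDerivAt u (v x) x) (hv : ContinuousOn v I) :
    ∀ᵐ x, x ∈ I → ‖v x‖ ^ 2 ≤ 2 * ‖U.weightedDeriv x‖ ^ 2 + 2 * ‖weighted γ U x‖ ^ 2 := by
  have hs : ∀ x ∈ I, HasDerivAt (weighted γ u)
      ((Real.exp (γ * |x|) : ℂ) * (((γ * (SignType.sign x : ℝ) : ℝ) : ℂ) * u x + v x)) x := by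
    intro x hx
    have h1 := (((hasDerivAt_abs (h0 hx : x ≠ 0)).const_mul γ).exp).ofReal_comp.mul (hd x hx)
    refine h1.congr_deriv ?_
    push_cast; ring
  have hsign : ContinuousOn (fun x : ℝ => ((SignType.sign x : SignType) : ℝ)) I := by
    intro x hx
    have hx0 : x ≠ 0 := h0 hx
    have : ContinuousAt (fun x : ℝ => (SignType.sign x : SignType)) x := continuousAt_sign_of_ne_zero hx0
    exact ((continuous_of_discreteTopology (f := fun s : SignType => (s : ℝ))).continuousAt.comp
      this).continuousWithinAt
  have hu' : ContinuousOn u I := fun x hx => (hd x hx).continuousAt.continuousWithinAt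
  have := U.isWeakDeriv.ae_eq_of_hasDerivAt hI (subset_univ _)
    ((weighted_congr γ hu.symm).mono fun x hx _ => hx) hs (by
      refine ContinuousOn.mul (by fun_prop) (ContinuousOn.add (ContinuousOn.mul ?_ hu') hv)
      exact Complex.continuous_ofReal.comp_continuousOn (continuousOn_const.mul hsign))
  filter_upwards [this, weighted_congr γ hu] with x h1 h2 hx
  have e1 : (1 : ℝ) ≤ Real.exp (γ * |x|) := Real.one_le_exp (by positivity)
  have e2 : (Real.exp (γ * |x|) : ℂ) * v x =
      U.weightedDeriv x - ((γ * (SignType.sign x : ℝ) : ℝ) : ℂ) * weighted γ U x := by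
    rw [h1 hx, ← h2, weighted]; ring
  have e3 : ‖v x‖ ≤ ‖U.weightedDeriv x‖ + ‖weighted γ U x‖ := by
    calc ‖v x‖ ≤ Real.exp (γ * |x|) * ‖v x‖ := le_mul_of_one_le_left (norm_nonneg _) e1
      _ = ‖(Real.exp (γ * |x|) : ℂ) * v x‖ := by
        rw [norm_mul, Complex.norm_real, Real.norm_eq_abs, Real.abs_exp]
      _ ≤ _ := by
        rw [e2]
        refine (norm_sub_le _ _).trans ?_
        gcongr
        rw [norm_mul, Complex.norm_real, Real.norm_eq_abs, abs_mul, abs_of_nonneg hγ]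
        have := abs_sign_le x
        have : γ * |((SignType.sign x : SignType) : ℝ)| ≤ 1 := by nlinarith [abs_nonneg ((SignType.sign x : SignType) : ℝ)]
        exact mul_le_of_le_one_left (norm_nonneg _) this
  nlinarith [norm_nonneg (v x), norm_nonneg (U.weightedDeriv x), norm_nonneg (weighted γ U x),
    sq_nonneg (‖U.weightedDeriv x‖ - ‖weighted γ U x‖)]

theorem norm_le_norm_weighted {γ : ℝ} (hγ : 0 ≤ γ) (u : ℝ → ℂ) (x : ℝ) :
    ‖u x‖ ≤ ‖weighted γ u x‖ := by
  rw [weighted, norm_mul, Complex.norm_real, Real.norm_eq_abs, Real.abs_exp]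
  exact le_mul_of_one_le_left (norm_nonneg _) (Real.one_le_exp (by positivity))

theorem IsClassicalBoundState.norm_le {γ : ℝ} (hγ : 0 ≤ γ) (hγ1 : γ ≤ 1) {U : WeightedH1 γ}
    {g : ℝ → ℝ} {E : ℝ} {u vp vm : ℝ → ℂ} {ℓp ℓm : ℂ}
    (h : IsClassicalBoundState g E u vp vm ℓp ℓm) (hu : u =ᵐ[volume] U) (x : ℝ) :
    ‖u x‖ ≤ 3 * ‖U‖ := by
  set D : ℝ → ℝ := fun x => 2 * ‖U.weightedDeriv x‖ ^ 2 + 2 * ‖weighted γ U x‖ ^ 2 with hD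
  have iW : Integrable (fun x => ‖U.weightedDeriv x‖ ^ 2) := U.memLp_weightedDeriv.norm.integrable_sq
  have iu : Integrable (fun x => ‖weighted γ U x‖ ^ 2) := U.memLp_weighted.norm.integrable_sq
  have iD : Integrable D := (iW.const_mul 2).add (iu.const_mul 2)
  have eD : ∫ x, D x ≤ 4 * ‖U‖ ^ 2 := by
    rw [hD, integral_add (iW.const_mul 2) (iu.const_mul 2), integral_const_mul, integral_const_mul,
      ← norm_toLp_sq U.memLp_weightedDeriv, ← norm_toLp_sq U.memLp_weighted]
    obtain ⟨h1, h2⟩ := U.norm_toL2_le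
    have := pow_le_pow_left₀ (norm_nonneg _) h1 2
    have := pow_le_pow_left₀ (norm_nonneg _) h2 2
    linarith
  have eu : ∫ x, ‖weighted γ U x‖ ^ 2 ≤ ‖U‖ ^ 2 := by
    rw [← norm_toLp_sq U.memLp_weighted]
    exact pow_le_pow_left₀ (norm_nonneg _) U.norm_toL2_le.1 2
  have au : ∀ᵐ x, ‖u x‖ ^ 2 ≤ ‖weighted γ U x‖ ^ 2 := by
    filter_upwards [weighted_congr γ hu] with x hx
    rw [← hx]
    exact pow_le_pow_left₀ (norm_nonneg _) (norm_le_norm_weighted hγ u x) 2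
  -- The 5 is 1 for u plus 4 for its derivative, and √5 ≤ 3.
  have fin : ∀ y : ℝ, ‖u y‖ ^ 2 ≤ 5 * ‖U‖ ^ 2 → ‖u y‖ ≤ 3 * ‖U‖ := by
    intro y hy
    nlinarith [norm_nonneg (u y), norm_nonneg U]
  have right : ∀ y : ℝ, 0 < y → ‖u y‖ ≤ 3 * ‖U‖ := by
    intro y hy
    apply fin
    refine (h.right.norm_sq_le hy).trans ?_
    have b1 : ∫ x in Ioi (0 : ℝ), ‖u x‖ ^ 2 ≤ ‖U‖ ^ 2 :=
      (integral_mono_ae h.right.mu.norm.integrable_sq iu.integrableOn (ae_restrict_of_ae au)).trans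
        ((setIntegral_le_integral iu (Eventually.of_forall fun x => by positivity)).trans eu)
    have b2 : ∫ x in Ioi (0 : ℝ), ‖vp x‖ ^ 2 ≤ 4 * ‖U‖ ^ 2 := by
      refine (integral_mono_ae h.right.mv.norm.integrable_sq iD.integrableOn ?_).trans
        ((setIntegral_le_integral iD (Eventually.of_forall fun x => by
          simp only [hD, Pi.zero_apply]; positivity)).trans eD)
      rw [EventuallyLE, ae_restrict_iff' measurableSet_Ioi]
      exact norm_sq_deriv_le_of_weighted hγ hγ1 U isOpen_Ioi (fun x hx => (ne_of_gt hx : x ≠ 0)) hu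
        h.right.du fun x hx => (h.right.dv x hx).continuousAt.continuousWithinAt
    linarith
  have left : ∀ y : ℝ, 0 < y → ‖u (-y)‖ ≤ 3 * ‖U‖ := by
    intro y hy
    apply fin
    refine (h.left.norm_sq_le hy).trans ?_
    have iu' := iu.comp_neg
    have iD' := iD.comp_neg
    have b1 : ∫ x in Ioi (0 : ℝ), ‖u (-x)‖ ^ 2 ≤ ‖U‖ ^ 2 := by
      refine (integral_mono_ae h.left.mu.norm.integrable_sq iu'.integrableOn
        (ae_restrict_of_ae (ae_comp_neg au))).trans
        ((setIntegral_le_integral iu' (Eventually.of_forall fun x => by positivity)).trans ?_)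
      rw [integral_neg_eq_self (fun x => ‖weighted γ U x‖ ^ 2) volume]
      exact eu
    have hder : ∀ x ∈ Iio (0 : ℝ), HasDerivAt u (vm x) x := by
      intro x hx
      have := (h.left.du (-x) (by simpa using hx)).scomp x (hasDerivAt_neg x)
      simpa [Function.comp_def] using this
    have hcon : ContinuousOn vm (Iio 0) := by
      intro x hx
      have := ((h.left.dv (-x) (by simpa using hx)).scomp x (hasDerivAt_neg x)).continuousAt.neg
      refine (this.congr (Eventually.of_forall fun y => ?_)).continuousWithinAt
      simp
    have b2 : ∫ x in Ioi (0 : ℝ), ‖-vm (-x)‖ ^ 2 ≤ 4 * ‖U‖ ^ 2 := by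
      refine (integral_mono_ae h.left.mv.norm.integrable_sq iD'.integrableOn ?_).trans
        ((setIntegral_le_integral iD' (Eventually.of_forall fun x => by
          simp only [hD, Pi.zero_apply]; positivity)).trans ?_)
      · rw [EventuallyLE, ae_restrict_iff' measurableSet_Ioi]
        filter_upwards [ae_comp_neg (norm_sq_deriv_le_of_weighted hγ hγ1 U isOpen_Iio
          (fun x hx => (ne_of_lt hx : x ≠ 0)) hu hder hcon)] with x hx hx0
        rw [norm_neg]
        exact hx (by simpa using hx0)
      · rw [integral_neg_eq_self D volume]
        exact eD
    linarith
  rcases lt_trichotomy x 0 with hx | hx | hx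
  · simpa using left (-x) (by linarith)
  · subst hx
    have : Tendsto (fun y => ‖u y‖) (𝓝[>] 0) (𝓝 ‖u 0‖) :=
      (h.continuous.norm.tendsto 0).mono_left nhdsWithin_le_nhds
    exact le_of_tendsto this (by filter_upwards [self_mem_nhdsWithin] with y hy using right y hy)
  · exact right x hx

end DeltaNLS

namespace DeltaNLS

/-! ### Coercivity on the line and uniqueness of small bound states -/

/-- The function `e^{-|x|/2}`, with complex values. -/
def expHalf (x : ℝ) : ℂ := (Real.exp (-(1 / 2) * |x|) : ℝ)

theorem memLp_expHalf : MemLp expHalf 2 volume :=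
  (memLp_exp_neg_mul_abs (c := 1 / 2) (by norm_num)).ofReal (K := ℂ)

theorem expHalf_neg (x : ℝ) : expHalf (-x) = expHalf x := by simp [expHalf]

theorem expHalf_of_pos {x : ℝ} (hx : 0 < x) : expHalf x = (Real.exp (-(1 / 2) * x) : ℝ) := by
  rw [expHalf, abs_of_pos hx]

section

variable {u w vp vm : ℝ → ℂ} {a ℓp ℓm : ℂ}

/-- The range of H_1 + 1/4 is orthogonal to its kernel. The two half-line Green identities leave ℓp
- ℓm + a, which the jump condition annihilates. -/
theorem integral_expHalf_mul_eq_zero (hu : MemLp u 2 volume) (hw : MemLp w 2 volume)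
    (hp : IsHalfLineH2 u vp w a ℓp)
    (hm : IsHalfLineH2 (fun x => u (-x)) (fun x => -vm (-x)) (fun x => w (-x)) a (-ℓm))
    (hj : ℓp - ℓm = -a) : ∫ x, expHalf x * (u x / 4 - w x) = 0 := by
  have hi : Integrable (fun x => expHalf x * (u x / 4 - w x)) := by
    have : MemLp (fun x => u x / 4 - w x) 2 volume := by
      simp only [div_eq_inv_mul]
      exact (hu.const_mul _).sub hw
    exact memLp_expHalf.integrable_mul this
  have e1 : ∫ x in Ioi (0 : ℝ), expHalf x * (u x / 4 - w x) = ℓp + a / 2 := by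
    rw [← hp.integral_exp_mul]
    exact setIntegral_congr_fun measurableSet_Ioi fun x hx => by simp only [expHalf_of_pos hx]
  have e2 : ∫ x in Ioi (0 : ℝ), expHalf (-x) * (u (-x) / 4 - w (-x)) = -ℓm + a / 2 := by
    rw [← hm.integral_exp_mul]
    exact setIntegral_congr_fun measurableSet_Ioi fun x hx => by
      simp only [expHalf_neg, expHalf_of_pos hx]
  rw [integral_eq_Ioi_add_Ioi_neg hi, e1, e2]
  linear_combination hj

-- Adding the half-line estimates, the flux terms contribute +‖a‖² by the jump condition and the two
-- terms -‖a‖²/2 cancel it. The quadratic form of H_1 + 1/4 thus dominates the part of u left after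
-- removing the right multiple of e^{-|x|/2}.
open ComplexConjugate in
theorem integral_norm_sq_sub_le (hu : MemLp u 2 volume) (hw : MemLp w 2 volume)
    (hp : IsHalfLineH2 u vp w a ℓp)
    (hm : IsHalfLineH2 (fun x => u (-x)) (fun x => -vm (-x)) (fun x => w (-x)) a (-ℓm))
    (hj : ℓp - ℓm = -a) :
    1 / 4 * ∫ x, ‖u x - a * expHalf x‖ ^ 2 ≤ ∫ x, (conj (u x) * (u x / 4 - w x)).re := by
  have hr : MemLp (fun x => u x / 4 - w x) 2 volume := by
    simp only [div_eq_inv_mul]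
    exact (hu.const_mul _).sub hw
  have i1 : Integrable (fun x => ‖u x - a * expHalf x‖ ^ 2) :=
    (hu.sub (memLp_expHalf.const_mul a)).norm.integrable_sq
  have i2 : Integrable (fun x => (conj (u x) * (u x / 4 - w x)).re) :=
    (hu.star.integrable_mul hr).re
  rw [integral_eq_Ioi_add_Ioi_neg i1, integral_eq_Ioi_add_Ioi_neg i2]
  have c1 := hp.coercive
  have c2 := hm.coercive
  have e1 : ∫ x in Ioi (0 : ℝ), ‖u x - a * expHalf x‖ ^ 2 =
      ∫ x in Ioi (0 : ℝ), ‖u x - a * (Real.exp (-(1 / 2) * x) : ℂ)‖ ^ 2 :=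
    setIntegral_congr_fun measurableSet_Ioi fun x hx => by simp only [expHalf_of_pos hx]
  have e2 : ∫ x in Ioi (0 : ℝ), ‖u (-x) - a * expHalf (-x)‖ ^ 2 =
      ∫ x in Ioi (0 : ℝ), ‖u (-x) - a * (Real.exp (-(1 / 2) * x) : ℂ)‖ ^ 2 :=
    setIntegral_congr_fun measurableSet_Ioi fun x hx => by
      simp only [expHalf_neg, expHalf_of_pos hx]
  rw [e1, e2]
  have e3 : (conj a * ℓp).re + (conj a * -ℓm).re = -‖a‖ ^ 2 := by
    rw [← Complex.add_re, ← mul_add, ← sub_eq_add_neg, hj, mul_neg, Complex.conj_mul']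
    simp [← Complex.ofReal_pow]
  linarith

end

theorem inner_toLp {u v : ℝ → ℂ} (hu : MemLp u 2 volume) (hv : MemLp v 2 volume) :
    (inner ℂ (hu.toLp u) (hv.toLp v) : ℂ) = ∫ x, (starRingEnd ℂ) (u x) * v x := by
  rw [L2.inner_def]
  refine integral_congr_ae ?_
  filter_upwards [hu.coeFn_toLp, hv.coeFn_toLp] with x h1 h2
  rw [h1, h2, RCLike.inner_apply, mul_comm]

theorem inner_expHalf {v : ℝ → ℂ} (hv : MemLp v 2 volume) :
    (inner ℂ (memLp_expHalf.toLp _) (hv.toLp v) : ℂ) = ∫ x, expHalf x * v x := by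
  rw [inner_toLp]
  simp only [expHalf, Complex.conj_ofReal]

/-- Two small classical bound states with the same nonzero component along the eigenfunction
coincide. -/
theorem IsClassicalBoundState.eq {g : ℝ → ℝ} (hg : ContinuousOn g (Ici 0)) {E₁ E₂ K B : ℝ} {z : ℂ}
    {u₁ u₂ vp₁ vm₁ vp₂ vm₂ : ℝ → ℂ} {ℓp₁ ℓm₁ ℓp₂ ℓm₂ : ℂ}
    (h₁ : IsClassicalBoundState g E₁ u₁ vp₁ vm₁ ℓp₁ ℓm₁)
    (h₂ : IsClassicalBoundState g E₂ u₂ vp₂ vm₂ ℓp₂ ℓm₂) (hz : z ≠ 0)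
    (hz₁ : ∫ x, expHalf x * u₁ x = z) (hz₂ : ∫ x, expHalf x * u₂ x = z)
    (hK : ∀ x, ‖(g (‖u₁ x‖ ^ 2) : ℂ) * u₁ x - (g (‖u₂ x‖ ^ 2) : ℂ) * u₂ x‖ ≤ K * ‖u₁ x - u₂ x‖)
    (hE : |E₁ + 1 / 4| ≤ K) (hB : ‖h₂.memLp.toLp u₂‖ ≤ B * ‖z‖)
    (hs : 4 * (K * (2 + ‖memLp_expHalf.toLp expHalf‖ * B)) < 1) : u₁ = u₂ := by
  have hK0 : 0 ≤ K := (abs_nonneg _).trans hE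
  set n : ℝ → ℂ := fun x => (g (‖u₁ x‖ ^ 2) : ℂ) * u₁ x - (g (‖u₂ x‖ ^ 2) : ℂ) * u₂ x with hn
  have nc : Continuous n :=
    (continuous_nonlinearity hg h₁.continuous).sub (continuous_nonlinearity hg h₂.continuous)
  set u : ℝ → ℂ := u₁ - u₂ with hu
  have mu : MemLp u 2 volume := h₁.memLp.sub h₂.memLp
  have mn : MemLp n 2 volume := mu.of_le_mul nc.aestronglyMeasurable (Eventually.of_forall hK)
  set w : ℝ → ℂ := boundStateRHS g E₁ u₁ - boundStateRHS g E₂ u₂ with hw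
  set eL := memLp_expHalf.toLp expHalf
  have m₂ := h₂.memLp
  set uL := mu.toLp u
  set nL := mn.toLp n
  set u₂L := m₂.toLp u₂
  -- The splitting puts all of E₁ - E₂ on `u₂`, whose component along the eigenfunction is known to
  -- be z ≠ 0.
  have hwr : ∀ x, u x / 4 - w x =
      -n x + ((E₁ + 1 / 4 : ℝ) : ℂ) * u x + ((E₁ - E₂ : ℝ) : ℂ) * u₂ x := by
    intro x
    simp only [hu, hw, hn, Pi.sub_apply, boundStateRHS]
    push_cast; ring
  have mr : MemLp (fun x => u x / 4 - w x) 2 volume := by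
    simp only [hwr]
    exact (mn.neg.add (mu.const_mul _)).add (m₂.const_mul _)
  have mw : MemLp w 2 volume := by
    have := (mu.const_mul (4 : ℂ)⁻¹).sub mr
    refine this.ae_eq (Eventually.of_forall fun x => ?_)
    simp only [Pi.sub_apply]; ring
  set rL := mr.toLp _
  have hrL : rL = -nL + ((E₁ + 1 / 4 : ℝ) : ℂ) • uL + ((E₁ - E₂ : ℝ) : ℂ) • u₂L := by
    rw [← MemLp.toLp_neg, ← MemLp.toLp_const_smul, ← MemLp.toLp_const_smul, ← MemLp.toLp_add,
      ← MemLp.toLp_add]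
    exact MemLp.toLp_congr _ _ (Eventually.of_forall hwr)
  have hp := h₁.right.sub h₂.right
  have hm : IsHalfLineH2 (fun x => u (-x)) (fun x => -(vm₁ - vm₂) (-x)) (fun x => w (-x))
      (u₁ 0 - u₂ 0) (-(ℓm₁ - ℓm₂)) := by
    have := h₁.left.sub h₂.left
    convert this using 1
    · rfl
    · funext x; simp only [Pi.sub_apply]; ring
    · rfl
    · ring
  have hj : (ℓp₁ - ℓp₂) - (ℓm₁ - ℓm₂) = -(u₁ 0 - u₂ 0) := by
    linear_combination h₁.jump - h₂.jump
  set a := u₁ 0 - u₂ 0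
  have o1 : (inner ℂ eL rL : ℂ) = 0 := by
    rw [inner_expHalf]; exact integral_expHalf_mul_eq_zero mu mw hp hm hj
  have o2 : (inner ℂ eL u₂L : ℂ) = z := by rw [inner_expHalf, hz₂]
  have o3 : (inner ℂ eL uL : ℂ) = 0 := by
    have : uL = h₁.memLp.toLp u₁ - u₂L := MemLp.toLp_sub _ _
    rw [this, inner_sub_right, o2, inner_expHalf, hz₁, sub_self]
  -- Pairing with the kernel removes both the left side and the term in u, and so determines the
  -- difference of the energies.
  have o4 : ((E₁ - E₂ : ℝ) : ℂ) * z = inner ℂ eL nL := by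
    rw [hrL, inner_add_right, inner_add_right, inner_neg_right, inner_smul_right, inner_smul_right,
      o2, o3] at o1
    linear_combination o1
  have bn : ‖nL‖ ≤ K * ‖uL‖ := by
    refine Lp.norm_le_mul_norm_of_ae_le_mul ?_
    filter_upwards [mn.coeFn_toLp, mu.coeFn_toLp] with x e1 e2
    rw [e1, e2]
    exact hK x
  have bE : |E₁ - E₂| * ‖z‖ ≤ ‖eL‖ * (K * ‖uL‖) := by
    have := congrArg norm o4
    rw [norm_mul, Complex.norm_real, Real.norm_eq_abs] at this
    rw [this]
    exact (norm_inner_le_norm _ _).trans (by gcongr)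
  have br : ‖rL‖ ≤ K * (2 + ‖eL‖ * B) * ‖uL‖ := by
    rw [hrL]
    refine (norm_add₃_le).trans ?_
    rw [norm_neg, norm_smul, norm_smul, Complex.norm_real, Complex.norm_real, Real.norm_eq_abs,
      Real.norm_eq_abs]
    have hzpos : 0 < ‖z‖ := norm_pos_iff.2 hz
    have hB0 : 0 ≤ B := by
      by_contra hcon
      have := (norm_nonneg _).trans hB
      nlinarith
    have t1 : |E₁ + 1 / 4| * ‖uL‖ ≤ K * ‖uL‖ := by gcongr
    have t2 : |E₁ - E₂| * ‖u₂L‖ ≤ K * (‖eL‖ * B) * ‖uL‖ := by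
      calc |E₁ - E₂| * ‖u₂L‖ ≤ |E₁ - E₂| * (B * ‖z‖) := by gcongr
        _ = (|E₁ - E₂| * ‖z‖) * B := by ring
        _ ≤ (‖eL‖ * (K * ‖uL‖)) * B := by gcongr
        _ = _ := by ring
    linarith
  have co : 1 / 4 * ‖uL - a • eL‖ ^ 2 ≤ ‖uL‖ * ‖rL‖ := by
    have h3 := integral_norm_sq_sub_le mu mw hp hm hj
    have h4 : ‖uL - a • eL‖ ^ 2 = ∫ x, ‖u x - a * expHalf x‖ ^ 2 := by
      rw [← MemLp.toLp_const_smul, ← MemLp.toLp_sub, norm_toLp_sq]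
      rfl
    have h5 : ∫ x, ((starRingEnd ℂ) (u x) * (u x / 4 - w x)).re = (inner ℂ uL rL : ℂ).re := by
      rw [inner_toLp]
      exact integral_re (𝕜 := ℂ) (mu.star.integrable_mul mr)
    rw [h4]
    refine h3.trans ?_
    rw [h5]
    exact (Complex.re_le_norm _).trans (norm_inner_le_norm _ _)
  -- As u is orthogonal to e^{-|x|/2}, subtracting any multiple of it can only increase the norm.
  -- Hence coercivity controls u itself, whatever its value at 0.
  have ort : ‖uL‖ ^ 2 ≤ ‖uL - a • eL‖ ^ 2 := by
    have h6 : (inner ℂ uL (a • eL) : ℂ) = 0 := by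
      rw [inner_smul_right, ← inner_conj_symm, o3, map_zero, mul_zero]
    have := norm_sub_sq (𝕜 := ℂ) uL (a • eL)
    rw [h6] at this
    rw [this]
    simp
  have hu0 : ‖uL‖ = 0 := by
    by_contra hne
    have hpos : 0 < ‖uL‖ := lt_of_le_of_ne (norm_nonneg _) (Ne.symm hne)
    have : ‖uL‖ * ‖rL‖ ≤ ‖uL‖ * (K * (2 + ‖eL‖ * B) * ‖uL‖) := by gcongr
    nlinarith [mul_pos hpos hpos]
  have h7 : u =ᵐ[volume] 0 := (MemLp.toLp_eq_toLp_iff mu MemLp.zero).1 (by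
    rw [MemLp.toLp_zero]; exact norm_eq_zero.1 hu0)
  have h8 : u = 0 := (h₁.continuous.sub h₂.continuous).ae_eq_iff_eq (μ := volume)
    continuous_zero |>.1 h7
  exact sub_eq_zero.1 h8

end DeltaNLS

namespace DeltaNLS

/-! ### The resolvent on the complement of the eigenfunction

A function `v ∈ C_b(ℝ)` represents the even function `e^{-|x|/4} v(|x|)`. -/

open scoped BoundedContinuousFunction

theorem integrableOn_exp_mul_bcf (m : ℝ →ᵇ ℝ) (x : ℝ) :
    IntegrableOn (fun t => Real.exp (-(3 / 4) * t) * m t) (Ioi x) := by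
  refine Integrable.mul_bdd (c := ‖m‖) (exp_neg_integrableOn_Ioi x (by norm_num))
    m.continuous.aestronglyMeasurable (Eventually.of_forall fun t => m.norm_coe_le_norm t)

theorem abs_integral_Ioi_exp_mul_le (m : ℝ →ᵇ ℝ) (x : ℝ) :
    |∫ t in Ioi x, Real.exp (-(3 / 4) * t) * m t| ≤ 4 / 3 * ‖m‖ * Real.exp (-(3 / 4) * x) := by
  have h1 : IntegrableOn (fun t => Real.exp (-(3 / 4) * t)) (Ioi x) :=
    exp_neg_integrableOn_Ioi x (by norm_num)
  have h2 : ∫ t in Ioi x, Real.exp (-(3 / 4) * t) = 4 / 3 * Real.exp (-(3 / 4) * x) := by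
    rw [integral_exp_mul_Ioi (by norm_num)]; ring
  calc |∫ t in Ioi x, Real.exp (-(3 / 4) * t) * m t|
      ≤ ∫ t in Ioi x, Real.exp (-(3 / 4) * t) * ‖m‖ := by
        rw [← Real.norm_eq_abs]
        refine norm_integral_le_of_norm_le (h1.mul_const _) (Eventually.of_forall fun t => ?_)
        rw [norm_mul, Real.norm_eq_abs, Real.abs_exp]
        gcongr
        exact m.norm_coe_le_norm t
    _ = _ := by rw [integral_mul_const, h2]; ring

/-- The pairing of `e^{-x/4} v` with `e^{-x/2}` on the half line. -/
def expPairing : (ℝ →ᵇ ℝ) →L[ℝ] ℝ :=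
  LinearMap.mkContinuous
    { toFun := fun m => ∫ t in Ioi (0 : ℝ), Real.exp (-(3 / 4) * t) * m t
      map_add' := fun m m' => by
        simp only [BoundedContinuousFunction.coe_add, Pi.add_apply, mul_add]
        exact integral_add (integrableOn_exp_mul_bcf m 0) (integrableOn_exp_mul_bcf m' 0)
      map_smul' := fun c m => by
        simp only [BoundedContinuousFunction.coe_smul, smul_eq_mul, RingHom.id_apply,
          mul_left_comm _ c]
        exact integral_const_mul _ _ }
    (4 / 3) (fun m => by simpa using abs_integral_Ioi_exp_mul_le m 0)

theorem expPairing_apply (m : ℝ →ᵇ ℝ) :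
    expPairing m = ∫ t in Ioi (0 : ℝ), Real.exp (-(3 / 4) * t) * m t := rfl

/-- The function `a = u' + u/2` attached to the source `e^{-x/4} m`. -/
def firstOrder (m : ℝ →ᵇ ℝ) (x : ℝ) : ℝ :=
  Real.exp (1 / 2 * x) * (expPairing m - ∫ t in (0 : ℝ)..x, Real.exp (-(3 / 4) * t) * m t)

theorem continuous_exp_mul_bcf (m : ℝ →ᵇ ℝ) : Continuous fun t => Real.exp (-(3 / 4) * t) * m t := by
  fun_prop

theorem hasDerivAt_exp_const_mul (c x : ℝ) :
    HasDerivAt (fun x => Real.exp (c * x)) (c * Real.exp (c * x)) x := by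
  have := ((hasDerivAt_id x).const_mul c).exp
  simp only [id, mul_one] at this
  rwa [mul_comm] at this

/-- Half of the factorization -u'' + u/4 = (-∂ + 1/2)(∂ + 1/2) u: the function a solves -a' + a/2 =
e^{-x/4} m. Writing it with an integral from 0, rather than as a tail integral, makes it
differentiable at every real x. -/
theorem hasDerivAt_firstOrder (m : ℝ →ᵇ ℝ) (x : ℝ) :
    HasDerivAt (firstOrder m) (firstOrder m x / 2 - Real.exp (-(1 / 4) * x) * m x) x := by
  have h1 : HasDerivAt (fun x => ∫ t in (0 : ℝ)..x, Real.exp (-(3 / 4) * t) * m t)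
      (Real.exp (-(3 / 4) * x) * m x) x :=
    (continuous_exp_mul_bcf m).integral_hasStrictDerivAt 0 x |>.hasDerivAt
  refine ((hasDerivAt_exp_const_mul (1 / 2) x).mul (h1.const_sub (expPairing m))).congr_deriv ?_
  have h2 : Real.exp (-(1 / 4) * x) = Real.exp (1 / 2 * x) * Real.exp (-(3 / 4) * x) := by
    rw [← Real.exp_add]; congr 1; ring
  rw [h2, firstOrder]; ring

theorem continuous_firstOrder (m : ℝ →ᵇ ℝ) : Continuous (firstOrder m) :=
  continuous_iff_continuousAt.2 fun x => (hasDerivAt_firstOrder m x).continuousAt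

/-- The constant `expPairing m` is the one for which the bracket equals the integral over (x, ∞).
Its decay e^{-3x/4} beats the growing factor e^{x/2}. -/
theorem abs_firstOrder_le (m : ℝ →ᵇ ℝ) {x : ℝ} (hx : 0 ≤ x) :
    |firstOrder m x| ≤ 4 / 3 * ‖m‖ * Real.exp (-(1 / 4) * x) := by
  have h1 : expPairing m - ∫ t in (0 : ℝ)..x, Real.exp (-(3 / 4) * t) * m t =
      ∫ t in Ioi x, Real.exp (-(3 / 4) * t) * m t := by
    rw [expPairing_apply, intervalIntegral.integral_of_le hx, sub_eq_iff_eq_add, add_comm,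
      ← setIntegral_union (Ioc_disjoint_Ioi le_rfl) measurableSet_Ioi
        ((integrableOn_exp_mul_bcf m 0).mono_set Ioc_subset_Ioi_self)
        (integrableOn_exp_mul_bcf m x), Ioc_union_Ioi_eq_Ioi hx]
  have h2 : Real.exp (-(1 / 4) * x) = Real.exp (1 / 2 * x) * Real.exp (-(3 / 4) * x) := by
    rw [← Real.exp_add]; congr 1; ring
  rw [firstOrder, h1, abs_mul, Real.abs_exp, h2]
  calc _ ≤ Real.exp (1 / 2 * x) * (4 / 3 * ‖m‖ * Real.exp (-(3 / 4) * x)) := by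
        gcongr; exact abs_integral_Ioi_exp_mul_le m x
    _ = _ := by ring

theorem firstOrder_zero (m : ℝ →ᵇ ℝ) : firstOrder m 0 = expPairing m := by simp [firstOrder]

theorem firstOrder_add (m m' : ℝ →ᵇ ℝ) (x : ℝ) :
    firstOrder (m + m') x = firstOrder m x + firstOrder m' x := by
  simp only [firstOrder, map_add, BoundedContinuousFunction.coe_add, Pi.add_apply, mul_add]
  rw [intervalIntegral.integral_add ((continuous_exp_mul_bcf m).intervalIntegrable _ _)
    ((continuous_exp_mul_bcf m').intervalIntegrable _ _)]
  ring

theorem firstOrder_smul (c : ℝ) (m : ℝ →ᵇ ℝ) (x : ℝ) :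
    firstOrder (c • m) x = c * firstOrder m x := by
  simp only [firstOrder, map_smul, BoundedContinuousFunction.coe_smul, smul_eq_mul,
    mul_left_comm _ c, intervalIntegral.integral_const_mul]
  ring

/-- A solution of `u' + u/2 = a`, with `a` as in `firstOrder`. -/
def particularSol (m : ℝ →ᵇ ℝ) (x : ℝ) : ℝ :=
  Real.exp (-(1 / 2) * x) * ∫ t in (0 : ℝ)..x, Real.exp (1 / 2 * t) * firstOrder m t

theorem continuous_exp_mul_firstOrder (m : ℝ →ᵇ ℝ) :
    Continuous fun t => Real.exp (1 / 2 * t) * firstOrder m t := by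
  have := continuous_firstOrder m
  fun_prop

theorem hasDerivAt_particularSol (m : ℝ →ᵇ ℝ) (x : ℝ) :
    HasDerivAt (particularSol m) (firstOrder m x - particularSol m x / 2) x := by
  have h1 : HasDerivAt (fun x => ∫ t in (0 : ℝ)..x, Real.exp (1 / 2 * t) * firstOrder m t)
      (Real.exp (1 / 2 * x) * firstOrder m x) x :=
    (continuous_exp_mul_firstOrder m).integral_hasStrictDerivAt 0 x |>.hasDerivAt
  refine ((hasDerivAt_exp_const_mul (-(1 / 2)) x).mul h1).congr_deriv ?_
  have h2 : Real.exp (-(1 / 2) * x) * Real.exp (1 / 2 * x) = 1 := by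
    rw [← Real.exp_add]; simp
  rw [particularSol, ← mul_assoc, h2]; ring

theorem continuous_particularSol (m : ℝ →ᵇ ℝ) : Continuous (particularSol m) :=
  continuous_iff_continuousAt.2 fun x => (hasDerivAt_particularSol m x).continuousAt

/-- The integrand e^{t/2} a(t) grows at most like e^{t/4}; integrating multiplies 4/3 by 4, and the
prefactor e^{-x/2} restores the decay e^{-x/4}. -/
theorem abs_particularSol_le (m : ℝ →ᵇ ℝ) {x : ℝ} (hx : 0 ≤ x) :
    |particularSol m x| ≤ 16 / 3 * ‖m‖ * Real.exp (-(1 / 4) * x) := by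
  have h1 : |∫ t in (0 : ℝ)..x, Real.exp (1 / 2 * t) * firstOrder m t| ≤
      16 / 3 * ‖m‖ * Real.exp (1 / 4 * x) := by
    have h2 : ∫ t in (0 : ℝ)..x, 4 / 3 * ‖m‖ * Real.exp (1 / 4 * t) =
        16 / 3 * ‖m‖ * Real.exp (1 / 4 * x) - 16 / 3 * ‖m‖ := by
      rw [intervalIntegral.integral_const_mul, intervalIntegral.integral_comp_mul_left
        (fun t => Real.exp t) (by norm_num), integral_exp]
      simp; ring
    calc |∫ t in (0 : ℝ)..x, Real.exp (1 / 2 * t) * firstOrder m t|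
        ≤ ∫ t in (0 : ℝ)..x, 4 / 3 * ‖m‖ * Real.exp (1 / 4 * t) := by
          rw [← Real.norm_eq_abs]
          refine intervalIntegral.norm_integral_le_of_norm_le hx (Eventually.of_forall fun t ht => ?_)
            (Continuous.intervalIntegrable
              (show Continuous fun t => 4 / 3 * ‖m‖ * Real.exp (1 / 4 * t) by fun_prop) _ _)
          rw [norm_mul, Real.norm_eq_abs, Real.abs_exp]
          have h3 : Real.exp (1 / 4 * t) = Real.exp (1 / 2 * t) * Real.exp (-(1 / 4) * t) := by
            rw [← Real.exp_add]; congr 1; ring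
          rw [h3]
          calc _ ≤ Real.exp (1 / 2 * t) * (4 / 3 * ‖m‖ * Real.exp (-(1 / 4) * t)) := by
                gcongr; exact abs_firstOrder_le m ht.1.le
            _ = _ := by ring
      _ ≤ _ := by rw [h2]; linarith [norm_nonneg m]
  have h2 : Real.exp (-(1 / 4) * x) = Real.exp (-(1 / 2) * x) * Real.exp (1 / 4 * x) := by
    rw [← Real.exp_add]; congr 1; ring
  rw [particularSol, abs_mul, Real.abs_exp, h2]
  calc _ ≤ Real.exp (-(1 / 2) * x) * (16 / 3 * ‖m‖ * Real.exp (1 / 4 * x)) := by gcongr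
    _ = _ := by ring

theorem particularSol_add (m m' : ℝ →ᵇ ℝ) (x : ℝ) :
    particularSol (m + m') x = particularSol m x + particularSol m' x := by
  simp only [particularSol, firstOrder_add, mul_add]
  rw [intervalIntegral.integral_add ((continuous_exp_mul_firstOrder m).intervalIntegrable _ _)
    ((continuous_exp_mul_firstOrder m').intervalIntegrable _ _)]
  ring

theorem particularSol_smul (c : ℝ) (m : ℝ →ᵇ ℝ) (x : ℝ) :
    particularSol (c • m) x = c * particularSol m x := by
  simp only [particularSol, firstOrder_smul, mul_left_comm _ c,
    intervalIntegral.integral_const_mul]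

/-- `particularSol` as an operator on the weighted representatives. -/
def particularSolCLM : (ℝ →ᵇ ℝ) →L[ℝ] (ℝ →ᵇ ℝ) :=
  have bd : ∀ (m : ℝ →ᵇ ℝ) (x : ℝ),
      ‖Real.exp (1 / 4 * |x|) * particularSol m |x|‖ ≤ 16 / 3 * ‖m‖ := fun m x => by
    rw [norm_mul, Real.norm_eq_abs, Real.abs_exp, Real.norm_eq_abs]
    have h1 : Real.exp (1 / 4 * |x|) * Real.exp (-(1 / 4) * |x|) = 1 := by
      rw [← Real.exp_add]; simp
    calc _ ≤ Real.exp (1 / 4 * |x|) * (16 / 3 * ‖m‖ * Real.exp (-(1 / 4) * |x|)) := by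
          gcongr; exact abs_particularSol_le m (abs_nonneg x)
      _ = 16 / 3 * ‖m‖ * (Real.exp (1 / 4 * |x|) * Real.exp (-(1 / 4) * |x|)) := by ring
      _ = _ := by rw [h1, mul_one]
  LinearMap.mkContinuous
    { toFun := fun m => BoundedContinuousFunction.ofNormedAddCommGroup
        (fun x => Real.exp (1 / 4 * |x|) * particularSol m |x|)
        (by have := continuous_particularSol m; fun_prop) (16 / 3 * ‖m‖) (bd m)
      map_add' := fun m m' => by
        ext x
        simp only [BoundedContinuousFunction.coe_ofNormedAddCommGroup, particularSol_add,
          BoundedContinuousFunction.coe_add, Pi.add_apply, mul_add]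
      map_smul' := fun c m => by
        ext x
        simp only [BoundedContinuousFunction.coe_ofNormedAddCommGroup, particularSol_smul,
          BoundedContinuousFunction.coe_smul, smul_eq_mul, RingHom.id_apply, mul_left_comm _ c] }
    (16 / 3) (fun m => BoundedContinuousFunction.norm_ofNormedAddCommGroup_le _
      (by positivity) (bd m))

/-- The weighted representative of `e^{-|x|/2}`. -/
def expWeighted : ℝ →ᵇ ℝ :=
  BoundedContinuousFunction.ofNormedAddCommGroup (fun x => Real.exp (-(1 / 4) * |x|))
    (by fun_prop) 1 (fun x => by
      rw [Real.norm_eq_abs, Real.abs_exp, Real.exp_le_one_iff]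
      nlinarith [abs_nonneg x])

theorem expWeighted_apply (x : ℝ) : expWeighted x = Real.exp (-(1 / 4) * |x|) := rfl

/-- The integrand is e^{-t}. This normalization makes `expProj` a projection with no further
constant. -/
theorem expPairing_expWeighted : expPairing expWeighted = 1 := by
  rw [expPairing_apply]
  have : ∀ t ∈ Ioi (0 : ℝ), Real.exp (-(3 / 4) * t) * expWeighted t = Real.exp (-t) := by
    intro t ht
    rw [expWeighted_apply, abs_of_pos ht, ← Real.exp_add]; congr 1; ring
  rw [setIntegral_congr_fun measurableSet_Ioi this, integral_exp_neg_Ioi_zero]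

/-- The projection off the eigenfunction. -/
def expProj : (ℝ →ᵇ ℝ) →L[ℝ] (ℝ →ᵇ ℝ) :=
  ContinuousLinearMap.id ℝ _ - expPairing.smulRight expWeighted

theorem expProj_apply (m : ℝ →ᵇ ℝ) : expProj m = m - expPairing m • expWeighted := rfl

theorem expPairing_expProj (m : ℝ →ᵇ ℝ) : expPairing (expProj m) = 0 := by
  rw [expProj_apply, map_sub, map_smul, expPairing_expWeighted]; simp

/-- The reduced resolvent at the eigenvalue, on even functions. -/
def reducedResolvent : (ℝ →ᵇ ℝ) →L[ℝ] (ℝ →ᵇ ℝ) :=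
  expProj ∘L particularSolCLM ∘L expProj

theorem expPairing_reducedResolvent (m : ℝ →ᵇ ℝ) : expPairing (reducedResolvent m) = 0 :=
  expPairing_expProj _

/-- The half-line function represented by `reducedResolvent n`. -/
def resSol (n : ℝ →ᵇ ℝ) (x : ℝ) : ℝ :=
  particularSol (expProj n) x -
    expPairing (particularSolCLM (expProj n)) * Real.exp (-(1 / 2) * x)

/-- The derivative of `resSol`. -/
def resSolDeriv (n : ℝ →ᵇ ℝ) (x : ℝ) : ℝ := firstOrder (expProj n) x - resSol n x / 2

/-- Ties the explicit half-line solution, which can be differentiated, to the bounded operator used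
in the contraction. -/
theorem resSol_abs (n : ℝ →ᵇ ℝ) (x : ℝ) :
    resSol n |x| = Real.exp (-(1 / 4) * |x|) * reducedResolvent n x := by
  have h1 : Real.exp (-(1 / 4) * |x|) * Real.exp (1 / 4 * |x|) = 1 := by
    rw [← Real.exp_add]; simp
  have h2 : Real.exp (-(1 / 2) * |x|) = Real.exp (-(1 / 4) * |x|) * Real.exp (-(1 / 4) * |x|) := by
    rw [← Real.exp_add]; congr 1; ring
  have h3 : reducedResolvent n x = Real.exp (1 / 4 * |x|) * particularSol (expProj n) |x| -
      expPairing (particularSolCLM (expProj n)) * Real.exp (-(1 / 4) * |x|) := rfl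
  rw [h3, mul_sub, ← mul_assoc, h1, resSol, h2]; ring

/-- The subtracted multiple of e^{-x/2} solves u' + u/2 = 0, so restoring orthogonality leaves the
first-order equation untouched. -/
theorem hasDerivAt_resSol (n : ℝ →ᵇ ℝ) (x : ℝ) : HasDerivAt (resSol n) (resSolDeriv n x) x := by
  refine ((hasDerivAt_particularSol (expProj n) x).sub
    ((hasDerivAt_exp_const_mul (-(1 / 2)) x).const_mul _)).congr_deriv ?_
  rw [resSolDeriv, resSol]; ring

theorem hasDerivAt_resSolDeriv (n : ℝ →ᵇ ℝ) (x : ℝ) :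
    HasDerivAt (resSolDeriv n) (resSol n x / 4 - Real.exp (-(1 / 4) * x) * expProj n x) x := by
  refine ((hasDerivAt_firstOrder (expProj n) x).sub
    ((hasDerivAt_resSol n x).div_const 2)).congr_deriv ?_
  rw [resSolDeriv]; ring

/-- The Robin condition u' + u/2 = 0 at 0 says that a(0) = 0, and a(0) is the pairing of the source
with the eigenfunction. This is the Fredholm condition, met because the source has been projected.
-/
theorem resSolDeriv_zero (n : ℝ →ᵇ ℝ) : resSolDeriv n 0 = -resSol n 0 / 2 := by
  rw [resSolDeriv, firstOrder_zero, expPairing_expProj]; ring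

theorem exists_isProfile_resSol : ∃ C : ℝ, 0 < C ∧ ∀ n : ℝ →ᵇ ℝ,
    IsProfile (1 / 4) (C * ‖n‖) (resSol n) (resSolDeriv n) ∧
    IsProfile (1 / 4) (C * ‖n‖) (resSolDeriv n)
      (fun x => resSol n x / 4 - Real.exp (-(1 / 4) * x) * expProj n x) := by
  set P := ‖expProj‖
  set T := ‖reducedResolvent‖
  have hP : 0 ≤ P := norm_nonneg expProj
  have hT : 0 ≤ T := norm_nonneg reducedResolvent
  -- Covers T for u, 4P/3 + T/2 for u' and T/4 + P for u''; the 1 keeps the constant positive.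
  refine ⟨1 + T + 2 * P, by positivity, fun n => ?_⟩
  have hn := norm_nonneg n
  have b1 : ∀ x, 0 ≤ x → |resSol n x| ≤ T * ‖n‖ * Real.exp (-(1 / 4) * x) := by
    intro x hx
    have h1 := resSol_abs n x
    rw [abs_of_nonneg hx] at h1
    rw [h1, abs_mul, Real.abs_exp, mul_comm]
    gcongr
    exact (BoundedContinuousFunction.norm_coe_le_norm _ x).trans (reducedResolvent.le_opNorm n)
  have b2 : ∀ x, 0 ≤ x → |firstOrder (expProj n) x| ≤
      4 / 3 * (P * ‖n‖) * Real.exp (-(1 / 4) * x) := by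
    intro x hx
    refine (abs_firstOrder_le _ hx).trans ?_
    gcongr
    exact expProj.le_opNorm n
  have b3 : ∀ x, |Real.exp (-(1 / 4) * x) * expProj n x| ≤
      P * ‖n‖ * Real.exp (-(1 / 4) * x) := by
    intro x
    rw [abs_mul, Real.abs_exp, mul_comm]
    gcongr
    exact (BoundedContinuousFunction.norm_coe_le_norm _ x).trans (expProj.le_opNorm n)
  have c1 : Continuous (resSol n) :=
    continuous_iff_continuousAt.2 fun x => (hasDerivAt_resSol n x).continuousAt
  have c2 : Continuous (resSolDeriv n) :=
    continuous_iff_continuousAt.2 fun x => (hasDerivAt_resSolDeriv n x).continuousAt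
  have d1 : ∀ x, 0 ≤ x → |resSol n x| ≤ (1 + T + 2 * P) * ‖n‖ * Real.exp (-(1 / 4) * x) := by
    intro x hx
    refine (b1 x hx).trans ?_
    gcongr; linarith
  have d2 : ∀ x, 0 ≤ x → |resSolDeriv n x| ≤ (1 + T + 2 * P) * ‖n‖ * Real.exp (-(1 / 4) * x) := by
    intro x hx
    have h1 := b1 x hx
    have h2 := b2 x hx
    have e := Real.exp_pos (-(1 / 4) * x)
    have p1 : 0 ≤ ‖n‖ * Real.exp (-(1 / 4) * x) := by positivity
    have p2 := mul_nonneg hT p1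
    have p3 := mul_nonneg hP p1
    rw [resSolDeriv]
    refine (abs_sub _ _).trans ?_
    rw [abs_div, abs_two]
    nlinarith
  refine ⟨⟨hasDerivAt_resSol n, c2, d1, d2⟩, hasDerivAt_resSolDeriv n, by fun_prop, d2, ?_⟩
  intro x hx
  have h1 := b1 x hx
  have h2 := b3 x
  have e := Real.exp_pos (-(1 / 4) * x)
  have p1 : 0 ≤ ‖n‖ * Real.exp (-(1 / 4) * x) := by positivity
  have p2 := mul_nonneg hT p1
  have p3 := mul_nonneg hP p1
  refine (abs_sub _ _).trans ?_
  rw [abs_div, abs_of_pos (show (0 : ℝ) < 4 by norm_num)]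
  nlinarith

/-- The reduced resolvent with values in the weighted Sobolev space. -/
theorem exists_resolventH1 : ∃ R : (ℝ →ᵇ ℝ) →L[ℝ] WeightedH1 (1 / 8),
    ∀ n, (R n : ℝ → ℂ) =ᵐ[volume] evenExt (resSol n) := by
  obtain ⟨C, hC, hprof⟩ := exists_isProfile_resSol
  obtain ⟨B, hB, hnorm⟩ := IsProfile.norm_le (γ := 1 / 8) (c := 1 / 4) (by norm_num) (by norm_num)
  have hγ : (0 : ℝ) ≤ 1 / 8 := by norm_num
  have hc : (1 / 8 : ℝ) < 1 / 4 := by norm_num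
  have key : ∀ n, ((hprof n).1.toWeightedH1 hγ hc : ℝ → ℂ) =ᵐ[volume] evenExt (resSol n) :=
    fun n => (hprof n).1.coe_toWeightedH1 hγ hc
  refine ⟨LinearMap.mkContinuous
    { toFun := fun n => (hprof n).1.toWeightedH1 hγ hc
      map_add' := fun n m => ?_
      map_smul' := fun c n => ?_ } (B * C) fun n => ?_, key⟩
  · refine WeightedH1.ext_ae ?_
    filter_upwards [key (n + m), key n, key m, WeightedH1.coe_add ((hprof n).1.toWeightedH1 hγ hc)
      ((hprof m).1.toWeightedH1 hγ hc)] with x h1 h2 h3 h4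
    rw [h1, h4, Pi.add_apply, h2, h3]
    simp only [evenExt, resSol_abs, map_add, BoundedContinuousFunction.coe_add, Pi.add_apply]
    push_cast; ring
  · refine WeightedH1.ext_ae ?_
    filter_upwards [key (c • n), key n, WeightedH1.coe_smul (c : ℂ)
      ((hprof n).1.toWeightedH1 hγ hc)] with x h1 h2 h4
    rw [h1]
    refine Eq.trans ?_ h4.symm
    rw [Pi.smul_apply, h2]
    simp only [evenExt, resSol_abs, map_smul, BoundedContinuousFunction.coe_smul, smul_eq_mul]
    push_cast; ring
  · have := hnorm _ _ _ (hprof n).1 _ (key n)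
    rwa [← mul_assoc] at this

end DeltaNLS

namespace DeltaNLS

/-! ### Superposition operators on weighted bounded continuous functions -/

open scoped BoundedContinuousFunction

theorem expWeighted_pos (x : ℝ) : 0 < expWeighted x := Real.exp_pos _

theorem expWeighted_le_one (x : ℝ) : expWeighted x ≤ 1 := by
  rw [expWeighted_apply, Real.exp_le_one_iff]
  nlinarith [abs_nonneg x]

theorem abs_expWeighted_mul_le (v : ℝ →ᵇ ℝ) (x : ℝ) : |expWeighted x * v x| ≤ ‖v‖ := by
  rw [abs_mul, abs_of_pos (expWeighted_pos x)]
  calc _ ≤ 1 * ‖v‖ := by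
        gcongr
        · exact expWeighted_le_one x
        · exact v.norm_coe_le_norm x
    _ = _ := one_mul _

/-- The superposition operator `v ↦ h(e^{-|x|/4} v)`. -/
def nemytskii (h : C(ℝ, ℝ)) (v : ℝ →ᵇ ℝ) : ℝ →ᵇ ℝ where
  toFun x := h (expWeighted x * v x)
  continuous_toFun := by fun_prop
  map_bounded' := by
    obtain ⟨C, hC⟩ := (isCompact_Icc (a := -‖v‖) (b := ‖v‖)).exists_bound_of_continuousOn
      h.continuous.continuousOn
    refine ⟨C + C, fun x y => ?_⟩
    refine (dist_le_norm_add_norm _ _).trans (add_le_add ?_ ?_) <;>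
    exact hC _ (abs_le.1 (abs_expWeighted_mul_le v _))

theorem nemytskii_apply (h : C(ℝ, ℝ)) (v : ℝ →ᵇ ℝ) (x : ℝ) :
    nemytskii h v x = h (expWeighted x * v x) := rfl

/-- Uniform continuity on an interval one unit longer than the range of s, so that t stays inside it
once δ ≤ 1. -/
theorem exists_delta_of_continuous (h : C(ℝ, ℝ)) (M : ℝ) {ε : ℝ} (hε : 0 < ε) :
    ∃ δ > 0, ∀ s t : ℝ, |s| ≤ M → |t - s| ≤ δ → |h t - h s| ≤ ε := by
  have hu := (isCompact_Icc (a := -(M + 1)) (b := M + 1)).uniformContinuousOn_of_continuous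
    h.continuous.continuousOn
  obtain ⟨δ, hδ, hh⟩ := Metric.uniformContinuousOn_iff_le.1 hu ε hε
  refine ⟨min δ 1, by positivity, fun s t hs ht => ?_⟩
  have h1 : |t - s| ≤ 1 := ht.trans (min_le_right _ _)
  have h2 : |t - s| ≤ δ := ht.trans (min_le_left _ _)
  rw [abs_le] at hs h1
  have := hh t ⟨by linarith, by linarith⟩ s ⟨by linarith, by linarith⟩ (by rwa [Real.dist_eq])
  rwa [Real.dist_eq] at this

theorem continuous_nemytskii (h : C(ℝ, ℝ)) : Continuous (nemytskii h) := by
  rw [Metric.continuous_iff]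
  intro v ε hε
  obtain ⟨δ, hδ, hh⟩ := exists_delta_of_continuous h ‖v‖ (half_pos hε)
  refine ⟨δ, hδ, fun w hw => ?_⟩
  refine lt_of_le_of_lt ?_ (half_lt_self hε)
  rw [BoundedContinuousFunction.dist_le (by positivity)]
  intro x
  rw [Real.dist_eq, nemytskii_apply, nemytskii_apply]
  refine hh _ _ (abs_expWeighted_mul_le v x) ?_
  rw [← mul_sub]
  refine (abs_expWeighted_mul_le (w - v) x).trans ?_
  rw [← dist_eq_norm]
  exact hw.le

/-- Continuous bilinear maps on a normed space. -/
abbrev BilinearMapOn (E : Type*) [NormedAddCommGroup E] [NormedSpace ℝ E] : Type _ :=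
  E →L[ℝ] E →L[ℝ] E

/-- Multiplication of bounded continuous functions. -/
def bcfMul : BilinearMapOn (ℝ →ᵇ ℝ) :=
  LinearMap.mkContinuous₂ (LinearMap.mul ℝ (ℝ →ᵇ ℝ)) 1 fun u v => by
    simpa using norm_mul_le u v

theorem bcfMul_apply (u v : ℝ →ᵇ ℝ) : bcfMul u v = u * v := rfl

theorem norm_bcfMul_apply_le (u : ℝ →ᵇ ℝ) : ‖bcfMul u‖ ≤ ‖u‖ :=
  ContinuousLinearMap.opNorm_le_bound _ (norm_nonneg u) fun v => norm_mul_le u v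

/-- A single proof for the plain operator (m = 1) and the one divided by the weight (m = 1/weight).
The inner factor `expWeighted` produced by the chain rule compensates m, so only the bounded product
k occurs. The remainder is uniform in x because all arguments stay in a compact interval. -/
theorem hasFDerivAt_superposition {F : ℝ → ℝ} {f : C(ℝ, ℝ)} (hF : ∀ t, HasDerivAt F (f t) t)
    {m : ℝ → ℝ} {k : ℝ →ᵇ ℝ} (hk : ∀ x, k x = m x * expWeighted x) (hk1 : ‖k‖ ≤ 1)
    {G : (ℝ →ᵇ ℝ) → (ℝ →ᵇ ℝ)} (hG : ∀ v x, G v x = m x * F (expWeighted x * v x)) (v : ℝ →ᵇ ℝ) :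
    HasFDerivAt G (bcfMul (k * nemytskii f v)) v := by
  rw [hasFDerivAt_iff_isLittleO_nhds_zero, Asymptotics.isLittleO_iff]
  intro ε hε
  obtain ⟨δ, hδ, hh⟩ := exists_delta_of_continuous f ‖v‖ hε
  filter_upwards [Metric.ball_mem_nhds 0 hδ] with w hw
  rw [mem_ball_zero_iff] at hw
  rw [BoundedContinuousFunction.norm_le (by positivity)]
  intro x
  set θ := expWeighted x
  have e1 : (G (v + w) - G v - (bcfMul (k * nemytskii f v)) w) x =
      m x * (F (θ * v x + θ * w x) - F (θ * v x) - f (θ * v x) * (θ * w x)) := by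
    simp only [BoundedContinuousFunction.coe_sub, Pi.sub_apply, hG, bcfMul_apply,
      BoundedContinuousFunction.coe_mul, Pi.mul_apply, BoundedContinuousFunction.coe_add,
      Pi.add_apply, nemytskii_apply, hk]
    change _ = m x * (F (expWeighted x * v x + expWeighted x * w x) - F (expWeighted x * v x) -
      f (expWeighted x * v x) * (expWeighted x * w x))
    rw [mul_add (expWeighted x)]
    ring
  have e2 : |F (θ * v x + θ * w x) - F (θ * v x) - f (θ * v x) * (θ * w x)| ≤ ε * |θ * w x| := by
    -- Mean value inequality for F minus its linearization; the derivative of this difference is at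
    -- most ε by uniform continuity of f.
    have hd : ∀ t ∈ Metric.closedBall (θ * v x) |θ * w x|,
        HasDerivWithinAt (fun t => F t - f (θ * v x) * t) (f t - f (θ * v x))
          (Metric.closedBall (θ * v x) |θ * w x|) t := fun t _ =>
      ((hF t).sub (by simpa using (hasDerivAt_id t).const_mul (f (θ * v x)))).hasDerivWithinAt
    have hb : ∀ t ∈ Metric.closedBall (θ * v x) |θ * w x|, ‖f t - f (θ * v x)‖ ≤ ε := by
      intro t ht
      rw [Metric.mem_closedBall, Real.dist_eq] at ht
      exact hh _ _ (abs_expWeighted_mul_le v x)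
        (ht.trans ((abs_expWeighted_mul_le w x).trans hw.le))
    have := (convex_closedBall (θ * v x) |θ * w x|).norm_image_sub_le_of_norm_hasDerivWithin_le
      hd hb (Metric.mem_closedBall_self (abs_nonneg _))
      (y := θ * v x + θ * w x) (by simp)
    simp only [Real.norm_eq_abs, add_sub_cancel_left] at this
    refine le_trans (le_of_eq ?_) this
    congr 1; ring
  rw [e1, norm_mul, Real.norm_eq_abs, Real.norm_eq_abs]
  have e3 : |m x| * |θ| ≤ 1 := by
    rw [← abs_mul, ← hk]
    exact (k.norm_coe_le_norm x).trans hk1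
  calc |m x| * |F (θ * v x + θ * w x) - F (θ * v x) - f (θ * v x) * (θ * w x)|
      ≤ |m x| * (ε * |θ * w x|) := by gcongr
    _ = (|m x| * |θ|) * (ε * |w x|) := by rw [abs_mul]; ring
    _ ≤ 1 * (ε * ‖w‖) := by gcongr; exact w.norm_coe_le_norm x
    _ = _ := one_mul _

theorem norm_expWeighted_le : ‖expWeighted‖ ≤ 1 := by
  rw [BoundedContinuousFunction.norm_le zero_le_one]
  intro x
  rw [Real.norm_eq_abs, abs_of_pos (expWeighted_pos x)]
  exact expWeighted_le_one x

theorem hasFDerivAt_nemytskii {F f : C(ℝ, ℝ)} (hF : ∀ t, HasDerivAt F (f t) t) (v : ℝ →ᵇ ℝ) :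
    HasFDerivAt (nemytskii F)
      (bcfMul (expWeighted * nemytskii f v)) v :=
  hasFDerivAt_superposition hF (m := fun _ => 1) (fun x => by simp) norm_expWeighted_le
    (fun v x => by simp [nemytskii_apply]) v

theorem contDiff_nemytskii {F f : C(ℝ, ℝ)} (hF : ∀ t, HasDerivAt F (f t) t) :
    ContDiff ℝ 1 (nemytskii F) := by
  rw [contDiff_one_iff_fderiv]
  refine ⟨fun v => (hasFDerivAt_nemytskii hF v).differentiableAt, ?_⟩
  have : fderiv ℝ (nemytskii F) =
      fun v => bcfMul (expWeighted * nemytskii f v) :=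
    funext fun v => (hasFDerivAt_nemytskii hF v).fderiv
  rw [this]
  exact bcfMul.continuous.comp
    (continuous_const.mul (continuous_nemytskii f))

/-- Vanishing at 0 to first order is what allows division by the decaying weight. -/
theorem exists_abs_le_mul {F : ℝ → ℝ} {f : C(ℝ, ℝ)} (hF : ∀ t, HasDerivAt F (f t) t)
    (h0 : F 0 = 0) (M : ℝ) : ∃ C, ∀ t, |t| ≤ M → |F t| ≤ C * |t| := by
  obtain ⟨C, hC⟩ := (isCompact_Icc (a := -M) (b := M)).exists_bound_of_continuousOn
      f.continuous.continuousOn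
  refine ⟨C, fun t ht => ?_⟩
  have hM : 0 ≤ M := (abs_nonneg t).trans ht
  have := (convex_Icc (-M) M).norm_image_sub_le_of_norm_hasDerivWithin_le
    (fun t _ => (hF t).hasDerivWithinAt) hC (x := 0) (y := t) ⟨by linarith, hM⟩ (abs_le.1 ht)
  simpa [h0] using this

/-- The superposition operator `v ↦ e^{|x|/4} F(e^{-|x|/4} v)`. -/
def weightedNemytskii (F : ℝ → ℝ) (f : C(ℝ, ℝ)) (hF : ∀ t, HasDerivAt F (f t) t) (h0 : F 0 = 0)
    (v : ℝ →ᵇ ℝ) : ℝ →ᵇ ℝ where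
  toFun x := (expWeighted x)⁻¹ * F (expWeighted x * v x)
  continuous_toFun := by
    have : Continuous F := continuous_iff_continuousAt.2 fun t => (hF t).continuousAt
    have h2 : Continuous fun x => (expWeighted x)⁻¹ :=
      expWeighted.continuous.inv₀ fun x => (expWeighted_pos x).ne'
    fun_prop
  map_bounded' := by
    obtain ⟨C, hC⟩ := exists_abs_le_mul hF h0 ‖v‖
    have key : ∀ x, ‖(expWeighted x)⁻¹ * F (expWeighted x * v x)‖ ≤ |C| * ‖v‖ := by
      intro x
      have hx := expWeighted_pos x
      rw [norm_mul, norm_inv, Real.norm_eq_abs, Real.norm_eq_abs, abs_of_pos hx,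
        inv_mul_le_iff₀ hx]
      refine (hC _ (abs_expWeighted_mul_le v x)).trans ?_
      rw [abs_mul, abs_of_pos hx]
      calc _ ≤ |C| * (expWeighted x * ‖v‖) := by
            gcongr
            · exact le_abs_self C
            · exact v.norm_coe_le_norm x
        _ = _ := by ring
    refine ⟨|C| * ‖v‖ + |C| * ‖v‖, fun x y => ?_⟩
    exact (dist_le_norm_add_norm _ _).trans (add_le_add (key x) (key y))

section

variable {F : ℝ → ℝ} {f f' : C(ℝ, ℝ)} (hF : ∀ t, HasDerivAt F (f t) t) (h0 : F 0 = 0)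

theorem weightedNemytskii_apply (v : ℝ →ᵇ ℝ) (x : ℝ) :
    weightedNemytskii F f hF h0 v x = (expWeighted x)⁻¹ * F (expWeighted x * v x) := rfl

theorem hasFDerivAt_weightedNemytskii (v : ℝ →ᵇ ℝ) :
    HasFDerivAt (weightedNemytskii F f hF h0)
      (bcfMul (nemytskii f v)) v := by
  have := hasFDerivAt_superposition hF (m := fun x => (expWeighted x)⁻¹) (k := 1)
    (fun x => by simp [(expWeighted_pos x).ne']) (by simp)
    (G := weightedNemytskii F f hF h0) (fun v x => rfl) v
  rwa [one_mul] at this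

theorem fderiv_weightedNemytskii :
    fderiv ℝ (weightedNemytskii F f hF h0) =
      fun v => bcfMul (nemytskii f v) :=
  funext fun v => (hasFDerivAt_weightedNemytskii hF h0 v).fderiv

theorem contDiff_one_weightedNemytskii : ContDiff ℝ 1 (weightedNemytskii F f hF h0) := by
  rw [contDiff_one_iff_fderiv, fderiv_weightedNemytskii]
  exact ⟨fun v => (hasFDerivAt_weightedNemytskii hF h0 v).differentiableAt,
    bcfMul.continuous.comp (continuous_nemytskii f)⟩

/-- The first derivative is multiplication by the undivided operator with symbol f, and that
operator is itself C¹ once f is. -/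
theorem contDiff_two_weightedNemytskii (hf : ∀ t, HasDerivAt f (f' t) t) :
    ContDiff ℝ 2 (weightedNemytskii F f hF h0) := by
  rw [show (2 : ℕ∞ω) = 1 + 1 from by norm_num, contDiff_succ_iff_fderiv, fderiv_weightedNemytskii]
  exact ⟨fun v => (hasFDerivAt_weightedNemytskii hF h0 v).differentiableAt, by simp,
    bcfMul.contDiff.comp (contDiff_nemytskii hf)⟩

variable {s K : ℝ}

theorem norm_weightedNemytskii_le (hs : 0 ≤ s) (hK : 0 ≤ K)
    (hb : ∀ t, |t| ≤ 1 → |F t| ≤ K * |t| ^ (s + 1)) {v : ℝ →ᵇ ℝ} (hv : ‖v‖ ≤ 1) :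
    ‖weightedNemytskii F f hF h0 v‖ ≤ K * ‖v‖ ^ (s + 1) := by
  rw [BoundedContinuousFunction.norm_le (by positivity)]
  intro x
  have hx := expWeighted_pos x
  have hvx : |v x| ≤ ‖v‖ := v.norm_coe_le_norm x
  rw [weightedNemytskii_apply, norm_mul, norm_inv, Real.norm_eq_abs, Real.norm_eq_abs,
    abs_of_pos hx, inv_mul_le_iff₀ hx]
  refine (hb _ ((abs_expWeighted_mul_le v x).trans hv)).trans ?_
  rw [abs_mul, abs_of_pos hx, Real.mul_rpow hx.le (abs_nonneg _)]
  -- Since the weight is at most 1 and s + 1 ≥ 1, the power bound on F supplies the factor needed to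
  -- cancel the inverse weight.
  have h1 : expWeighted x ^ (s + 1) ≤ expWeighted x := by
    calc expWeighted x ^ (s + 1) ≤ expWeighted x ^ (1 : ℝ) :=
          Real.rpow_le_rpow_of_exponent_ge hx (expWeighted_le_one x) (by linarith)
      _ = _ := Real.rpow_one _
  have h2 : |v x| ^ (s + 1) ≤ ‖v‖ ^ (s + 1) := by gcongr
  calc _ ≤ K * (expWeighted x * ‖v‖ ^ (s + 1)) := by gcongr
    _ = _ := by ring

theorem norm_nemytskii_le (hs : 0 ≤ s) (hK : 0 ≤ K)
    (hb : ∀ t, |t| ≤ 1 → |f t| ≤ K * |t| ^ s) {v : ℝ →ᵇ ℝ} (hv : ‖v‖ ≤ 1) :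
    ‖nemytskii f v‖ ≤ K * ‖v‖ ^ s := by
  rw [BoundedContinuousFunction.norm_le (by positivity)]
  intro x
  refine (hb _ ((abs_expWeighted_mul_le v x).trans hv)).trans ?_
  gcongr
  exact abs_expWeighted_mul_le v x

theorem norm_fderiv_weightedNemytskii_le (hs : 0 ≤ s) (hK : 0 ≤ K)
    (hb : ∀ t, |t| ≤ 1 → |f t| ≤ K * |t| ^ s) {v : ℝ →ᵇ ℝ} (hv : ‖v‖ ≤ 1) :
    ‖fderiv ℝ (weightedNemytskii F f hF h0) v‖ ≤ K * ‖v‖ ^ s := by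
  rw [fderiv_weightedNemytskii]
  exact (norm_bcfMul_apply_le _).trans (norm_nemytskii_le hs hK hb hv)

theorem norm_fderiv_fderiv_weightedNemytskii_le (hs : 0 ≤ s) (hK : 0 ≤ K)
    (hf : ∀ t, HasDerivAt f (f' t) t)
    (hb : ∀ t, |t| ≤ 1 → |f' t| ≤ K * |t| ^ s) {v : ℝ →ᵇ ℝ} (hv : ‖v‖ ≤ 1) (ξ η : ℝ →ᵇ ℝ) :
    ‖fderiv ℝ (fderiv ℝ (weightedNemytskii F f hF h0)) v ξ η‖ ≤ K * ‖v‖ ^ s * ‖ξ‖ * ‖η‖ := by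
  rw [fderiv_weightedNemytskii]
  have h1 := (bcfMul.hasFDerivAt).comp v (hasFDerivAt_nemytskii hf v)
  have h2 : fderiv ℝ (fun v => bcfMul (nemytskii f v)) v = _ := h1.fderiv
  rw [h2]
  change ‖expWeighted * nemytskii f' v * ξ * η‖ ≤ _
  have h3 := norm_nemytskii_le hs hK hb hv
  have h4 := norm_expWeighted_le
  calc _ ≤ ‖expWeighted‖ * ‖nemytskii f' v‖ * ‖ξ‖ * ‖η‖ := by
        refine (norm_mul_le _ _).trans ?_
        gcongr
        refine (norm_mul_le _ _).trans ?_
        gcongr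
        exact norm_mul_le _ _
    _ ≤ 1 * (K * ‖v‖ ^ s) * ‖ξ‖ * ‖η‖ := by gcongr
    _ = _ := by ring

end

end DeltaNLS

namespace DeltaNLS

/-! ### A bifurcation problem in a Banach space -/

section

variable {E : Type*} [NormedAddCommGroup E] [NormedSpace ℝ E]

/-- `G` is `C¹` and vanishes to order `s + 1` at the origin. -/
structure HasPowerBound (G : E → E) (K s : ℝ) : Prop where
  contDiff : ContDiff ℝ 1 G
  nonneg : 0 ≤ K
  pos : 0 < s
  norm_le : ∀ v, ‖v‖ ≤ 1 → ‖G v‖ ≤ K * ‖v‖ ^ (s + 1)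
  norm_fderiv_le : ∀ v, ‖v‖ ≤ 1 → ‖fderiv ℝ G v‖ ≤ K * ‖v‖ ^ s

/-- The second-order analogue of `HasPowerBound`. -/
structure HasSecondPowerBound (G : E → E) (K s : ℝ) : Prop where
  contDiff : ContDiff ℝ 2 G
  one_lt : 1 < s
  norm_le : ∀ v, ‖v‖ ≤ 1 → ∀ ξ η, ‖fderiv ℝ (fderiv ℝ G) v ξ η‖ ≤ K * ‖v‖ ^ (s - 1) * ‖ξ‖ * ‖η‖

/-- The rescaled nonlinearity `ρ⁻¹ G(ρ(φ + w))`. -/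
def scaled (G : E → E) (φ : E) (ρ : ℝ) (w : E) : E := ρ⁻¹ • G (ρ • (φ + w))

/-- The source term of the equation for `w`. -/
def source (G : E → E) (φ : E) (ℓ : E →L[ℝ] ℝ) (ρ : ℝ) (w : E) : E :=
  -scaled G φ ρ w + ℓ (scaled G φ ρ w) • w

/-- The size of the nonlinear terms at scale `ρ`. -/
def smallness (φ : E) (K s ρ : ℝ) : ℝ := K * (‖φ‖ + 1) ^ (s + 1) * ρ ^ s

variable {G : E → E} {K s ρ : ℝ} {φ w w' : E} {ℓ : E →L[ℝ] ℝ} {T : E →L[ℝ] E}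

theorem norm_profile_le (hρ : 0 < ρ) (hw : ‖w‖ ≤ 1) : ‖ρ • (φ + w)‖ ≤ ρ * (‖φ‖ + 1) := by
  rw [norm_smul, Real.norm_eq_abs, abs_of_pos hρ]
  gcongr
  exact (norm_add_le _ _).trans (by linarith)

namespace HasPowerBound

theorem smallness_nonneg (h : HasPowerBound G K s) (φ : E) (hρ : 0 < ρ) :
    0 ≤ smallness φ K s ρ := by
  have := h.nonneg
  unfold smallness; positivity

theorem norm_comp_le (h : HasPowerBound G K s) (hρ : 0 < ρ) (hρ1 : ρ * (‖φ‖ + 1) ≤ 1)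
    (hw : ‖w‖ ≤ 1) : ‖G (ρ • (φ + w))‖ ≤ ρ * smallness φ K s ρ := by
  have hv := norm_profile_le (φ := φ) hρ hw
  have hK := h.nonneg
  have hs := h.pos
  refine (h.norm_le _ (hv.trans hρ1)).trans ?_
  calc K * ‖ρ • (φ + w)‖ ^ (s + 1) ≤ K * (ρ * (‖φ‖ + 1)) ^ (s + 1) := by gcongr
    _ = _ := by
      rw [Real.mul_rpow hρ.le (by positivity), Real.rpow_add hρ, Real.rpow_one, smallness]; ring

theorem norm_scaled_le (h : HasPowerBound G K s) (hρ : 0 < ρ) (hρ1 : ρ * (‖φ‖ + 1) ≤ 1)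
    (hw : ‖w‖ ≤ 1) : ‖scaled G φ ρ w‖ ≤ smallness φ K s ρ := by
  rw [scaled, norm_smul, norm_inv, Real.norm_eq_abs, abs_of_pos hρ, inv_mul_le_iff₀ hρ]
  exact h.norm_comp_le hρ hρ1 hw

/-- The natural constant is (‖φ‖ + 1)^s. It is enlarged to the exponent s + 1 so that one quantity
`smallness` controls both G and its derivative. -/
theorem norm_fderiv_comp_le (h : HasPowerBound G K s) (hρ : 0 < ρ) (hρ1 : ρ * (‖φ‖ + 1) ≤ 1)
    (hw : ‖w‖ ≤ 1) : ‖fderiv ℝ G (ρ • (φ + w))‖ ≤ smallness φ K s ρ := by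
  have hv := norm_profile_le (φ := φ) hρ hw
  have hK := h.nonneg
  have hs := h.pos
  refine (h.norm_fderiv_le _ (hv.trans hρ1)).trans ?_
  calc K * ‖ρ • (φ + w)‖ ^ s ≤ K * (ρ * (‖φ‖ + 1)) ^ s := by gcongr
    _ = K * (‖φ‖ + 1) ^ s * ρ ^ s := by rw [Real.mul_rpow hρ.le (by positivity)]; ring
    _ ≤ _ := by
      unfold smallness
      gcongr
      · linarith [norm_nonneg φ]
      · linarith

theorem norm_scaled_sub_le (h : HasPowerBound G K s) (hρ : 0 < ρ) (hρ1 : ρ * (‖φ‖ + 1) ≤ 1)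
    (hw : ‖w‖ ≤ 1) (hw' : ‖w'‖ ≤ 1) :
    ‖scaled G φ ρ w - scaled G φ ρ w'‖ ≤ smallness φ K s ρ * ‖w - w'‖ := by
  have hd : ∀ y ∈ Metric.closedBall (0 : E) 1, HasFDerivWithinAt (fun y => scaled G φ ρ y)
      (ρ⁻¹ • (fderiv ℝ G (ρ • (φ + y)) ∘L (ρ • ContinuousLinearMap.id ℝ E)))
      (Metric.closedBall (0 : E) 1) y := by
    intro y _
    have h1 : HasFDerivAt (fun y => ρ • (φ + y)) (ρ • ContinuousLinearMap.id ℝ E) y :=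
      ((hasFDerivAt_id y).const_add φ).const_smul ρ
    exact (((h.contDiff.differentiable one_ne_zero _).hasFDerivAt.comp y h1).const_smul
      ρ⁻¹).hasFDerivWithinAt
  refine (convex_closedBall (0 : E) 1).norm_image_sub_le_of_norm_hasFDerivWithin_le hd ?_
    (mem_closedBall_zero_iff.2 hw') (mem_closedBall_zero_iff.2 hw)
  intro y hy
  rw [mem_closedBall_zero_iff] at hy
  rw [ContinuousLinearMap.comp_smul, ContinuousLinearMap.comp_id, smul_smul,
    inv_mul_cancel₀ hρ.ne', one_smul]
  exact h.norm_fderiv_comp_le hρ hρ1 hy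

theorem norm_source_le (h : HasPowerBound G K s) (hρ : 0 < ρ) (hρ1 : ρ * (‖φ‖ + 1) ≤ 1)
    (hw : ‖w‖ ≤ 1) : ‖source G φ ℓ ρ w‖ ≤ (1 + ‖ℓ‖) * smallness φ K s ρ := by
  have h1 := h.norm_scaled_le hρ hρ1 hw
  have h2 : ‖ℓ (scaled G φ ρ w)‖ ≤ ‖ℓ‖ * smallness φ K s ρ := (ℓ.le_opNorm _).trans (by gcongr)
  rw [source]
  refine (norm_add_le _ _).trans ?_
  rw [norm_neg, norm_smul]
  nlinarith [norm_nonneg (ℓ (scaled G φ ρ w)), norm_nonneg w]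

/-- The product ℓ(N) w is split as a difference of products on the unit ball, so ‖ℓ‖ enters twice.
The constant 1 + 2‖ℓ‖ in `IsSmallScale` comes from here. -/
theorem norm_source_sub_le (h : HasPowerBound G K s) (hρ : 0 < ρ) (hρ1 : ρ * (‖φ‖ + 1) ≤ 1)
    (hw : ‖w‖ ≤ 1) (hw' : ‖w'‖ ≤ 1) :
    ‖source G φ ℓ ρ w - source G φ ℓ ρ w'‖ ≤
      (1 + 2 * ‖ℓ‖) * smallness φ K s ρ * ‖w - w'‖ := by
  have h1 := h.norm_scaled_sub_le hρ hρ1 hw hw'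
  have h2 := h.norm_scaled_le hρ hρ1 hw'
  have hq := h.smallness_nonneg φ hρ
  have e : source G φ ℓ ρ w - source G φ ℓ ρ w' = -(scaled G φ ρ w - scaled G φ ρ w') +
      ℓ (scaled G φ ρ w - scaled G φ ρ w') • w + ℓ (scaled G φ ρ w') • (w - w') := by
    simp only [source, map_sub]; module
  have h3 : ‖ℓ (scaled G φ ρ w - scaled G φ ρ w')‖ ≤ ‖ℓ‖ * (smallness φ K s ρ * ‖w - w'‖) :=
    (ℓ.le_opNorm _).trans (by gcongr)
  have h4 : ‖ℓ (scaled G φ ρ w')‖ ≤ ‖ℓ‖ * smallness φ K s ρ := (ℓ.le_opNorm _).trans (by gcongr)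
  rw [e]
  refine norm_add₃_le.trans ?_
  rw [norm_neg, norm_smul, norm_smul]
  have h5 : ‖ℓ (scaled G φ ρ w - scaled G φ ρ w')‖ * ‖w‖ ≤
      ‖ℓ‖ * (smallness φ K s ρ * ‖w - w'‖) * 1 := by
    gcongr
  have h6 : ‖ℓ (scaled G φ ρ w')‖ * ‖w - w'‖ ≤ ‖ℓ‖ * smallness φ K s ρ * ‖w - w'‖ := by gcongr
  linarith

end HasPowerBound

/-- The scale `ρ` is small enough for the contraction argument. -/
structure IsSmallScale (φ : E) (ℓ : E →L[ℝ] ℝ) (T : E →L[ℝ] E) (K s ρ : ℝ) : Prop where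
  pos : 0 < ρ
  mul_le_one : ρ * (‖φ‖ + 1) ≤ 1
  le_half : ‖T‖ * ((1 + 2 * ‖ℓ‖) * smallness φ K s ρ) ≤ 1 / 2

theorem HasPowerBound.exists_isSmallScale (h : HasPowerBound G K s) (φ : E) (ℓ : E →L[ℝ] ℝ)
    (T : E →L[ℝ] E) : ∃ a : ℝ, 0 < a ∧ ∀ ρ ∈ Ioo 0 a, IsSmallScale φ ℓ T K s ρ := by
  have t1 : Tendsto (fun ρ : ℝ => ρ * (‖φ‖ + 1)) (𝓝 0) (𝓝 0) := by
    have : Continuous (fun ρ : ℝ => ρ * (‖φ‖ + 1)) := by fun_prop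
    simpa using this.tendsto 0
  have t2 : Tendsto (fun ρ : ℝ => ‖T‖ * ((1 + 2 * ‖ℓ‖) * smallness φ K s ρ)) (𝓝 0) (𝓝 0) := by
    have h1 : Tendsto (fun ρ : ℝ => ρ ^ s) (𝓝 0) (𝓝 (0 ^ s)) :=
      (Real.continuousAt_rpow_const 0 s (.inr h.pos.le)).tendsto
    rw [Real.zero_rpow h.pos.ne'] at h1
    unfold smallness
    simpa using ((h1.const_mul (K * (‖φ‖ + 1) ^ (s + 1))).const_mul (1 + 2 * ‖ℓ‖)).const_mul ‖T‖
  obtain ⟨a, ha, hs⟩ := Metric.eventually_nhds_iff.1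
    ((t1.eventually (gt_mem_nhds zero_lt_one)).and (t2.eventually (gt_mem_nhds one_half_pos)))
  refine ⟨a, ha, fun ρ hρ => ?_⟩
  have := hs (y := ρ) (by rw [Real.dist_eq, sub_zero, abs_of_pos hρ.1]; exact hρ.2)
  exact ⟨hρ.1, this.1.le, this.2.le⟩

theorem HasPowerBound.norm_map_source_sub_le (h : HasPowerBound G K s)
    (hρ : IsSmallScale φ ℓ T K s ρ) (hw : ‖w‖ ≤ 1) (hw' : ‖w'‖ ≤ 1) :
    ‖T (source G φ ℓ ρ w) - T (source G φ ℓ ρ w')‖ ≤ 1 / 2 * ‖w - w'‖ := by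
  rw [← map_sub]
  refine (T.le_opNorm _).trans ?_
  calc ‖T‖ * ‖source G φ ℓ ρ w - source G φ ℓ ρ w'‖
      ≤ ‖T‖ * ((1 + 2 * ‖ℓ‖) * smallness φ K s ρ * ‖w - w'‖) := by
        gcongr; exact h.norm_source_sub_le hρ.pos hρ.mul_le_one hw hw'
    _ = ‖T‖ * ((1 + 2 * ‖ℓ‖) * smallness φ K s ρ) * ‖w - w'‖ := by ring
    _ ≤ _ := by gcongr; exact hρ.le_half

/-- The bound 1/2 rather than 1 places fixed points in the interior of the unit ball, where the
implicit function theorem can be applied. -/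
theorem HasPowerBound.norm_map_source_le (h : HasPowerBound G K s)
    (hρ : IsSmallScale φ ℓ T K s ρ) (hw : ‖w‖ ≤ 1) : ‖T (source G φ ℓ ρ w)‖ ≤ 1 / 2 := by
  have hq := h.smallness_nonneg φ hρ.pos
  refine (T.le_opNorm _).trans (le_trans ?_ hρ.le_half)
  gcongr
  refine (h.norm_source_le hρ.pos hρ.mul_le_one hw).trans ?_
  gcongr
  linarith [norm_nonneg ℓ]

theorem HasPowerBound.exists_fixedPoint [CompleteSpace E] (h : HasPowerBound G K s)
    (hρ : IsSmallScale φ ℓ T K s ρ) : ∃ w : E, ‖w‖ ≤ 1 ∧ w = T (source G φ ℓ ρ w) := by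
  have hmaps : MapsTo (fun w => T (source G φ ℓ ρ w)) (Metric.closedBall 0 1)
      (Metric.closedBall 0 1) := fun w hw => by
    rw [mem_closedBall_zero_iff] at hw ⊢
    exact (h.norm_map_source_le hρ hw).trans (by norm_num)
  have hcontr : ContractingWith (1 / 2) (hmaps.restrict _ _ _) := by
    refine ⟨by norm_num, LipschitzWith.of_dist_le_mul fun x y => ?_⟩
    rw [Subtype.dist_eq, Subtype.dist_eq, dist_eq_norm, dist_eq_norm]
    have := h.norm_map_source_sub_le hρ (mem_closedBall_zero_iff.1 x.2)
      (mem_closedBall_zero_iff.1 y.2)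
    simpa using this
  obtain ⟨w, hw, hfix, -⟩ := hcontr.exists_fixedPoint' Metric.isClosed_closedBall.isComplete hmaps
    (x := 0) (by simp) (by simp)
  exact ⟨w, mem_closedBall_zero_iff.1 hw, hfix.symm⟩

/-- A branch of solutions of `w = T (source ρ w)` over `(0, a)`. -/
structure IsBranch (G : E → E) (φ : E) (ℓ : E →L[ℝ] ℝ) (T : E →L[ℝ] E) (K s a : ℝ)
    (w : ℝ → E) : Prop where
  small : ∀ ρ ∈ Ioo 0 a, IsSmallScale φ ℓ T K s ρ
  norm_le : ∀ ρ ∈ Ioo 0 a, ‖w ρ‖ ≤ 1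
  eq : ∀ ρ ∈ Ioo 0 a, w ρ = T (source G φ ℓ ρ (w ρ))

theorem HasPowerBound.exists_isBranch [CompleteSpace E] (h : HasPowerBound G K s) (φ : E)
    (ℓ : E →L[ℝ] ℝ) (T : E →L[ℝ] E) : ∃ (a : ℝ) (w : ℝ → E), 0 < a ∧ IsBranch G φ ℓ T K s a w := by
  obtain ⟨a, ha, hs⟩ := h.exists_isSmallScale φ ℓ T
  choose! w hw1 hw2 using fun ρ hρ => h.exists_fixedPoint (hs ρ hρ)
  exact ⟨a, w, ha, hs, hw1, hw2⟩

theorem contDiffAt_scaled {n : ℕ∞ω} (hG : ContDiff ℝ n G) (hρ : ρ ≠ 0) :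
    ContDiffAt ℝ n (fun p : ℝ × E => scaled G φ p.1 p.2) (ρ, w) := by
  unfold scaled
  refine ContDiffAt.smul (contDiffAt_fst.inv hρ) ?_
  exact hG.contDiffAt.comp _ (contDiffAt_fst.smul (contDiffAt_const.add contDiffAt_snd))

theorem contDiffAt_source {n : ℕ∞ω} (hG : ContDiff ℝ n G) (hρ : ρ ≠ 0) :
    ContDiffAt ℝ n (fun p : ℝ × E => source G φ ℓ p.1 p.2) (ρ, w) := by
  unfold source
  have h1 := contDiffAt_scaled (φ := φ) (w := w) hG hρ
  exact h1.neg.add ((ℓ.contDiff.contDiffAt.comp _ h1).smul contDiffAt_snd)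

namespace IsBranch

variable {a : ℝ} {w : ℝ → E}

/-- The contraction constant 1/2 bounds the partial derivative A in w, so 1 - A is invertible by a
Neumann series. The branch was chosen pointwise with no continuity in ρ; uniqueness of the fixed
point in the unit ball identifies it with the implicit function. -/
theorem contDiffAt [CompleteSpace E] (hb : IsBranch G φ ℓ T K s a w) (h : HasPowerBound G K s)
    {n : ℕ∞ω} (hn : n ≠ 0) (hG : ContDiff ℝ n G) {ρ : ℝ} (hρ : ρ ∈ Ioo 0 a) :
    ContDiffAt ℝ n w ρ := by
  set f : ℝ × E → E := fun p => p.2 - T (source G φ ℓ p.1 p.2) with hf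
  have cf : ContDiffAt ℝ n f (ρ, w ρ) :=
    contDiffAt_snd.sub (T.contDiff.contDiffAt.comp _ (contDiffAt_source hG hρ.1.ne'))
  have hfix : f (ρ, w ρ) = 0 := sub_eq_zero.2 (hb.eq ρ hρ)
  set A := fderiv ℝ (fun y => T (source G φ ℓ ρ y)) (w ρ) with hA
  have hdA : DifferentiableAt ℝ (fun y => T (source G φ ℓ ρ y)) (w ρ) := by
    have h1 : ContDiffAt ℝ n (fun p : ℝ × E => T (source G φ ℓ p.1 p.2)) (ρ, w ρ) :=
      T.contDiff.contDiffAt.comp _ (contDiffAt_source hG hρ.1.ne')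
    have h2 : ContDiffAt ℝ n (fun y : E => (ρ, y)) (w ρ) := contDiffAt_const.prodMk contDiffAt_id
    exact (h1.comp (w ρ) h2).differentiableAt hn
  have hnear : Metric.closedBall (0 : E) 1 ∈ 𝓝 (w ρ) := by
    refine Metric.closedBall_mem_nhds_of_mem ?_
    rw [mem_ball_zero_iff, hb.eq ρ hρ]
    exact (h.norm_map_source_le (hb.small ρ hρ) (hb.norm_le ρ hρ)).trans_lt (by norm_num)
  have hAn : ‖A‖ ≤ ((1 / 2 : NNReal) : ℝ) := by
    refine norm_fderiv_le_of_lipschitzOn ℝ hnear (LipschitzOnWith.of_dist_le_mul ?_)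
    intro x hx y hy
    rw [dist_eq_norm, dist_eq_norm]
    have := h.norm_map_source_sub_le (hb.small ρ hρ) (mem_closedBall_zero_iff.1 hx)
      (mem_closedBall_zero_iff.1 hy)
    simpa using this
  have hfd : fderiv ℝ f (ρ, w ρ) ∘L .inr ℝ ℝ E = 1 - A := by
    have h1 : HasFDerivAt (fun y => f (ρ, y)) (fderiv ℝ f (ρ, w ρ) ∘L .inr ℝ ℝ E) (w ρ) :=
      (cf.differentiableAt hn).hasFDerivAt.comp (w ρ) (hasFDerivAt_prodMk_right ρ (w ρ))
    have h2 : HasFDerivAt (fun y => f (ρ, y)) (1 - A) (w ρ) :=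
      (hasFDerivAt_id (w ρ)).sub hdA.hasFDerivAt
    exact h1.unique h2
  have hinv : (fderiv ℝ f (ρ, w ρ) ∘L .inr ℝ ℝ E).IsInvertible := by
    have hlt : ‖A‖ < 1 := hAn.trans_lt (by norm_num)
    obtain ⟨U, hU⟩ := isUnit_one_sub_of_norm_lt_one hlt
    rw [hfd, ← hU]
    exact ⟨ContinuousLinearEquiv.unitsEquiv ℝ E U, rfl⟩
  have hψ := cf.contDiffAt_implicitFunction hn hinv
  refine hψ.congr_of_eventuallyEq ?_
  have e1 := cf.eventually_apply_implicitFunction hn hinv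
  have e2 : ∀ᶠ x in 𝓝 ρ, cf.implicitFunction hn hinv x ∈ Metric.closedBall (0 : E) 1 := by
    refine hψ.continuousAt.eventually ?_
    have := cf.implicitFunction_apply_self hn hinv
    simp only at this
    rw [this]
    exact hnear
  -- Near ρ both functions are fixed points in the unit ball at the same scale, so their distance is
  -- at most half of itself.
  filter_upwards [e1, e2, isOpen_Ioo.mem_nhds hρ] with x h1 h2 hx
  rw [hfix] at h1
  have h3 : cf.implicitFunction hn hinv x = T (source G φ ℓ x (cf.implicitFunction hn hinv x)) :=
    sub_eq_zero.1 h1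
  have h4 := h.norm_map_source_sub_le (hb.small x hx) (hb.norm_le x hx)
    (mem_closedBall_zero_iff.1 h2)
  rw [← h3, ← hb.eq x hx] at h4
  have h5 : ‖w x - cf.implicitFunction hn hinv x‖ = 0 := by
    linarith [norm_nonneg (w x - cf.implicitFunction hn hinv x)]
  exact sub_eq_zero.1 (norm_eq_zero.1 h5)

end IsBranch

end

end DeltaNLS

/-! ### Estimates for the first and second derivatives along the branch. -/

namespace DeltaNLS

section

variable {E : Type*} [NormedAddCommGroup E] [NormedSpace ℝ E] [CompleteSpace E]
  {G : E → E} {K s a ρ : ℝ} {φ : E} {ℓ : E →L[ℝ] ℝ} {T : E →L[ℝ] E} {w : ℝ → E}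

namespace IsBranch

theorem source_contDiffAt (hb : IsBranch G φ ℓ T K s a w) (h : HasPowerBound G K s)
    {n : ℕ∞ω} (hn : n ≠ 0) (hG : ContDiff ℝ n G) (hρ : ρ ∈ Ioo 0 a) :
    ContDiffAt ℝ n (fun t => source G φ ℓ t (w t)) ρ :=
  ContDiffAt.comp (g := fun p : ℝ × E => source G φ ℓ p.1 p.2) (f := fun t => (t, w t)) ρ
    (contDiffAt_source hG hρ.1.ne') (contDiffAt_id.prodMk (hb.contDiffAt h hn hG hρ))

theorem scaled_contDiffAt (hb : IsBranch G φ ℓ T K s a w) (h : HasPowerBound G K s)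
    {n : ℕ∞ω} (hn : n ≠ 0) (hG : ContDiff ℝ n G) (hρ : ρ ∈ Ioo 0 a) :
    ContDiffAt ℝ n (fun t => scaled G φ t (w t)) ρ :=
  ContDiffAt.comp (g := fun p : ℝ × E => scaled G φ p.1 p.2) (f := fun t => (t, w t)) ρ
    (contDiffAt_scaled hG hρ.1.ne') (contDiffAt_id.prodMk (hb.contDiffAt h hn hG hρ))

theorem hasDerivAt (hb : IsBranch G φ ℓ T K s a w) (h : HasPowerBound G K s) (hρ : ρ ∈ Ioo 0 a) :
    HasDerivAt w (deriv w ρ) ρ :=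
  ((hb.contDiffAt h one_ne_zero h.contDiff hρ).differentiableAt one_ne_zero).hasDerivAt

theorem hasDerivAt_comp (hb : IsBranch G φ ℓ T K s a w) (h : HasPowerBound G K s)
    (hρ : ρ ∈ Ioo 0 a) : HasDerivAt (fun t => G (t • (φ + w t)))
      (fderiv ℝ G (ρ • (φ + w ρ)) (ρ • deriv w ρ + (φ + w ρ))) ρ := by
  have h1 : HasDerivAt (fun t => t • (φ + w t)) (ρ • deriv w ρ + (φ + w ρ)) ρ := by
    exact ((hasDerivAt_id ρ).smul ((hb.hasDerivAt h hρ).const_add φ)).congr_deriv (by simp)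
  exact (h.contDiff.differentiable one_ne_zero _).hasFDerivAt.comp_hasDerivAt ρ h1

theorem hasDerivAt_scaled (hb : IsBranch G φ ℓ T K s a w) (h : HasPowerBound G K s)
    (hρ : ρ ∈ Ioo 0 a) :
    HasDerivAt (fun t => scaled G φ t (w t)) (deriv (fun t => scaled G φ t (w t)) ρ) ρ :=
  ((hb.scaled_contDiffAt h one_ne_zero h.contDiff hρ).differentiableAt one_ne_zero).hasDerivAt

/-- Differentiating `ρ N = S`. -/
theorem smul_deriv_scaled (hb : IsBranch G φ ℓ T K s a w) (h : HasPowerBound G K s)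
    (hρ : ρ ∈ Ioo 0 a) : ρ • deriv (fun t => scaled G φ t (w t)) ρ + scaled G φ ρ (w ρ) =
      fderiv ℝ G (ρ • (φ + w ρ)) (ρ • deriv w ρ + (φ + w ρ)) := by
  have h1 : HasDerivAt (fun t => t • scaled G φ t (w t))
      (ρ • deriv (fun t => scaled G φ t (w t)) ρ + scaled G φ ρ (w ρ)) ρ := by
    exact ((hasDerivAt_id ρ).smul (hb.hasDerivAt_scaled h hρ)).congr_deriv (by simp)
  refine h1.unique ((hb.hasDerivAt_comp h hρ).congr_of_eventuallyEq ?_)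
  filter_upwards [isOpen_Ioo.mem_nhds hρ] with t ht
  rw [scaled, smul_inv_smul₀ ht.1.ne']

theorem deriv_source (hb : IsBranch G φ ℓ T K s a w) (h : HasPowerBound G K s)
    (hρ : ρ ∈ Ioo 0 a) : deriv (fun t => source G φ ℓ t (w t)) ρ =
      -deriv (fun t => scaled G φ t (w t)) ρ + (ℓ (scaled G φ ρ (w ρ)) • deriv w ρ +
        ℓ (deriv (fun t => scaled G φ t (w t)) ρ) • w ρ) := by
  have h1 := hb.hasDerivAt_scaled h hρ
  exact (h1.neg.add ((ℓ.hasFDerivAt.comp_hasDerivAt ρ h1).smul (hb.hasDerivAt h hρ))).deriv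

theorem deriv_eq (hb : IsBranch G φ ℓ T K s a w) (h : HasPowerBound G K s)
    (hρ : ρ ∈ Ioo 0 a) : deriv w ρ = T (deriv (fun t => source G φ ℓ t (w t)) ρ) := by
  have h1 : HasDerivAt (fun t => T (source G φ ℓ t (w t)))
      (T (deriv (fun t => source G φ ℓ t (w t)) ρ)) ρ :=
    T.hasFDerivAt.comp_hasDerivAt ρ ((hb.source_contDiffAt h one_ne_zero h.contDiff hρ).differentiableAt
      one_ne_zero).hasDerivAt
  refine (h1.congr_of_eventuallyEq ?_).deriv
  filter_upwards [isOpen_Ioo.mem_nhds hρ] with t ht using hb.eq t ht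

theorem norm_map_scaled_le (hb : IsBranch G φ ℓ T K s a w) (h : HasPowerBound G K s)
    (hρ : ρ ∈ Ioo 0 a) : ‖ℓ (scaled G φ ρ (w ρ))‖ ≤ ‖ℓ‖ * smallness φ K s ρ :=
  (ℓ.le_opNorm _).trans (by
    gcongr; exact h.norm_scaled_le hρ.1 (hb.small ρ hρ).mul_le_one (hb.norm_le ρ hρ))

/-- Differentiating the product ρ N avoids the derivative of ρ⁻¹. The unknown quantity ρ‖w'‖ remains
on the right with the small factor `smallness`. -/
theorem mul_norm_deriv_scaled_le (hb : IsBranch G φ ℓ T K s a w) (h : HasPowerBound G K s)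
    (hρ : ρ ∈ Ioo 0 a) : ρ * ‖deriv (fun t => scaled G φ t (w t)) ρ‖ ≤
      smallness φ K s ρ * (‖φ‖ + 2 + ρ * ‖deriv w ρ‖) := by
  have hsm := hb.small ρ hρ
  have hw := hb.norm_le ρ hρ
  have hρ0 := hρ.1
  have e : ρ • deriv (fun t => scaled G φ t (w t)) ρ =
      fderiv ℝ G (ρ • (φ + w ρ)) (ρ • deriv w ρ + (φ + w ρ)) - scaled G φ ρ (w ρ) :=
    eq_sub_of_add_eq (hb.smul_deriv_scaled h hρ)
  have h1 : ‖ρ • deriv w ρ + (φ + w ρ)‖ ≤ ρ * ‖deriv w ρ‖ + (‖φ‖ + 1) := by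
    refine (norm_add_le _ _).trans ?_
    rw [norm_smul, Real.norm_eq_abs, abs_of_pos hρ0]
    have := norm_add_le φ (w ρ)
    linarith
  have h2 : ‖fderiv ℝ G (ρ • (φ + w ρ)) (ρ • deriv w ρ + (φ + w ρ))‖ ≤
      smallness φ K s ρ * (ρ * ‖deriv w ρ‖ + (‖φ‖ + 1)) := by
    refine (ContinuousLinearMap.le_opNorm _ _).trans ?_
    have hq := h.smallness_nonneg φ hρ0
    gcongr
    exact h.norm_fderiv_comp_le hρ0 hsm.mul_le_one hw
  have h3 := h.norm_scaled_le hρ0 hsm.mul_le_one hw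
  have h4 := congrArg norm e
  rw [norm_smul, Real.norm_eq_abs, abs_of_pos hρ0] at h4
  rw [h4]
  refine (norm_sub_le _ _).trans ?_
  linarith

theorem mul_norm_deriv_source_le' (hb : IsBranch G φ ℓ T K s a w) (h : HasPowerBound G K s)
    (hρ : ρ ∈ Ioo 0 a) : ρ * ‖deriv (fun t => source G φ ℓ t (w t)) ρ‖ ≤
      (1 + ‖ℓ‖) * smallness φ K s ρ * (‖φ‖ + 2) +
        (1 + 2 * ‖ℓ‖) * smallness φ K s ρ * (ρ * ‖deriv w ρ‖) := by
  have hρ0 := hρ.1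
  rw [hb.deriv_source h hρ]
  have h1 := hb.mul_norm_deriv_scaled_le h hρ
  set N := deriv (fun t => scaled G φ t (w t)) ρ
  have h2 : ‖ℓ N • w ρ‖ ≤ ‖ℓ‖ * ‖N‖ := by
    rw [norm_smul]
    calc ‖ℓ N‖ * ‖w ρ‖ ≤ ‖ℓ‖ * ‖N‖ * 1 := by
          gcongr
          · exact ℓ.le_opNorm _
          · exact hb.norm_le ρ hρ
      _ = _ := mul_one _
  have h3 : ‖ℓ (scaled G φ ρ (w ρ)) • deriv w ρ‖ ≤ ‖ℓ‖ * smallness φ K s ρ * ‖deriv w ρ‖ := by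
    rw [norm_smul]
    gcongr
    exact hb.norm_map_scaled_le h hρ
  have h4 : ‖-N + (ℓ (scaled G φ ρ (w ρ)) • deriv w ρ + ℓ N • w ρ)‖ ≤
      (1 + ‖ℓ‖) * ‖N‖ + ‖ℓ‖ * smallness φ K s ρ * ‖deriv w ρ‖ := by
    refine (norm_add_le _ _).trans ?_
    have := norm_add_le (ℓ (scaled G φ ρ (w ρ)) • deriv w ρ) (ℓ N • w ρ)
    rw [norm_neg]
    linarith
  calc _ ≤ ρ * ((1 + ‖ℓ‖) * ‖N‖ + ‖ℓ‖ * smallness φ K s ρ * ‖deriv w ρ‖) := by gcongr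
    _ = (1 + ‖ℓ‖) * (ρ * ‖N‖) + ‖ℓ‖ * smallness φ K s ρ * (ρ * ‖deriv w ρ‖) := by ring
    _ ≤ (1 + ‖ℓ‖) * (smallness φ K s ρ * (‖φ‖ + 2 + ρ * ‖deriv w ρ‖)) +
          ‖ℓ‖ * smallness φ K s ρ * (ρ * ‖deriv w ρ‖) := by gcongr
    _ = _ := by ring

theorem norm_mul_smallness_le (hb : IsBranch G φ ℓ T K s a w) (h : HasPowerBound G K s)
    (hρ : ρ ∈ Ioo 0 a) : ‖T‖ * ((1 + ‖ℓ‖) * smallness φ K s ρ) ≤ 1 / 2 := by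
  refine le_trans ?_ (hb.small ρ hρ).le_half
  have hq := h.smallness_nonneg φ hρ.1
  gcongr
  linarith [norm_nonneg ℓ]

/-- Since w' = T n', the estimate of the source returns ρ‖w'‖ with a coefficient at most 1/2, by the
same smallness that gave the contraction, and it can be absorbed. -/
theorem mul_norm_deriv_le (hb : IsBranch G φ ℓ T K s a w) (h : HasPowerBound G K s)
    (hρ : ρ ∈ Ioo 0 a) : ρ * ‖deriv w ρ‖ ≤ ‖φ‖ + 2 := by
  have hρ0 := hρ.1
  have h0 : ‖deriv w ρ‖ ≤ ‖T‖ * ‖deriv (fun t => source G φ ℓ t (w t)) ρ‖ := by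
    conv_lhs => rw [hb.deriv_eq h hρ]
    exact T.le_opNorm _
  have h1 := hb.mul_norm_deriv_source_le' h hρ
  have h2 : ρ * ‖deriv w ρ‖ ≤ ‖T‖ * ((1 + ‖ℓ‖) * smallness φ K s ρ) * (‖φ‖ + 2) +
      ‖T‖ * ((1 + 2 * ‖ℓ‖) * smallness φ K s ρ) * (ρ * ‖deriv w ρ‖) := by
    calc ρ * ‖deriv w ρ‖ ≤ ρ * (‖T‖ * ‖deriv (fun t => source G φ ℓ t (w t)) ρ‖) := by gcongr
      _ = ‖T‖ * (ρ * ‖deriv (fun t => source G φ ℓ t (w t)) ρ‖) := by ring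
      _ ≤ ‖T‖ * ((1 + ‖ℓ‖) * smallness φ K s ρ * (‖φ‖ + 2) +
        (1 + 2 * ‖ℓ‖) * smallness φ K s ρ * (ρ * ‖deriv w ρ‖)) := by gcongr
      _ = _ := by ring
  have h3 : ‖T‖ * ((1 + ‖ℓ‖) * smallness φ K s ρ) * (‖φ‖ + 2) ≤ 1 / 2 * (‖φ‖ + 2) := by
    gcongr; exact hb.norm_mul_smallness_le h hρ
  have h4 : ‖T‖ * ((1 + 2 * ‖ℓ‖) * smallness φ K s ρ) * (ρ * ‖deriv w ρ‖) ≤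
      1 / 2 * (ρ * ‖deriv w ρ‖) := by
    gcongr; exact (hb.small ρ hρ).le_half
  linarith

/-- Feeding the crude bound on w' back into the estimate recovers the full order ρ^s. The
coefficient is the sum of 1 + ‖ℓ‖ and 1 + 2‖ℓ‖. -/
theorem mul_norm_deriv_source_le (hb : IsBranch G φ ℓ T K s a w) (h : HasPowerBound G K s)
    (hρ : ρ ∈ Ioo 0 a) : ρ * ‖deriv (fun t => source G φ ℓ t (w t)) ρ‖ ≤
      (2 + 3 * ‖ℓ‖) * (‖φ‖ + 2) * smallness φ K s ρ := by
  have hq := h.smallness_nonneg φ hρ.1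
  have h1 := hb.mul_norm_deriv_source_le' h hρ
  have h2 : (1 + 2 * ‖ℓ‖) * smallness φ K s ρ * (ρ * ‖deriv w ρ‖) ≤
      (1 + 2 * ‖ℓ‖) * smallness φ K s ρ * (‖φ‖ + 2) := by
    gcongr; exact hb.mul_norm_deriv_le h hρ
  linarith

/-! #### Second derivatives -/

theorem hasDerivAt_deriv (hb : IsBranch G φ ℓ T K s a w) (h : HasPowerBound G K s)
    (h' : HasSecondPowerBound G K s) (hρ : ρ ∈ Ioo 0 a) :
    HasDerivAt (deriv w) (deriv (deriv w) ρ) ρ := by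
  have h1 : ContDiffOn ℝ 2 w (Ioo 0 a) := fun t ht =>
    (hb.contDiffAt h two_ne_zero h'.contDiff ht).contDiffWithinAt
  have h2 : ContDiffOn ℝ 1 (deriv w) (Ioo 0 a) := h1.deriv_of_isOpen isOpen_Ioo (by norm_num)
  exact ((h2.contDiffAt (isOpen_Ioo.mem_nhds hρ)).differentiableAt one_ne_zero).hasDerivAt

theorem hasDerivAt_deriv_scaled (hb : IsBranch G φ ℓ T K s a w) (h : HasPowerBound G K s)
    (h' : HasSecondPowerBound G K s) (hρ : ρ ∈ Ioo 0 a) :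
    HasDerivAt (deriv fun t => scaled G φ t (w t))
      (deriv (deriv fun t => scaled G φ t (w t)) ρ) ρ := by
  have h1 : ContDiffOn ℝ 2 (fun t => scaled G φ t (w t)) (Ioo 0 a) := fun t ht =>
    (hb.scaled_contDiffAt h two_ne_zero h'.contDiff ht).contDiffWithinAt
  have h2 := h1.deriv_of_isOpen (m := 1) isOpen_Ioo (by norm_num)
  exact ((h2.contDiffAt (isOpen_Ioo.mem_nhds hρ)).differentiableAt one_ne_zero).hasDerivAt

theorem hasDerivAt_deriv_source (hb : IsBranch G φ ℓ T K s a w) (h : HasPowerBound G K s)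
    (h' : HasSecondPowerBound G K s) (hρ : ρ ∈ Ioo 0 a) :
    HasDerivAt (deriv fun t => source G φ ℓ t (w t))
      (deriv (deriv fun t => source G φ ℓ t (w t)) ρ) ρ := by
  have h1 : ContDiffOn ℝ 2 (fun t => source G φ ℓ t (w t)) (Ioo 0 a) := fun t ht =>
    (hb.source_contDiffAt h two_ne_zero h'.contDiff ht).contDiffWithinAt
  have h2 := h1.deriv_of_isOpen (m := 1) isOpen_Ioo (by norm_num)
  exact ((h2.contDiffAt (isOpen_Ioo.mem_nhds hρ)).differentiableAt one_ne_zero).hasDerivAt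

theorem deriv_deriv_eq (hb : IsBranch G φ ℓ T K s a w) (h : HasPowerBound G K s)
    (h' : HasSecondPowerBound G K s) (hρ : ρ ∈ Ioo 0 a) :
    deriv (deriv w) ρ = T (deriv (deriv fun t => source G φ ℓ t (w t)) ρ) := by
  refine ((T.hasFDerivAt.comp_hasDerivAt ρ
    (hb.hasDerivAt_deriv_source h h' hρ)).congr_of_eventuallyEq ?_).deriv
  filter_upwards [isOpen_Ioo.mem_nhds hρ] with t ht using hb.deriv_eq h ht

/-- Second derivative of ρ N = G(V) with V = ρ (φ + w), for which V' = ρ w' + φ + w and V'' = ρ w''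
+ 2 w'. -/
theorem smul_deriv_deriv_scaled (hb : IsBranch G φ ℓ T K s a w) (h : HasPowerBound G K s)
    (h' : HasSecondPowerBound G K s) (hρ : ρ ∈ Ioo 0 a) :
    ρ • deriv (deriv fun t => scaled G φ t (w t)) ρ + (2 : ℝ) •
      deriv (fun t => scaled G φ t (w t)) ρ =
      fderiv ℝ (fderiv ℝ G) (ρ • (φ + w ρ)) (ρ • deriv w ρ + (φ + w ρ))
        (ρ • deriv w ρ + (φ + w ρ)) +
      fderiv ℝ G (ρ • (φ + w ρ)) (ρ • deriv (deriv w) ρ + (2 : ℝ) • deriv w ρ) := by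
  have h1 : HasDerivAt (fun t => t • deriv (fun t => scaled G φ t (w t)) t + scaled G φ t (w t))
      (ρ • deriv (deriv fun t => scaled G φ t (w t)) ρ +
        (2 : ℝ) • deriv (fun t => scaled G φ t (w t)) ρ) ρ := by
    have := ((hasDerivAt_id ρ).smul (hb.hasDerivAt_deriv_scaled h h' hρ)).add
      (hb.hasDerivAt_scaled h hρ)
    refine this.congr_deriv ?_
    rw [id, two_smul, one_smul, add_assoc]
  have h2 : HasDerivAt (fun t => t • deriv w t + (φ + w t))
      (ρ • deriv (deriv w) ρ + (2 : ℝ) • deriv w ρ) ρ := by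
    have := ((hasDerivAt_id ρ).smul (hb.hasDerivAt_deriv h h' hρ)).add
      ((hb.hasDerivAt h hρ).const_add φ)
    refine this.congr_deriv ?_
    rw [id, two_smul, one_smul, add_assoc]
  have h3 : HasDerivAt (fun t => t • (φ + w t)) (ρ • deriv w ρ + (φ + w ρ)) ρ := by
    exact ((hasDerivAt_id ρ).smul ((hb.hasDerivAt h hρ).const_add φ)).congr_deriv (by simp)
  have hd : Differentiable ℝ (fderiv ℝ G) :=
    (h'.contDiff.fderiv_right (m := 1) (by norm_num)).differentiable one_ne_zero
  have h4 := ((hd _).hasFDerivAt.comp_hasDerivAt ρ h3).clm_apply h2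
  refine h1.unique (h4.congr_of_eventuallyEq ?_)
  filter_upwards [isOpen_Ioo.mem_nhds hρ] with t ht using hb.smul_deriv_scaled h ht

theorem deriv_deriv_source (hb : IsBranch G φ ℓ T K s a w) (h : HasPowerBound G K s)
    (h' : HasSecondPowerBound G K s) (hρ : ρ ∈ Ioo 0 a) :
    deriv (deriv fun t => source G φ ℓ t (w t)) ρ =
      -deriv (deriv fun t => scaled G φ t (w t)) ρ + (ℓ (scaled G φ ρ (w ρ)) • deriv (deriv w) ρ +
        (2 * ℓ (deriv (fun t => scaled G φ t (w t)) ρ)) • deriv w ρ +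
        ℓ (deriv (deriv fun t => scaled G φ t (w t)) ρ) • w ρ) := by
  have h0 := hb.hasDerivAt h hρ
  have h1 := hb.hasDerivAt_scaled h hρ
  have h2 := hb.hasDerivAt_deriv_scaled h h' hρ
  have h3 := hb.hasDerivAt_deriv h h' hρ
  have h4 := h2.neg.add (((ℓ.hasFDerivAt.comp_hasDerivAt ρ h1).smul h3).add
    ((ℓ.hasFDerivAt.comp_hasDerivAt ρ h2).smul h0))
  refine ((h4.congr_of_eventuallyEq ?_).deriv).trans ?_
  · filter_upwards [isOpen_Ioo.mem_nhds hρ] with t ht using hb.deriv_source h ht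
  · simp only [Function.comp]
    module

/-- The extra factor ρ lifts the order s - 1 of the second derivative of G to s, so that `smallness`
serves once more. -/
theorem mul_norm_fderiv_fderiv_le (hb : IsBranch G φ ℓ T K s a w) (h : HasPowerBound G K s)
    (h' : HasSecondPowerBound G K s) (hρ : ρ ∈ Ioo 0 a) (ξ η : E) :
    ρ * ‖fderiv ℝ (fderiv ℝ G) (ρ • (φ + w ρ)) ξ η‖ ≤ smallness φ K s ρ * ‖ξ‖ * ‖η‖ := by
  have hρ0 := hρ.1
  have hv := norm_profile_le (φ := φ) hρ0 (hb.norm_le ρ hρ)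
  have hK := h.nonneg
  have hs := h'.one_lt
  have h1 := h'.norm_le _ (hv.trans (hb.small ρ hρ).mul_le_one) ξ η
  have h2 : ρ * (K * ‖ρ • (φ + w ρ)‖ ^ (s - 1)) ≤ smallness φ K s ρ := by
    calc ρ * (K * ‖ρ • (φ + w ρ)‖ ^ (s - 1)) ≤ ρ * (K * (ρ * (‖φ‖ + 1)) ^ (s - 1)) := by
          gcongr
      _ = K * (‖φ‖ + 1) ^ (s - 1) * (ρ ^ (s - 1) * ρ) := by
          rw [Real.mul_rpow hρ0.le (by positivity)]; ring
      _ = K * (‖φ‖ + 1) ^ (s - 1) * ρ ^ s := by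
          rw [← Real.rpow_add_one hρ0.ne', sub_add_cancel]
      _ ≤ _ := by
          unfold smallness
          gcongr
          · linarith [norm_nonneg φ]
          · linarith
  calc _ ≤ ρ * (K * ‖ρ • (φ + w ρ)‖ ^ (s - 1) * ‖ξ‖ * ‖η‖) := by gcongr
    _ = ρ * (K * ‖ρ • (φ + w ρ)‖ ^ (s - 1)) * ‖ξ‖ * ‖η‖ := by ring
    _ ≤ _ := by gcongr

theorem sq_mul_norm_deriv_deriv_scaled_le (hb : IsBranch G φ ℓ T K s a w)
    (h : HasPowerBound G K s) (h' : HasSecondPowerBound G K s) (hρ : ρ ∈ Ioo 0 a) :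
    ρ ^ 2 * ‖deriv (deriv fun t => scaled G φ t (w t)) ρ‖ ≤ smallness φ K s ρ *
      (4 * (‖φ‖ + 2) ^ 2 + 6 * (‖φ‖ + 2) + ρ ^ 2 * ‖deriv (deriv w) ρ‖) := by
  have hρ0 := hρ.1
  have hq := h.smallness_nonneg φ hρ0
  have h1 := hb.mul_norm_deriv_scaled_le h hρ
  have h2 := hb.mul_norm_deriv_le h hρ
  have e := hb.smul_deriv_deriv_scaled h h' hρ
  set N₁ := deriv (fun t => scaled G φ t (w t)) ρ
  set N₂ := deriv (deriv fun t => scaled G φ t (w t)) ρ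
  set q := smallness φ K s ρ
  set M := ‖φ‖ + 2 with hM
  have h3 : ‖ρ • deriv w ρ + (φ + w ρ)‖ ≤ 2 * M := by
    refine (norm_add_le _ _).trans ?_
    rw [norm_smul, Real.norm_eq_abs, abs_of_pos hρ0]
    have := norm_add_le φ (w ρ)
    have := hb.norm_le ρ hρ
    linarith
  have h4 := hb.mul_norm_fderiv_fderiv_le h h' hρ (ρ • deriv w ρ + (φ + w ρ))
    (ρ • deriv w ρ + (φ + w ρ))
  set A := fderiv ℝ (fderiv ℝ G) (ρ • (φ + w ρ)) (ρ • deriv w ρ + (φ + w ρ))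
    (ρ • deriv w ρ + (φ + w ρ))
  have h5 : ρ * ‖A‖ ≤ q * (2 * M) * (2 * M) := h4.trans (by gcongr)
  have h6 : ‖fderiv ℝ G (ρ • (φ + w ρ)) (ρ • deriv (deriv w) ρ + (2 : ℝ) • deriv w ρ)‖ ≤
      q * (ρ * ‖deriv (deriv w) ρ‖ + 2 * ‖deriv w ρ‖) := by
    refine (ContinuousLinearMap.le_opNorm _ _).trans ?_
    gcongr
    · exact h.norm_fderiv_comp_le hρ0 (hb.small ρ hρ).mul_le_one (hb.norm_le ρ hρ)
    · refine (norm_add_le _ _).trans ?_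
      rw [norm_smul, norm_smul, Real.norm_eq_abs, abs_of_pos hρ0, Real.norm_eq_abs, abs_two]
  set A' := fderiv ℝ G (ρ • (φ + w ρ)) (ρ • deriv (deriv w) ρ + (2 : ℝ) • deriv w ρ)
  have h7 : ρ * ‖N₂‖ ≤ ‖A‖ + ‖A'‖ + 2 * ‖N₁‖ := by
    have e' : ρ • N₂ = A + A' - (2 : ℝ) • N₁ := eq_sub_of_add_eq e
    have := congrArg norm e'
    rw [norm_smul, Real.norm_eq_abs, abs_of_pos hρ0] at this
    rw [this]
    refine (norm_sub_le _ _).trans ?_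
    rw [norm_smul, Real.norm_eq_abs, abs_two]
    gcongr
    exact norm_add_le _ _
  calc ρ ^ 2 * ‖N₂‖ = ρ * (ρ * ‖N₂‖) := by ring
    _ ≤ ρ * (‖A‖ + q * (ρ * ‖deriv (deriv w) ρ‖ + 2 * ‖deriv w ρ‖) + 2 * ‖N₁‖) := by
        gcongr; linarith
    _ = ρ * ‖A‖ + q * (ρ ^ 2 * ‖deriv (deriv w) ρ‖) + 2 * q * (ρ * ‖deriv w ρ‖) +
        2 * (ρ * ‖N₁‖) := by ring
    _ ≤ q * (2 * M) * (2 * M) + q * (ρ ^ 2 * ‖deriv (deriv w) ρ‖) + 2 * q * M +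
        2 * (q * (M + M)) := by
        have h8 : ρ * ‖N₁‖ ≤ q * (M + M) := h1.trans (by gcongr)
        gcongr
    _ = _ := by ring

/-- The absorption argument one order higher, applied to ρ²‖w''‖. The constant does not depend on ρ,
the first-order quantities having already been bounded by ‖φ‖ + 2. -/
theorem sq_mul_norm_deriv_deriv_source_le (hb : IsBranch G φ ℓ T K s a w)
    (h : HasPowerBound G K s) (h' : HasSecondPowerBound G K s) :
    ∃ D : ℝ, 0 ≤ D ∧ ∀ ρ ∈ Ioo 0 a, ρ ^ 2 * ‖deriv (deriv fun t => source G φ ℓ t (w t)) ρ‖ ≤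
      D * smallness φ K s ρ := by
  set M := ‖φ‖ + 2 with hM
  set D := (1 + ‖ℓ‖) * (4 * M ^ 2 + 6 * M) + 4 * ‖ℓ‖ * M ^ 2 with hD
  have hD0 : 0 ≤ D := by positivity
  refine ⟨(2 + 2 * ‖ℓ‖) * D, by positivity, fun ρ hρ => ?_⟩
  have hρ0 := hρ.1
  have hq := h.smallness_nonneg φ hρ0
  have h1 := hb.mul_norm_deriv_scaled_le h hρ
  have h2 := hb.mul_norm_deriv_le h hρ
  have h3 := hb.sq_mul_norm_deriv_deriv_scaled_le h h' hρ
  have h4 := hb.norm_map_scaled_le h hρ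
  have h5 : ‖deriv (deriv w) ρ‖ ≤ ‖T‖ * ‖deriv (deriv fun t => source G φ ℓ t (w t)) ρ‖ := by
    rw [hb.deriv_deriv_eq h h' hρ]
    exact T.le_opNorm _
  have h6 := (hb.small ρ hρ).le_half
  have h6' := hb.norm_mul_smallness_le h hρ
  rw [hb.deriv_deriv_source h h' hρ] at h5 ⊢
  set N₁ := deriv (fun t => scaled G φ t (w t)) ρ
  set N₂ := deriv (deriv fun t => scaled G φ t (w t)) ρ
  set n₂ := -N₂ + (ℓ (scaled G φ ρ (w ρ)) • deriv (deriv w) ρ + (2 * ℓ N₁) • deriv w ρ + ℓ N₂ • w ρ)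
  set q := smallness φ K s ρ
  have h7 : ‖n₂‖ ≤ (1 + ‖ℓ‖) * ‖N₂‖ + ‖ℓ‖ * q * ‖deriv (deriv w) ρ‖ +
      2 * ‖ℓ‖ * ‖N₁‖ * ‖deriv w ρ‖ := by
    have e1 : ‖ℓ (scaled G φ ρ (w ρ)) • deriv (deriv w) ρ‖ ≤ ‖ℓ‖ * q * ‖deriv (deriv w) ρ‖ := by
      rw [norm_smul]; gcongr
    have e2 : ‖(2 * ℓ N₁) • deriv w ρ‖ ≤ 2 * ‖ℓ‖ * ‖N₁‖ * ‖deriv w ρ‖ := by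
      rw [norm_smul, norm_mul, Real.norm_eq_abs 2, abs_two, mul_assoc 2 ‖ℓ‖]
      gcongr
      exact ℓ.le_opNorm _
    have e3 : ‖ℓ N₂ • w ρ‖ ≤ ‖ℓ‖ * ‖N₂‖ := by
      rw [norm_smul]
      calc ‖ℓ N₂‖ * ‖w ρ‖ ≤ ‖ℓ‖ * ‖N₂‖ * 1 := by
            gcongr
            · exact ℓ.le_opNorm _
            · exact hb.norm_le ρ hρ
        _ = _ := mul_one _
    have e4 : ‖n₂‖ ≤ ‖N₂‖ + (‖ℓ (scaled G φ ρ (w ρ)) • deriv (deriv w) ρ‖ +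
        ‖(2 * ℓ N₁) • deriv w ρ‖ + ‖ℓ N₂ • w ρ‖) := by
      refine (norm_add_le _ _).trans ?_
      rw [norm_neg]
      gcongr
      exact norm_add₃_le
    linarith
  have h8 : ρ ^ 2 * ‖n₂‖ ≤ q * D + (1 + 2 * ‖ℓ‖) * q * (ρ ^ 2 * ‖deriv (deriv w) ρ‖) := by
    calc ρ ^ 2 * ‖n₂‖ ≤ ρ ^ 2 * ((1 + ‖ℓ‖) * ‖N₂‖ + ‖ℓ‖ * q * ‖deriv (deriv w) ρ‖ +
          2 * ‖ℓ‖ * ‖N₁‖ * ‖deriv w ρ‖) := by gcongr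
      _ = (1 + ‖ℓ‖) * (ρ ^ 2 * ‖N₂‖) + ‖ℓ‖ * q * (ρ ^ 2 * ‖deriv (deriv w) ρ‖) +
          2 * ‖ℓ‖ * (ρ * ‖N₁‖) * (ρ * ‖deriv w ρ‖) := by ring
      _ ≤ (1 + ‖ℓ‖) * (q * (4 * M ^ 2 + 6 * M + ρ ^ 2 * ‖deriv (deriv w) ρ‖)) +
          ‖ℓ‖ * q * (ρ ^ 2 * ‖deriv (deriv w) ρ‖) + 2 * ‖ℓ‖ * (q * (M + M)) * M := by
        have h9 : ρ * ‖N₁‖ ≤ q * (M + M) := h1.trans (by gcongr)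
        gcongr
      _ = _ := by rw [hD]; ring
  -- Half of D comes from the source and half of the left side is absorbed.
  have h9 : ρ ^ 2 * ‖deriv (deriv w) ρ‖ ≤ D := by
    have e1 : ρ ^ 2 * ‖deriv (deriv w) ρ‖ ≤ ‖T‖ * ((1 + ‖ℓ‖) * q) * D +
        ‖T‖ * ((1 + 2 * ‖ℓ‖) * q) * (ρ ^ 2 * ‖deriv (deriv w) ρ‖) := by
      calc _ ≤ ρ ^ 2 * (‖T‖ * ‖n₂‖) := by gcongr
        _ = ‖T‖ * (ρ ^ 2 * ‖n₂‖) := by ring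
        _ ≤ ‖T‖ * (1 * q * D + (1 + 2 * ‖ℓ‖) * q * (ρ ^ 2 * ‖deriv (deriv w) ρ‖)) := by
            gcongr; linarith
        _ ≤ ‖T‖ * ((1 + ‖ℓ‖) * q * D + (1 + 2 * ‖ℓ‖) * q * (ρ ^ 2 * ‖deriv (deriv w) ρ‖)) := by
            gcongr
            linarith [norm_nonneg ℓ]
        _ = _ := by ring
    have e2 : ‖T‖ * ((1 + ‖ℓ‖) * q) * D ≤ 1 / 2 * D := by gcongr
    have e3 : ‖T‖ * ((1 + 2 * ‖ℓ‖) * q) * (ρ ^ 2 * ‖deriv (deriv w) ρ‖) ≤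
        1 / 2 * (ρ ^ 2 * ‖deriv (deriv w) ρ‖) := by gcongr
    linarith
  have h10 : (1 + 2 * ‖ℓ‖) * q * (ρ ^ 2 * ‖deriv (deriv w) ρ‖) ≤ (1 + 2 * ‖ℓ‖) * q * D := by
    gcongr
  linarith

end IsBranch

end

end DeltaNLS

namespace DeltaNLS

/-! ### Functions vanishing to some order at the origin -/

section

variable {X Y : Type*} [NormedAddCommGroup X] [NormedAddCommGroup Y] {h : X → Y} {C s : ℝ}

theorem tendsto_const_mul_norm_rpow (C : ℝ) (hs : 0 < s) :
    Tendsto (fun z : X => C * ‖z‖ ^ s) (𝓝 0) (𝓝 0) := by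
  have h1 : Tendsto (fun z : X => ‖z‖ ^ s) (𝓝 0) (𝓝 (‖(0 : X)‖ ^ s)) :=
    (continuous_norm.tendsto _).rpow_const (.inr hs.le)
  rw [norm_zero, Real.zero_rpow hs.ne'] at h1
  simpa using h1.const_mul C

theorem continuousAt_zero_of_norm_le (hs : 0 < s) (hb : ∀ᶠ z in 𝓝 0, ‖h z‖ ≤ C * ‖z‖ ^ s) :
    ContinuousAt h 0 := by
  have h0 : h 0 = 0 := by
    have := hb.self_of_nhds
    rw [norm_zero, Real.zero_rpow hs.ne', mul_zero] at this
    exact norm_le_zero_iff.1 this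
  rw [ContinuousAt, h0]
  exact squeeze_zero_norm' hb (tendsto_const_mul_norm_rpow C hs)

/-- Vanishing of order s + 1 with s > 0 is o(‖z‖). The value at 0 is forced to be 0 by the bound
itself, which holds there too. -/
theorem hasFDerivAt_zero_of_norm_le [NormedSpace ℝ X] [NormedSpace ℝ Y] (hs : 0 < s)
    (hb : ∀ᶠ z in 𝓝 0, ‖h z‖ ≤ C * ‖z‖ ^ (s + 1)) : HasFDerivAt h (0 : X →L[ℝ] Y) 0 := by
  have h0 : h 0 = 0 := by
    have := hb.self_of_nhds
    rw [norm_zero, Real.zero_rpow (by positivity), mul_zero] at this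
    exact norm_le_zero_iff.1 this
  rw [hasFDerivAt_iff_isLittleO_nhds_zero, Asymptotics.isLittleO_iff]
  intro c hc
  filter_upwards [hb, (tendsto_const_mul_norm_rpow (X := X) C hs).eventually (gt_mem_nhds hc)]
    with z h1 h2
  simp only [zero_add, h0, sub_zero, zero_apply]
  refine h1.trans ?_
  rw [Real.rpow_add_one' (norm_nonneg z) (by positivity), ← mul_assoc]
  gcongr

/-- The power bounds make the derivative exist and vanish at 0 and make it continuous there. This
crosses the origin twice: for the family z ↦ z W(|z|) and then for its derivative. -/
theorem contDiffOn_one_of_punctured [NormedSpace ℝ X] [NormedSpace ℝ Y] {a : ℝ} (hs : 0 < s)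
    (hd : ∀ z ∈ Metric.ball (0 : X) a, z ≠ 0 → ContDiffAt ℝ 1 h z)
    (hb : ∀ z ∈ Metric.ball (0 : X) a, ‖h z‖ ≤ C * ‖z‖ ^ (s + 1))
    (hb' : ∀ z ∈ Metric.ball (0 : X) a, z ≠ 0 → ‖fderiv ℝ h z‖ ≤ C * ‖z‖ ^ s) :
    ContDiffOn ℝ 1 h (Metric.ball 0 a) ∧
      ∀ z ∈ Metric.ball (0 : X) a, ‖fderiv ℝ h z‖ ≤ C * ‖z‖ ^ s := by
  by_cases ha : 0 < a
  swap
  · rw [Metric.ball_eq_empty.2 (not_lt.1 ha)]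
    exact ⟨fun z hz => absurd hz (notMem_empty z), fun z hz => absurd hz (notMem_empty z)⟩
  have hnb := Metric.ball_mem_nhds (0 : X) ha
  have h0 : HasFDerivAt h (0 : X →L[ℝ] Y) 0 :=
    hasFDerivAt_zero_of_norm_le hs (eventually_of_mem hnb hb)
  have hall : ∀ z ∈ Metric.ball (0 : X) a, ‖fderiv ℝ h z‖ ≤ C * ‖z‖ ^ s := by
    intro z hz
    by_cases hz0 : z = 0
    · rw [hz0, h0.fderiv, norm_zero, norm_zero, Real.zero_rpow hs.ne', mul_zero]
    · exact hb' z hz hz0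
  refine ⟨?_, hall⟩
  have hcd := contDiffOn_succ_iff_fderiv_of_isOpen (𝕜 := ℝ) (n := 0) (f := h)
    (Metric.isOpen_ball (x := (0 : X)) (ε := a))
  rw [zero_add] at hcd
  refine hcd.2 ⟨fun z hz => ?_, by simp, contDiffOn_zero.2 fun z hz => ?_⟩
  · by_cases hz0 : z = 0
    · rw [hz0]; exact h0.differentiableAt.differentiableWithinAt
    · exact ((hd z hz hz0).differentiableAt one_ne_zero).differentiableWithinAt
  · refine ContinuousAt.continuousWithinAt ?_
    by_cases hz0 : z = 0
    · rw [hz0]; exact continuousAt_zero_of_norm_le hs (eventually_of_mem hnb hall)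
    · exact ((hd z hz hz0).fderiv_right (m := 0) (by norm_num)).continuousAt

end

/-! ### The real nonlinearity `t ↦ g(t²) t` -/

namespace IsNonlinearity

variable {p : ℝ} {g : ℝ → ℝ}

theorem exists_bound (hg : IsNonlinearity p g) : ∃ C : ℝ, 0 < C ∧ ∀ s ∈ Ioc (0 : ℝ) 1,
    |g s| ≤ C * s ^ p ∧ |deriv g s| ≤ C * s ^ (p - 1) ∧ |deriv (deriv g) s| ≤ C * s ^ (p - 2) := by
  obtain ⟨C, hC, h⟩ := hg.bound
  refine ⟨C, hC, fun s hs => ⟨?_, ?_, ?_⟩⟩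
  · simpa using h 0 (by norm_num) s hs
  · simpa using h 1 (by norm_num) s hs
  · have := h 2 (by norm_num) s hs
    rw [iteratedDeriv_succ, iteratedDeriv_one] at this
    exact_mod_cast this

theorem hasDerivAt (hg : IsNonlinearity p g) {s : ℝ} (hs : 0 < s) : HasDerivAt g (deriv g s) s :=
  ((hg.contDiffOn.contDiffAt (Ioi_mem_nhds hs)).differentiableAt (by norm_num)).hasDerivAt

theorem contDiffAt_deriv (hg : IsNonlinearity p g) {s : ℝ} (hs : 0 < s) :
    ContDiffAt ℝ 2 (deriv g) s :=
  (hg.contDiffOn.deriv_of_isOpen isOpen_Ioi (by norm_num)).contDiffAt (Ioi_mem_nhds hs)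

theorem hasDerivAt_deriv (hg : IsNonlinearity p g) {s : ℝ} (hs : 0 < s) :
    HasDerivAt (deriv g) (deriv (deriv g) s) s :=
  ((hg.contDiffAt_deriv hs).differentiableAt (by norm_num)).hasDerivAt

theorem continuousAt_deriv_deriv (hg : IsNonlinearity p g) {s : ℝ} (hs : 0 < s) :
    ContinuousAt (deriv (deriv g)) s := by
  have h1 : ContDiffOn ℝ 2 (deriv g) (Ioi 0) := fun t ht =>
    (hg.contDiffAt_deriv ht).contDiffWithinAt
  exact ((h1.deriv_of_isOpen (m := 1) isOpen_Ioi (by norm_num)).contDiffAt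
    (Ioi_mem_nhds hs)).continuousAt

theorem map_zero (hg : IsNonlinearity p g) (hp : 0 < p) : g 0 = 0 := by
  obtain ⟨C, hC, h⟩ := hg.exists_bound
  have h1 : Tendsto g (𝓝[>] 0) (𝓝 (g 0)) :=
    (hg.continuousOn 0 self_mem_Ici).mono Ioi_subset_Ici_self
  have h2 : Tendsto g (𝓝[>] 0) (𝓝 0) := by
    refine squeeze_zero_norm' (a := fun s => C * ‖s‖ ^ p) ?_
      ((tendsto_const_mul_norm_rpow C hp).mono_left nhdsWithin_le_nhds)
    filter_upwards [Ioc_mem_nhdsGT zero_lt_one] with s hs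
    rw [Real.norm_eq_abs, Real.norm_eq_abs, abs_of_pos hs.1]
    exact (h s hs).1
  exact tendsto_nhds_unique h1 h2

end IsNonlinearity

theorem sq_rpow (t p : ℝ) : (t ^ 2) ^ p = |t| ^ (2 * p) := by
  rw [← sq_abs, ← Real.rpow_natCast, ← Real.rpow_mul (abs_nonneg t)]
  norm_num

/-- `t ↦ g(t²) t`. -/
def oddPower (g : ℝ → ℝ) (t : ℝ) : ℝ := g (t ^ 2) * t

/-- The derivative of `oddPower g`. -/
def oddPowerDeriv (g : ℝ → ℝ) (t : ℝ) : ℝ := g (t ^ 2) + 2 * t ^ 2 * deriv g (t ^ 2)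

/-- The second derivative of `oddPower g`. -/
def oddPowerDeriv₂ (g : ℝ → ℝ) (t : ℝ) : ℝ :=
  6 * t * deriv g (t ^ 2) + 4 * t ^ 3 * deriv (deriv g) (t ^ 2)

namespace IsNonlinearity

variable {p : ℝ} {g : ℝ → ℝ}

theorem exists_oddPower_bound (hg : IsNonlinearity p g) (hp : 0 < p) : ∃ K : ℝ, 0 < K ∧
    ∀ t : ℝ, |t| ≤ 1 → |g (t ^ 2)| ≤ K * |t| ^ (2 * p) ∧
      |oddPower g t| ≤ K * |t| ^ (2 * p + 1) ∧ |oddPowerDeriv g t| ≤ K * |t| ^ (2 * p) ∧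
      (1 < 2 * p → |oddPowerDeriv₂ g t| ≤ K * |t| ^ (2 * p - 1)) := by
  obtain ⟨C, hC, h⟩ := hg.exists_bound
  -- The second derivative needs 6 + 4; the other bounds need at most 3.
  refine ⟨10 * C, by positivity, fun t ht => ?_⟩
  -- The bounds on g stop short of s = 0. There the powers of t annihilate the terms containing
  -- derivatives of g, whatever value `deriv` takes at 0.
  by_cases ht0 : t = 0
  · subst ht0
    have e : (0 : ℝ) ^ (2 * p) = 0 := Real.zero_rpow (by positivity)
    have e' : (0 : ℝ) ^ (2 * p + 1) = 0 := Real.zero_rpow (by positivity)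
    refine ⟨?_, ?_, ?_, fun h2 => ?_⟩
    · simp [hg.map_zero hp, e]
    · simp [oddPower, e']
    · simp [oddPowerDeriv, hg.map_zero hp, e]
    · simp [oddPowerDeriv₂, Real.zero_rpow (sub_pos.2 h2).ne']
  have hat : 0 < |t| := abs_pos.2 ht0
  have hs : t ^ 2 ∈ Ioc (0 : ℝ) 1 := ⟨by positivity, by rw [← sq_abs]; exact pow_le_one₀ hat.le ht⟩
  obtain ⟨h0, h1, h2⟩ := h _ hs
  rw [sq_rpow] at h0 h1 h2
  have m1 : |t| ^ (2 * (p - 1)) * |t| ^ 2 = |t| ^ (2 * p) := by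
    rw [← Real.rpow_natCast, ← Real.rpow_add hat]; congr 1; push_cast; ring
  have m2 : |t| ^ (2 * (p - 1)) * |t| = |t| ^ (2 * p - 1) := by
    rw [← Real.rpow_add_one hat.ne']; congr 1; ring
  have m3 : |t| ^ (2 * (p - 2)) * |t| ^ 3 = |t| ^ (2 * p - 1) := by
    rw [← Real.rpow_natCast, ← Real.rpow_add hat]; congr 1; push_cast; ring
  have hr : 0 ≤ |t| ^ (2 * p) := by positivity
  have hr' : 0 ≤ |t| ^ (2 * p - 1) := by positivity
  refine ⟨by nlinarith, ?_, ?_, fun _ => ?_⟩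
  · rw [oddPower, abs_mul, Real.rpow_add_one hat.ne', ← mul_assoc]
    gcongr
    nlinarith
  · have e : |2 * t ^ 2 * deriv g (t ^ 2)| ≤ 2 * C * |t| ^ (2 * p) := by
      rw [abs_mul, abs_mul, abs_two, abs_pow, ← m1]
      calc 2 * |t| ^ 2 * |deriv g (t ^ 2)| ≤ 2 * |t| ^ 2 * (C * |t| ^ (2 * (p - 1))) := by gcongr
        _ = _ := by ring
    refine (abs_add_le _ _).trans ?_
    nlinarith
  · have e1 : |6 * t * deriv g (t ^ 2)| ≤ 6 * C * |t| ^ (2 * p - 1) := by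
      rw [abs_mul, abs_mul, abs_of_pos (by norm_num : (0 : ℝ) < 6), ← m2]
      calc 6 * |t| * |deriv g (t ^ 2)| ≤ 6 * |t| * (C * |t| ^ (2 * (p - 1))) := by gcongr
        _ = _ := by ring
    have e2 : |4 * t ^ 3 * deriv (deriv g) (t ^ 2)| ≤ 4 * C * |t| ^ (2 * p - 1) := by
      rw [abs_mul, abs_mul, abs_pow, abs_of_pos (by norm_num : (0 : ℝ) < 4), ← m3]
      calc 4 * |t| ^ 3 * |deriv (deriv g) (t ^ 2)|
          ≤ 4 * |t| ^ 3 * (C * |t| ^ (2 * (p - 2))) := by gcongr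
        _ = _ := by ring
    refine (abs_add_le _ _).trans ?_
    linarith

/-- Since g need not be differentiable at 0, the derivative at t = 0 comes from the power bound and
not from the chain rule. -/
theorem hasDerivAt_oddPower (hg : IsNonlinearity p g) (hp : 0 < p) (t : ℝ) :
    HasDerivAt (oddPower g) (oddPowerDeriv g t) t := by
  by_cases ht : t = 0
  · obtain ⟨K, -, hK⟩ := hg.exists_oddPower_bound hp
    have h1 : HasFDerivAt (oddPower g) (0 : ℝ →L[ℝ] ℝ) 0 := by
      refine hasFDerivAt_zero_of_norm_le (C := K) (s := 2 * p) (by positivity) ?_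
      filter_upwards [Metric.closedBall_mem_nhds (0 : ℝ) one_pos] with x hx
      exact (hK x (by simpa using hx)).2.1
    rw [ht]
    refine h1.hasDerivAt.congr_deriv ?_
    simp [oddPowerDeriv, hg.map_zero hp]
  · have h1 : HasDerivAt (fun t : ℝ => t ^ 2) (2 * t) t := by simpa using hasDerivAt_pow 2 t
    have h2 := (HasDerivAt.comp (h := fun t : ℝ => t ^ 2) t
      (hg.hasDerivAt (by positivity : 0 < t ^ 2)) h1).mul (hasDerivAt_id t)
    refine h2.congr_deriv ?_
    simp only [Function.comp, id, oddPowerDeriv]; ring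

theorem hasDerivAt_oddPowerDeriv (hg : IsNonlinearity p g) (hp : 0 < p) (hp' : 1 < 2 * p) (t : ℝ) :
    HasDerivAt (oddPowerDeriv g) (oddPowerDeriv₂ g t) t := by
  by_cases ht : t = 0
  · obtain ⟨K, -, hK⟩ := hg.exists_oddPower_bound hp
    have h1 : HasFDerivAt (oddPowerDeriv g) (0 : ℝ →L[ℝ] ℝ) 0 := by
      refine hasFDerivAt_zero_of_norm_le (C := K) (s := 2 * p - 1) (by linarith) ?_
      filter_upwards [Metric.closedBall_mem_nhds (0 : ℝ) one_pos] with x hx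
      rw [sub_add_cancel]
      exact (hK x (by simpa using hx)).2.2.1
    rw [ht]
    refine h1.hasDerivAt.congr_deriv ?_
    simp [oddPowerDeriv₂]
  · have h1 : HasDerivAt (fun t : ℝ => t ^ 2) (2 * t) t := by simpa using hasDerivAt_pow 2 t
    have hpos : 0 < t ^ 2 := by positivity
    have h2 := (HasDerivAt.comp (h := fun t : ℝ => t ^ 2) t (hg.hasDerivAt hpos) h1).add
      ((h1.const_mul 2).mul
        (HasDerivAt.comp (h := fun t : ℝ => t ^ 2) t (hg.hasDerivAt_deriv hpos) h1))
    refine h2.congr_deriv ?_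
    simp only [Function.comp, oddPowerDeriv₂]; ring

theorem continuous_oddPowerDeriv (hg : IsNonlinearity p g) (hp : 0 < p) :
    Continuous (oddPowerDeriv g) := by
  refine continuous_iff_continuousAt.2 fun t => ?_
  by_cases ht : t = 0
  · obtain ⟨K, -, hK⟩ := hg.exists_oddPower_bound hp
    rw [ht]
    refine continuousAt_zero_of_norm_le (C := K) (s := 2 * p) (by positivity) ?_
    filter_upwards [Metric.closedBall_mem_nhds (0 : ℝ) one_pos] with x hx
    exact (hK x (by simpa using hx)).2.2.1
  · have hpos : 0 < t ^ 2 := by positivity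
    have c1 : ContinuousAt (fun t : ℝ => t ^ 2) t := by fun_prop
    exact (ContinuousAt.comp (f := fun t : ℝ => t ^ 2) (hg.hasDerivAt hpos).continuousAt c1).add
      ((c1.const_mul 2).mul (ContinuousAt.comp (f := fun t : ℝ => t ^ 2) (hg.contDiffAt_deriv hpos).continuousAt c1))

theorem continuous_oddPowerDeriv₂ (hg : IsNonlinearity p g) (hp : 0 < p) (hp' : 1 < 2 * p) :
    Continuous (oddPowerDeriv₂ g) := by
  refine continuous_iff_continuousAt.2 fun t => ?_
  by_cases ht : t = 0
  · obtain ⟨K, -, hK⟩ := hg.exists_oddPower_bound hp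
    rw [ht]
    refine continuousAt_zero_of_norm_le (C := K) (s := 2 * p - 1) (by linarith) ?_
    filter_upwards [Metric.closedBall_mem_nhds (0 : ℝ) one_pos] with x hx
    exact (hK x (by simpa using hx)).2.2.2 hp'
  · have hpos : 0 < t ^ 2 := by positivity
    have c1 : ContinuousAt (fun t : ℝ => t ^ 2) t := by fun_prop
    have c2 : ContinuousAt (fun t : ℝ => 6 * t) t := by fun_prop
    have c3 : ContinuousAt (fun t : ℝ => 4 * t ^ 3) t := by fun_prop
    exact (c2.mul (ContinuousAt.comp (f := fun t : ℝ => t ^ 2) (hg.contDiffAt_deriv hpos).continuousAt c1)).add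
      (c3.mul (ContinuousAt.comp (f := fun t : ℝ => t ^ 2) (hg.continuousAt_deriv_deriv hpos) c1))

/-- The complex nonlinearity `a ↦ g(|a|²) a` is Lipschitz on small balls. -/
theorem exists_lipschitz (hg : IsNonlinearity p g) (hp : 0 < p) : ∃ K : ℝ, 0 < K ∧
    ∀ r ≤ (1 : ℝ), ∀ a b : ℂ, ‖a‖ ≤ r → ‖b‖ ≤ r →
      ‖(g (‖a‖ ^ 2) : ℂ) * a - (g (‖b‖ ^ 2) : ℂ) * b‖ ≤ K * r ^ (2 * p) * ‖a - b‖ := by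
  obtain ⟨K, hK0, hK⟩ := hg.exists_oddPower_bound hp
  refine ⟨3 * K, by positivity, fun r hr a b ha hb => ?_⟩
  have hr0 : 0 ≤ r := (norm_nonneg a).trans ha
  have h1 : |oddPower g ‖a‖ - oddPower g ‖b‖| ≤ K * r ^ (2 * p) * |‖a‖ - ‖b‖| := by
    have := (convex_Icc (0 : ℝ) r).norm_image_sub_le_of_norm_hasDerivWithin_le
      (f := oddPower g) (C := K * r ^ (2 * p))
      (fun x _ => (hg.hasDerivAt_oddPower hp x).hasDerivWithinAt) (fun x hx => ?_)
      ⟨norm_nonneg b, hb⟩ ⟨norm_nonneg a, ha⟩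
    · exact this
    · have hx' : |x| ≤ r := by rw [abs_of_nonneg hx.1]; exact hx.2
      refine ((hK x (hx'.trans hr)).2.2.1).trans ?_
      gcongr
  have h2 : |g (‖b‖ ^ 2)| ≤ K * r ^ (2 * p) := by
    refine ((hK ‖b‖ (by rw [abs_norm]; exact hb.trans hr)).1).trans ?_
    rw [abs_norm]
    gcongr
  have h3 : |‖a‖ - ‖b‖| ≤ ‖a - b‖ := abs_norm_sub_norm_le a b
  have e : (g (‖a‖ ^ 2) : ℂ) * a - (g (‖b‖ ^ 2) : ℂ) * b =
      (g (‖b‖ ^ 2) : ℂ) * (a - b) + ((g (‖a‖ ^ 2) - g (‖b‖ ^ 2) : ℝ) : ℂ) * a := by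
    push_cast; ring
  have h4 : ‖((g (‖a‖ ^ 2) - g (‖b‖ ^ 2) : ℝ) : ℂ) * a‖ ≤ 2 * (K * r ^ (2 * p)) * ‖a - b‖ := by
    rw [norm_mul, Complex.norm_real, Real.norm_eq_abs]
    conv_lhs => rw [← abs_norm a]
    rw [← abs_mul]
    -- Rewriting through t ↦ g(t²) t uses the mean value inequality for a C¹ function and avoids any
    -- derivative of g near 0.
    have e' : (g (‖a‖ ^ 2) - g (‖b‖ ^ 2)) * ‖a‖ =
        (oddPower g ‖a‖ - oddPower g ‖b‖) - g (‖b‖ ^ 2) * (‖a‖ - ‖b‖) := by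
      simp only [oddPower]; ring
    rw [abs_norm, e']
    refine (abs_sub _ _).trans ?_
    rw [abs_mul]
    have h5 : |g (‖b‖ ^ 2)| * |‖a‖ - ‖b‖| ≤ K * r ^ (2 * p) * ‖a - b‖ := by gcongr
    have h6 : K * r ^ (2 * p) * |‖a‖ - ‖b‖| ≤ K * r ^ (2 * p) * ‖a - b‖ := by gcongr
    linarith
  rw [e]
  refine (norm_add_le _ _).trans ?_
  rw [norm_mul, Complex.norm_real, Real.norm_eq_abs]
  have h5 : |g (‖b‖ ^ 2)| * ‖a - b‖ ≤ K * r ^ (2 * p) * ‖a - b‖ := by gcongr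
  linarith

end IsNonlinearity

end DeltaNLS

namespace DeltaNLS

/-! ### Gauge covariant maps in polar form -/

section

open scoped RealInnerProductSpace

variable {X : Type*} [NormedAddCommGroup X] [NormedSpace ℂ X] {W : ℝ → X} {C s a : ℝ}

/-- The gauge covariant map `z ↦ z W(|z|)`. -/
def polar (W : ℝ → X) (z : ℂ) : X := z • W ‖z‖

theorem hasFDerivAt_norm {z : ℂ} (hz : z ≠ 0) :
    HasFDerivAt (fun z : ℂ => ‖z‖) (‖z‖⁻¹ • innerSL ℝ z) z := by
  have h1 := (hasStrictFDerivAt_norm_sq z).hasFDerivAt.sqrt (by simpa using hz)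
  have e : (fun z : ℂ => √(‖z‖ ^ 2)) = fun z => ‖z‖ := by
    ext z; exact Real.sqrt_sq (norm_nonneg z)
  rw [e] at h1
  refine h1.congr_fderiv ?_
  rw [Real.sqrt_sq (norm_nonneg z)]
  ext x
  simp only [smul_apply, smul_eq_mul, nsmul_eq_mul]
  field_simp
  norm_num

theorem hasFDerivAt_comp_norm {V : ℝ → X} {V' : X} {z : ℂ} (hz : z ≠ 0)
    (hV : HasDerivAt V V' ‖z‖) :
    HasFDerivAt (fun z : ℂ => V ‖z‖) ((‖z‖⁻¹ • innerSL ℝ z).smulRight V') z := by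
  have := hV.hasFDerivAt.comp z (hasFDerivAt_norm hz)
  refine this.congr_fderiv ?_
  ext x
  simp [smul_smul]

theorem hasFDerivAt_polar {W' : X} {z : ℂ} (hz : z ≠ 0) (hW : HasDerivAt W W' ‖z‖) :
    HasFDerivAt (polar W) (z • (‖z‖⁻¹ • innerSL ℝ z).smulRight W' +
      (ContinuousLinearMap.id ℝ ℂ).smulRight (W ‖z‖)) z :=
  (hasFDerivAt_id (𝕜 := ℝ) z).smul (hasFDerivAt_comp_norm hz hW)

/-- The radial part is itself ⟪z, ξ⟫ times a polar map, with profile t⁻¹ W'(t); the second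
derivative exploits this. -/
theorem fderiv_polar_apply {W' : X} {z : ℂ} (hz : z ≠ 0) (hW : HasDerivAt W W' ‖z‖) (ξ : ℂ) :
    fderiv ℝ (polar W) z ξ = ξ • W ‖z‖ + ⟪z, ξ⟫ • z • ‖z‖⁻¹ • W' := by
  rw [(hasFDerivAt_polar hz hW).fderiv]
  simp only [add_apply, smul_apply, ContinuousLinearMap.smulRight_apply, innerSL_apply_apply,
    ContinuousLinearMap.id_apply, smul_eq_mul]
  rw [add_comm, smul_comm z, mul_comm, mul_smul, smul_comm z]

theorem contDiffAt_polar {n : ℕ∞ω} {z : ℂ} (hz : z ≠ 0) (hW : ContDiffAt ℝ n W ‖z‖) :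
    ContDiffAt ℝ n (polar W) z :=
  contDiffAt_id.smul (ContDiffAt.comp z hW (contDiffAt_norm ℝ hz))

theorem contDiffOn_one_polar (hs : 0 < s) (hC : 0 ≤ C)
    (hW : ∀ ρ ∈ Ioo 0 a, ContDiffAt ℝ 1 W ρ) (h0 : ∀ ρ ∈ Ioo 0 a, ‖W ρ‖ ≤ C * ρ ^ s)
    (h1 : ∀ ρ ∈ Ioo 0 a, ρ * ‖deriv W ρ‖ ≤ C * ρ ^ s) :
    ContDiffOn ℝ 1 (polar W) (Metric.ball 0 a) ∧
      (∀ z ∈ Metric.ball (0 : ℂ) a, ‖polar W z‖ ≤ C * ‖z‖ ^ (s + 1)) ∧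
      ∀ z ∈ Metric.ball (0 : ℂ) a, ‖fderiv ℝ (polar W) z‖ ≤ 2 * C * ‖z‖ ^ s := by
  have hmem : ∀ z ∈ Metric.ball (0 : ℂ) a, z ≠ 0 → ‖z‖ ∈ Ioo 0 a := fun z hz hz0 =>
    ⟨norm_pos_iff.2 hz0, mem_ball_zero_iff.1 hz⟩
  have hb : ∀ z ∈ Metric.ball (0 : ℂ) a, ‖polar W z‖ ≤ C * ‖z‖ ^ (s + 1) := by
    intro z hz
    by_cases hz0 : z = 0
    · rw [hz0, polar, zero_smul, norm_zero]
      positivity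
    · rw [polar, norm_smul, Real.rpow_add_one (norm_ne_zero_iff.2 hz0), mul_comm, ← mul_assoc]
      gcongr
      exact h0 _ (hmem z hz hz0)
  have hd := contDiffOn_one_of_punctured (h := polar W) (C := 2 * C) (a := a) hs
    (fun z hz hz0 => contDiffAt_polar hz0 (hW _ (hmem z hz hz0)))
    (fun z hz => (hb z hz).trans (by gcongr; linarith)) fun z hz hz0 => ?_
  · exact ⟨hd.1, hb, hd.2⟩
  have hm := hmem z hz hz0
  have hpos := hm.1
  refine ContinuousLinearMap.opNorm_le_bound _ (by positivity) fun ξ => ?_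
  rw [fderiv_polar_apply hz0 ((hW _ hm).differentiableAt one_ne_zero).hasDerivAt]
  refine (norm_add_le _ _).trans ?_
  rw [norm_smul, norm_smul, norm_smul, norm_smul, norm_inv, norm_norm]
  have e1 := h0 _ hm
  have e2 := h1 _ hm
  have e3 : ‖⟪z, ξ⟫‖ ≤ ‖z‖ * ‖ξ‖ := norm_inner_le_norm z ξ
  calc ‖ξ‖ * ‖W ‖z‖‖ + ‖⟪z, ξ⟫‖ * (‖z‖ * (‖z‖⁻¹ * ‖deriv W ‖z‖‖))
      ≤ ‖ξ‖ * (C * ‖z‖ ^ s) + (‖z‖ * ‖ξ‖) * (‖z‖ * (‖z‖⁻¹ * ‖deriv W ‖z‖‖)) := by gcongr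
    _ = ‖ξ‖ * (C * ‖z‖ ^ s) + ‖ξ‖ * (‖z‖ * ‖deriv W ‖z‖‖) := by
        field_simp
    _ ≤ ‖ξ‖ * (C * ‖z‖ ^ s) + ‖ξ‖ * (C * ‖z‖ ^ s) := by gcongr
    _ = _ := by ring

/-- Differentiating ξ W + ⟪z, ξ⟫ z t⁻¹ W' at t = ‖z‖ yields three terms of size ‖W'‖ and one of size
‖z‖² ‖(t⁻¹ W')'‖. The last is worth two more units, whence the 5. -/
theorem norm_fderiv_fderiv_polar_apply_le (hW : ∀ ρ ∈ Ioo 0 a, ContDiffAt ℝ 2 W ρ)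
    (h1 : ∀ ρ ∈ Ioo 0 a, ρ * ‖deriv W ρ‖ ≤ C * ρ ^ s)
    (h2 : ∀ ρ ∈ Ioo 0 a, ρ ^ 2 * ‖deriv (deriv W) ρ‖ ≤ C * ρ ^ s) {z : ℂ}
    (hz : z ∈ Metric.ball (0 : ℂ) a) (hz0 : z ≠ 0) (η ξ : ℂ) :
    ‖fderiv ℝ (fderiv ℝ (polar W)) z η ξ‖ ≤ 5 * C * ‖z‖ ^ (s - 1) * ‖η‖ * ‖ξ‖ := by
  have hmem : ∀ z ∈ Metric.ball (0 : ℂ) a, z ≠ 0 → ‖z‖ ∈ Ioo 0 a := fun z hz hz0 =>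
    ⟨norm_pos_iff.2 hz0, mem_ball_zero_iff.1 hz⟩
  have hm := hmem z hz hz0
  have hpos := hm.1
  have hW1 : ∀ ρ ∈ Ioo 0 a, HasDerivAt W (deriv W ρ) ρ := fun ρ hρ =>
    ((hW ρ hρ).differentiableAt two_ne_zero).hasDerivAt
  have hW2 : HasDerivAt (deriv W) (deriv (deriv W) ‖z‖) ‖z‖ := by
    have e1 : ContDiffOn ℝ 2 W (Ioo 0 a) := fun t ht => (hW t ht).contDiffWithinAt
    have e2 := e1.deriv_of_isOpen (m := 1) isOpen_Ioo (by norm_num)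
    exact ((e2.contDiffAt (isOpen_Ioo.mem_nhds hm)).differentiableAt one_ne_zero).hasDerivAt
  set V' := ‖z‖⁻¹ • deriv (deriv W) ‖z‖ + (-(‖z‖ ^ 2)⁻¹) • deriv W ‖z‖ with hV'
  have hV : HasDerivAt (fun t => t⁻¹ • deriv W t) V' ‖z‖ :=
    (hasDerivAt_inv hpos.ne').smul hW2
  have d1 : DifferentiableAt ℝ (fderiv ℝ (polar W)) z :=
    ((contDiffAt_polar hz0 (hW _ hm)).fderiv_right (m := 1) (by norm_num)).differentiableAt
      one_ne_zero
  have d2 : HasFDerivAt (fun z => fderiv ℝ (polar W) z ξ)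
      ((fderiv ℝ (fderiv ℝ (polar W)) z).flip ξ) z := by
    refine (d1.hasFDerivAt.clm_apply (hasFDerivAt_const ξ z)).congr_fderiv ?_
    ext x
    simp
  have d3 : HasFDerivAt (𝕜 := ℝ) (fun z : ℂ => ξ • W ‖z‖) _ z :=
    (hasFDerivAt_comp_norm hz0 (hW1 _ hm)).const_smul ξ
  have d4 : HasFDerivAt (fun z : ℂ => ⟪z, ξ⟫) (innerSL ℝ ξ) z := by
    have : (fun z : ℂ => ⟪z, ξ⟫) = innerSL ℝ ξ := by
      ext z; rw [innerSL_apply_apply, real_inner_comm]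
    rw [this]
    exact (innerSL ℝ ξ).hasFDerivAt
  have d5 := d3.add (d4.smul (hasFDerivAt_polar hz0 hV))
  have d6 := d5.congr_of_eventuallyEq (f₁ := fun z => fderiv ℝ (polar W) z ξ) (by
    filter_upwards [Metric.isOpen_ball.mem_nhds hz, isOpen_ne.mem_nhds hz0] with y hy hy0
    exact fderiv_polar_apply hy0 (hW1 _ (hmem y hy hy0)) ξ)
  have e := congrArg (fun L : ℂ →L[ℝ] X => L η) (d2.unique d6)
  simp only [ContinuousLinearMap.flip_apply, add_apply, smul_apply,
    ContinuousLinearMap.smulRight_apply, innerSL_apply_apply, ContinuousLinearMap.id_apply,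
    smul_eq_mul, polar] at e
  rw [e]
  set W₁ := deriv W ‖z‖
  set W₂ := deriv (deriv W) ‖z‖
  have a1 : ‖W₁‖ ≤ C * ‖z‖ ^ (s - 1) := by
    rw [Real.rpow_sub_one hpos.ne', ← mul_div_assoc, le_div_iff₀ hpos, mul_comm]
    exact h1 _ hm
  have a2 : ‖z‖ * ‖W₂‖ ≤ C * ‖z‖ ^ (s - 1) := by
    rw [Real.rpow_sub_one hpos.ne', ← mul_div_assoc, le_div_iff₀ hpos]
    calc ‖z‖ * ‖W₂‖ * ‖z‖ = ‖z‖ ^ 2 * ‖W₂‖ := by ring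
      _ ≤ _ := h2 _ hm
  have a3 : ‖z‖ ^ 2 * ‖V'‖ ≤ 2 * (C * ‖z‖ ^ (s - 1)) := by
    have : ‖V'‖ ≤ ‖z‖⁻¹ * ‖W₂‖ + (‖z‖ ^ 2)⁻¹ * ‖W₁‖ := by
      refine (norm_add_le _ _).trans ?_
      rw [norm_smul, norm_smul, norm_neg, norm_inv, norm_inv, norm_pow, norm_norm]
    calc ‖z‖ ^ 2 * ‖V'‖ ≤ ‖z‖ ^ 2 * (‖z‖⁻¹ * ‖W₂‖ + (‖z‖ ^ 2)⁻¹ * ‖W₁‖) := by gcongr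
      _ = ‖z‖ * ‖W₂‖ + ‖W₁‖ := by field_simp
      _ ≤ _ := by linarith
  have i1 : ‖⟪z, η⟫‖ ≤ ‖z‖ * ‖η‖ := norm_inner_le_norm z η
  have i2 : ‖⟪z, ξ⟫‖ ≤ ‖z‖ * ‖ξ‖ := norm_inner_le_norm z ξ
  have i3 : ‖⟪ξ, η⟫‖ ≤ ‖ξ‖ * ‖η‖ := norm_inner_le_norm ξ η
  have b1 : ‖ξ • (‖z‖⁻¹ * ⟪z, η⟫) • W₁‖ ≤ ‖ξ‖ * ‖η‖ * ‖W₁‖ := by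
    rw [norm_smul, norm_smul, norm_mul, norm_inv, norm_norm]
    calc ‖ξ‖ * (‖z‖⁻¹ * ‖⟪z, η⟫‖ * ‖W₁‖) ≤ ‖ξ‖ * (‖z‖⁻¹ * (‖z‖ * ‖η‖) * ‖W₁‖) := by gcongr
      _ = _ := by field_simp
  have b2 : ‖⟪z, ξ⟫ • z • (‖z‖⁻¹ * ⟪z, η⟫) • V'‖ ≤ ‖ξ‖ * ‖η‖ * (‖z‖ ^ 2 * ‖V'‖) := by
    rw [norm_smul, norm_smul, norm_smul, norm_mul, norm_inv, norm_norm]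
    calc ‖⟪z, ξ⟫‖ * (‖z‖ * (‖z‖⁻¹ * ‖⟪z, η⟫‖ * ‖V'‖))
        ≤ (‖z‖ * ‖ξ‖) * (‖z‖ * (‖z‖⁻¹ * (‖z‖ * ‖η‖) * ‖V'‖)) := by gcongr
      _ = _ := by field_simp
  have b3 : ‖⟪z, ξ⟫ • η • ‖z‖⁻¹ • W₁‖ ≤ ‖ξ‖ * ‖η‖ * ‖W₁‖ := by
    rw [norm_smul, norm_smul, norm_smul, norm_inv, norm_norm]
    calc ‖⟪z, ξ⟫‖ * (‖η‖ * (‖z‖⁻¹ * ‖W₁‖)) ≤ (‖z‖ * ‖ξ‖) * (‖η‖ * (‖z‖⁻¹ * ‖W₁‖)) := by gcongr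
      _ = _ := by field_simp
  have b4 : ‖⟪ξ, η⟫ • z • ‖z‖⁻¹ • W₁‖ ≤ ‖ξ‖ * ‖η‖ * ‖W₁‖ := by
    rw [norm_smul, norm_smul, norm_smul, norm_inv, norm_norm, mul_inv_cancel_left₀ hpos.ne']
    gcongr
  have b5 : ‖ξ • (‖z‖⁻¹ * ⟪z, η⟫) • W₁ + (⟪z, ξ⟫ • (z • (‖z‖⁻¹ * ⟪z, η⟫) • V' + η • ‖z‖⁻¹ • W₁) +
      ⟪ξ, η⟫ • z • ‖z‖⁻¹ • W₁)‖ ≤ ‖ξ‖ * ‖η‖ * (3 * ‖W₁‖ + ‖z‖ ^ 2 * ‖V'‖) := by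
    rw [smul_add]
    refine (norm_add_le _ _).trans ?_
    have := norm_add₃_le (a := ⟪z, ξ⟫ • z • (‖z‖⁻¹ * ⟪z, η⟫) • V') (b := ⟪z, ξ⟫ • η • ‖z‖⁻¹ • W₁)
      (c := ⟪ξ, η⟫ • z • ‖z‖⁻¹ • W₁)
    linarith
  refine b5.trans ?_
  calc _ ≤ ‖ξ‖ * ‖η‖ * (5 * (C * ‖z‖ ^ (s - 1))) := by gcongr; linarith
    _ = _ := by ring

theorem contDiffOn_two_polar (hs : 1 < s) (hC : 0 ≤ C)
    (hW : ∀ ρ ∈ Ioo 0 a, ContDiffAt ℝ 2 W ρ) (h0 : ∀ ρ ∈ Ioo 0 a, ‖W ρ‖ ≤ C * ρ ^ s)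
    (h1 : ∀ ρ ∈ Ioo 0 a, ρ * ‖deriv W ρ‖ ≤ C * ρ ^ s)
    (h2 : ∀ ρ ∈ Ioo 0 a, ρ ^ 2 * ‖deriv (deriv W) ρ‖ ≤ C * ρ ^ s) :
    ContDiffOn ℝ 2 (polar W) (Metric.ball 0 a) ∧
      ∀ z ∈ Metric.ball (0 : ℂ) a, ‖fderiv ℝ (fderiv ℝ (polar W)) z‖ ≤ 5 * C * ‖z‖ ^ (s - 1) := by
  have hmem : ∀ z ∈ Metric.ball (0 : ℂ) a, z ≠ 0 → ‖z‖ ∈ Ioo 0 a := fun z hz hz0 =>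
    ⟨norm_pos_iff.2 hz0, mem_ball_zero_iff.1 hz⟩
  obtain ⟨c1, -, c3⟩ := contDiffOn_one_polar (by linarith) hC
    (fun ρ hρ => (hW ρ hρ).of_le one_le_two) h0 h1
  have hd := contDiffOn_one_of_punctured (h := fderiv ℝ (polar W)) (C := 5 * C) (a := a)
    (sub_pos.2 hs)
    (fun z hz hz0 => (contDiffAt_polar hz0 (hW _ (hmem z hz hz0))).fderiv_right (by norm_num))
    (fun z hz => ?_) fun z hz hz0 => ?_
  · refine ⟨?_, hd.2⟩
    have hcd := contDiffOn_succ_iff_fderiv_of_isOpen (𝕜 := ℝ) (n := 1) (f := polar W)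
      (Metric.isOpen_ball (x := (0 : ℂ)) (ε := a))
    rw [one_add_one_eq_two] at hcd
    exact hcd.2 ⟨c1.differentiableOn one_ne_zero, by simp, hd.1⟩
  -- The first-order bound says that the derivative vanishes to order s = (s - 1) + 1, as the
  -- punctured criterion requires.
  · rw [sub_add_cancel]
    refine (c3 z hz).trans ?_
    gcongr
    norm_num
  · exact ContinuousLinearMap.opNorm_le_bound₂ _ (by positivity) fun η ξ =>
      norm_fderiv_fderiv_polar_apply_le hW h1 h2 hz hz0 η ξ

end

end DeltaNLS

namespace DeltaNLS

/-! ### Uniqueness of the branch -/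

theorem eigenfunction_one_eq (x : ℝ) :
    eigenfunction 1 x = ((Real.sqrt (1 / 2) : ℝ) : ℂ) * expHalf x := by
  rw [eigenfunction, expHalf, Complex.ofReal_mul]

/-- The factor √2 is the reciprocal of the normalization √(1/2) of the eigenfunction. -/
theorem integral_expHalf_mul_eq {φ u v : ℝ → ℂ} {z : ℂ} (hφ : φ =ᵐ[volume] eigenfunction 1)
    (huv : u =ᵐ[volume] v) (h : ∫ x, v x * φ x = z) :
    ∫ x, expHalf x * u x = ((Real.sqrt 2 : ℝ) : ℂ) * z := by
  have e : (fun x => expHalf x * u x) =ᵐ[volume] fun x => ((Real.sqrt 2 : ℝ) : ℂ) * (v x * φ x) := by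
    filter_upwards [hφ, huv] with x h1 h2
    have h3 : ((Real.sqrt 2 : ℝ) : ℂ) * ((Real.sqrt (1 / 2) : ℝ) : ℂ) = 1 := by
      rw [← Complex.ofReal_mul, ← Real.sqrt_mul (by norm_num)]
      norm_num
    rw [h1, h2, eigenfunction_one_eq]
    linear_combination (-expHalf x * v x) * h3
  rw [integral_congr_ae e, integral_const_mul, h]

theorem norm_toLp_le_norm {γ : ℝ} (hγ : 0 ≤ γ) (U : WeightedH1 γ) {u : ℝ → ℂ}
    (hu : MemLp u 2 volume) (huU : u =ᵐ[volume] U) : ‖hu.toLp u‖ ≤ ‖U‖ := by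
  refine le_trans ?_ U.norm_toL2_le.1
  refine Lp.norm_le_norm_of_ae_le ?_
  filter_upwards [hu.coeFn_toLp, U.memLp_weighted.coeFn_toLp, huU] with x h1 h2 h3
  rw [h1, h2, h3]
  exact norm_le_norm_weighted hγ _ x

namespace IsBoundStateFamily

variable {g : ℝ → ℝ} {p γ a C : ℝ} {φ : WeightedH1 γ} {Q Q' : ℂ → WeightedH1 γ}

theorem norm_le (h : IsBoundStateFamily g p γ a C φ Q) (hp : 0 < p) (hC : 0 ≤ C) (ha : a ≤ 1)
    {z : ℂ} (hz : z ∈ Metric.ball (0 : ℂ) a) : ‖Q z‖ ≤ (‖φ‖ + C) * ‖z‖ := by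
  have hz1 : ‖z‖ ≤ 1 := (mem_ball_zero_iff.1 hz).le.trans ha
  have h1 := h.norm_sub_le z hz
  have h2 : ‖z‖ ^ (2 * p + 1) ≤ ‖z‖ := by
    conv_rhs => rw [← Real.rpow_one ‖z‖]
    by_cases hz0 : ‖z‖ = 0
    · rw [hz0, Real.zero_rpow (by positivity), Real.zero_rpow one_ne_zero]
    · exact Real.rpow_le_rpow_of_exponent_ge ((norm_nonneg z).lt_of_ne' hz0) hz1 (by linarith)
  have h3 : ‖Q z‖ ≤ ‖z • φ‖ + ‖Q z - z • φ‖ := by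
    have := norm_add_le (z • φ) (Q z - z • φ)
    rwa [add_sub_cancel] at this
  rw [norm_smul] at h3
  nlinarith

/-- The radius is allowed to depend on C: the closeness of the competitors to z φ and of their
energies to -1/4 is measured by that constant. The energies of the two families are not assumed
equal. -/
theorem exists_eqOn (hp : 0 < p) (hg : IsNonlinearity p g) (hγ : 0 ≤ γ) (hγ1 : γ ≤ 1)
    (φ : WeightedH1 γ) (hφ : φ =ᵐ[volume] eigenfunction 1) (hC : 0 ≤ C) :
    ∃ a₁ : ℝ, 0 < a₁ ∧ ∀ a ≤ a₁, ∀ Q Q' : ℂ → WeightedH1 γ, IsBoundStateFamily g p γ a C φ Q →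
      IsBoundStateFamily g p γ a C φ Q' → ∀ z ∈ Metric.ball (0 : ℂ) a, Q' z = Q z := by
  obtain ⟨L, hL, hLip⟩ := hg.exists_lipschitz hp
  set B := ‖φ‖ + C with hB
  have hB0 : 0 ≤ B := by positivity
  -- The first summand is the Lipschitz constant of the nonlinearity on the ball of radius 3B‖z‖,
  -- the second the bound on the energy shift, both without the factor ‖z‖^{2p}.
  set M := L * (3 * B) ^ (2 * p) + C with hM
  set A := 4 * (M * (2 + ‖memLp_expHalf.toLp expHalf‖ * B)) with hA
  obtain ⟨ε, hε, hs⟩ := Metric.eventually_nhds_iff.1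
    ((tendsto_const_mul_norm_rpow (X := ℝ) A (by positivity : 0 < 2 * p)).eventually
      (gt_mem_nhds zero_lt_one))
  -- Here ε makes the contraction factor less than 1, the bound 1 gives ‖Q z‖ ≤ B‖z‖, and 1/(3B + 1)
  -- keeps the sup norms at most 1, where g is controlled.
  refine ⟨min (min ε 1) (1 / (3 * B + 1)), by positivity, fun a ha Q Q' hQ hQ' z hz => ?_⟩
  have ha1 : a ≤ ε := ha.trans ((min_le_left _ _).trans (min_le_left _ _))
  have ha2 : a ≤ 1 := ha.trans ((min_le_left _ _).trans (min_le_right _ _))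
  have ha3 : a ≤ 1 / (3 * B + 1) := ha.trans (min_le_right _ _)
  have hza : ‖z‖ < a := mem_ball_zero_iff.1 hz
  have n1 := hQ'.norm_le hp hC ha2 hz
  have n2 := hQ.norm_le hp hC ha2 hz
  by_cases hz0 : z = 0
  · rw [hz0, norm_zero, mul_zero] at n1 n2
    rw [hz0, norm_le_zero_iff.1 n1, norm_le_zero_iff.1 n2]
  obtain ⟨E₁, -, hE₁⟩ := hQ'.boundState
  obtain ⟨E₂, -, hE₂⟩ := hQ.boundState
  obtain ⟨u₁, vp₁, vm₁, ℓp₁, ℓm₁, h₁, hu₁⟩ := (hE₁ z hz).1.exists_classical hg.continuousOn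
  obtain ⟨u₂, vp₂, vm₂, ℓp₂, ℓm₂, h₂, hu₂⟩ := (hE₂ z hz).1.exists_classical hg.continuousOn
  have hr : 3 * B * ‖z‖ ≤ 1 := by
    have h1 : ‖z‖ ≤ 1 / (3 * B + 1) := hza.le.trans ha3
    rw [le_div_iff₀ (by positivity)] at h1
    nlinarith [norm_nonneg z]
  have s1 : ∀ x, ‖u₁ x‖ ≤ 3 * B * ‖z‖ := fun x =>
    (h₁.norm_le hγ hγ1 hu₁ x).trans (by linarith)
  have s2 : ∀ x, ‖u₂ x‖ ≤ 3 * B * ‖z‖ := fun x =>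
    (h₂.norm_le hγ hγ1 hu₂ x).trans (by linarith)
  have hsq : 1 ≤ Real.sqrt 2 := Real.one_le_sqrt.2 one_le_two
  have hn : ‖((Real.sqrt 2 : ℝ) : ℂ) * z‖ = Real.sqrt 2 * ‖z‖ := by
    rw [norm_mul, Complex.norm_real, Real.norm_eq_abs, abs_of_nonneg (Real.sqrt_nonneg 2)]
  have hzp : 0 ≤ ‖z‖ ^ (2 * p) := by positivity
  have key : u₁ = u₂ := by
    refine IsClassicalBoundState.eq (K := M * ‖z‖ ^ (2 * p)) (B := B)
      (z := ((Real.sqrt 2 : ℝ) : ℂ) * z) hg.continuousOn h₁ h₂ ?_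
      (integral_expHalf_mul_eq hφ hu₁ (hQ'.normalized z hz))
      (integral_expHalf_mul_eq hφ hu₂ (hQ.normalized z hz)) (fun x => ?_) ?_ ?_ ?_
    · refine mul_ne_zero ?_ hz0
      exact_mod_cast (by positivity : Real.sqrt 2 ≠ 0)
    · refine (hLip _ hr _ _ (s1 x) (s2 x)).trans ?_
      refine mul_le_mul_of_nonneg_right ?_ (norm_nonneg _)
      rw [Real.mul_rpow (by positivity) (norm_nonneg z), hM]
      nlinarith [mul_nonneg hC hzp]
    · refine (hE₁ z hz).2.trans ?_
      gcongr
      rw [hM]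
      have : 0 ≤ L * (3 * B) ^ (2 * p) := by positivity
      linarith
    · rw [hn]
      refine (norm_toLp_le_norm hγ _ h₂.memLp hu₂).trans (n2.trans ?_)
      gcongr
      nlinarith [norm_nonneg z]
    · have := hs (y := ‖z‖) (by rw [Real.dist_eq, sub_zero, abs_norm]; exact hza.trans_le ha1)
      rw [norm_norm, hA] at this
      linarith
  refine WeightedH1.ext_ae (hu₁.symm.trans ?_)
  rw [key]
  exact hu₂

end IsBoundStateFamily

end DeltaNLS

/-! ### The branch as a gauge covariant map, and continuity of the energy. -/

namespace DeltaNLS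

section

variable {E X : Type*} [NormedAddCommGroup E] [NormedSpace ℝ E] [CompleteSpace E]
  [NormedAddCommGroup X] [NormedSpace ℂ X]
  {G : E → E} {K s a ρ : ℝ} {φ : E} {ℓ : E →L[ℝ] ℝ} {T : E →L[ℝ] E} {w : ℝ → E}

theorem IsBranch.exists_polar_bound (hb : IsBranch G φ ℓ T K s a w) (h : HasPowerBound G K s)
    (R : E →L[ℝ] X) : ∃ C : ℝ, 0 ≤ C ∧
      ContDiffOn ℝ 1 (polar fun t => R (source G φ ℓ t (w t))) (Metric.ball 0 a) ∧
      (∀ z ∈ Metric.ball (0 : ℂ) a,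
        ‖polar (fun t => R (source G φ ℓ t (w t))) z‖ ≤ C * ‖z‖ ^ (s + 1)) ∧
      (∀ z ∈ Metric.ball (0 : ℂ) a,
        ‖fderiv ℝ (polar fun t => R (source G φ ℓ t (w t))) z‖ ≤ C * ‖z‖ ^ s) ∧
      (HasSecondPowerBound G K s →
        ContDiffOn ℝ 2 (polar fun t => R (source G φ ℓ t (w t))) (Metric.ball 0 a) ∧
        ∀ z ∈ Metric.ball (0 : ℂ) a,
          ‖fderiv ℝ (fderiv ℝ (polar fun t => R (source G φ ℓ t (w t)))) z‖ ≤
            C * ‖z‖ ^ (s - 1)) := by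
  -- The second-order constant is fixed before knowing whether second derivatives exist, so that a
  -- single constant serves all the estimates.
  obtain ⟨D, hD0, hD⟩ : ∃ D : ℝ, 0 ≤ D ∧ (HasSecondPowerBound G K s → ∀ ρ ∈ Ioo 0 a,
      ρ ^ 2 * ‖deriv (deriv fun t => source G φ ℓ t (w t)) ρ‖ ≤ D * smallness φ K s ρ) := by
    by_cases h' : HasSecondPowerBound G K s
    · obtain ⟨D, h1, h2⟩ := hb.sq_mul_norm_deriv_deriv_source_le h h'
      exact ⟨D, h1, fun _ => h2⟩
    · exact ⟨0, le_rfl, fun h'' => absurd h'' h'⟩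
  set n : ℝ → E := fun t => source G φ ℓ t (w t) with hn
  set W : ℝ → X := fun t => R (n t) with hWdef
  have hK := h.nonneg
  set κ := K * (‖φ‖ + 1) ^ (s + 1) with hκ
  have hκ0 : 0 ≤ κ := by positivity
  set M := (2 + 3 * ‖ℓ‖) * (‖φ‖ + 2) + D with hM
  have hM1 : 1 + ‖ℓ‖ ≤ M := by
    rw [hM]
    nlinarith [norm_nonneg ℓ, norm_nonneg φ, mul_nonneg (norm_nonneg ℓ) (norm_nonneg φ)]
  have hM2 : (2 + 3 * ‖ℓ‖) * (‖φ‖ + 2) ≤ M := by linarith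
  have hM3 : D ≤ M := by
    have : 0 ≤ (2 + 3 * ‖ℓ‖) * (‖φ‖ + 2) := by positivity
    linarith
  have hM0 : 0 ≤ M := hD0.trans hM3
  set C := ‖R‖ * (M * κ) with hC
  have hC0 : 0 ≤ C := by positivity
  have dn : ∀ ρ ∈ Ioo 0 a, HasDerivAt n (deriv n ρ) ρ := fun ρ hρ =>
    ((hb.source_contDiffAt h one_ne_zero h.contDiff hρ).differentiableAt one_ne_zero).hasDerivAt
  have dW : ∀ ρ ∈ Ioo 0 a, deriv W ρ = R (deriv n ρ) := fun ρ hρ =>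
    (R.hasFDerivAt.comp_hasDerivAt ρ (dn ρ hρ)).deriv
  have hmono : ∀ ρ ∈ Ioo 0 a, ∀ x : E, ∀ r m : ℝ, 0 ≤ r → m ≤ M →
      r * ‖x‖ ≤ m * smallness φ K s ρ → r * ‖R x‖ ≤ C * ρ ^ s := by
    intro ρ hρ x r m hr hm hx
    have hq := h.smallness_nonneg φ hρ.1
    calc r * ‖R x‖ ≤ r * (‖R‖ * ‖x‖) := by gcongr; exact R.le_opNorm x
      _ = ‖R‖ * (r * ‖x‖) := by ring
      _ ≤ ‖R‖ * (M * smallness φ K s ρ) :=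
        mul_le_mul_of_nonneg_left (hx.trans (by gcongr)) (norm_nonneg R)
      _ = C * ρ ^ s := by rw [hC, smallness, ← hκ]; ring
  have b0 : ∀ ρ ∈ Ioo 0 a, ‖W ρ‖ ≤ C * ρ ^ s := fun ρ hρ => by
    have := hmono ρ hρ (n ρ) 1 (1 + ‖ℓ‖) zero_le_one hM1 (by
      rw [one_mul]
      exact h.norm_source_le hρ.1 (hb.small ρ hρ).mul_le_one (hb.norm_le ρ hρ))
    rwa [one_mul] at this
  have b1 : ∀ ρ ∈ Ioo 0 a, ρ * ‖deriv W ρ‖ ≤ C * ρ ^ s := fun ρ hρ => by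
    rw [dW ρ hρ]
    exact hmono ρ hρ _ ρ _ hρ.1.le hM2 (hb.mul_norm_deriv_source_le h hρ)
  have hWc : ∀ {m : ℕ∞ω}, m ≠ 0 → ContDiff ℝ m G → ∀ ρ ∈ Ioo 0 a, ContDiffAt ℝ m W ρ :=
    fun hm hG ρ hρ => R.contDiff.contDiffAt.comp ρ (hb.source_contDiffAt h hm hG hρ)
  obtain ⟨c1, c2, c3⟩ := contDiffOn_one_polar h.pos hC0 (hWc one_ne_zero h.contDiff) b0 b1
  refine ⟨5 * C, by positivity, c1, fun z hz => (c2 z hz).trans (by gcongr; linarith),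
    fun z hz => (c3 z hz).trans (by gcongr; norm_num), fun h' => ?_⟩
  refine contDiffOn_two_polar h'.one_lt hC0 (hWc two_ne_zero h'.contDiff) b0 b1 fun ρ hρ => ?_
  have e : deriv (deriv W) ρ = R (deriv (deriv n) ρ) := by
    refine ((R.hasFDerivAt.comp_hasDerivAt ρ
      (hb.hasDerivAt_deriv_source h h' hρ)).congr_of_eventuallyEq ?_).deriv
    filter_upwards [isOpen_Ioo.mem_nhds hρ] with t ht using dW t ht
  rw [e]
  exact hmono ρ hρ _ (ρ ^ 2) D (by positivity) hM3 (hD h' ρ hρ)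

theorem IsBranch.continuousOn_map_scaled (hb : IsBranch G φ ℓ T K s a w)
    (h : HasPowerBound G K s) :
    ContinuousOn (fun t => ℓ (scaled G φ t (w t))) (Ico 0 a) := by
  intro ρ hρ
  by_cases hρ0 : ρ = 0
  · subst hρ0
    -- With 0⁻¹ = 0 the rescaled nonlinearity vanishes at ρ = 0 for any `w 0`, which happens to be
    -- its limit.
    have e : ℓ (scaled G φ 0 (w 0)) = 0 := by simp [scaled]
    rw [ContinuousWithinAt, e]
    refine squeeze_zero_norm' (a := fun t => ‖ℓ‖ * (K * (‖φ‖ + 1) ^ (s + 1)) * ‖t‖ ^ s) ?_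
      ((tendsto_const_mul_norm_rpow _ h.pos).mono_left nhdsWithin_le_nhds)
    filter_upwards [self_mem_nhdsWithin] with t ht
    by_cases ht0 : t = 0
    · subst ht0
      have hK := h.nonneg
      rw [e, norm_zero]
      positivity
    · have ht' : t ∈ Ioo 0 a := ⟨lt_of_le_of_ne ht.1 (Ne.symm ht0), ht.2⟩
      refine (hb.norm_map_scaled_le h ht').trans (le_of_eq ?_)
      rw [smallness, Real.norm_eq_abs, abs_of_pos ht'.1]
      ring
  · have hρ' : ρ ∈ Ioo 0 a := ⟨lt_of_le_of_ne hρ.1 (Ne.symm hρ0), hρ.2⟩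
    exact (ℓ.continuous.continuousAt.comp
      (hb.scaled_contDiffAt h one_ne_zero h.contDiff hρ').continuousAt).continuousWithinAt

end

end DeltaNLS

namespace DeltaNLS

open scoped BoundedContinuousFunction

/-! ### The branch of bound states -/

/-- The eigenfunction `φ`, in the variable `e^{|x|/4} u`. -/
def groundProfile : ℝ →ᵇ ℝ := Real.sqrt (1 / 2) • expWeighted

/-- The coefficient along `φ` of an even function, in the variable `e^{|x|/4} u`. -/
def groundFunctional : (ℝ →ᵇ ℝ) →L[ℝ] ℝ := Real.sqrt 2 • expPairing

/-- The even map `u ↦ g(u²)u`, in the variable `e^{|x|/4} u`. -/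
def IsNonlinearity.superposition {p : ℝ} {g : ℝ → ℝ} (hg : IsNonlinearity p g) (hp : 0 < p) :
    (ℝ →ᵇ ℝ) → (ℝ →ᵇ ℝ) :=
  weightedNemytskii (oddPower g) ⟨oddPowerDeriv g, hg.continuous_oddPowerDeriv hp⟩
    (hg.hasDerivAt_oddPower hp) (by simp [oddPower])

theorem IsNonlinearity.exists_hasPowerBound {p : ℝ} {g : ℝ → ℝ} (hg : IsNonlinearity p g)
    (hp : 0 < p) : ∃ K : ℝ, HasPowerBound (hg.superposition hp) K (2 * p) ∧
      (1 < 2 * p → HasSecondPowerBound (hg.superposition hp) K (2 * p)) := by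
  obtain ⟨K, hK0, hK⟩ := hg.exists_oddPower_bound hp
  have h0 : oddPower g 0 = 0 := by simp [oddPower]
  refine ⟨K, ⟨contDiff_one_weightedNemytskii _ h0, hK0.le, by positivity, fun v hv => ?_,
    fun v hv => ?_⟩, fun hp' => ⟨?_, hp', fun v hv ξ η => ?_⟩⟩
  · exact norm_weightedNemytskii_le _ h0 (by positivity) hK0.le (fun t ht => (hK t ht).2.1) hv
  · exact norm_fderiv_weightedNemytskii_le _ h0 (by positivity) hK0.le
      (fun t ht => (hK t ht).2.2.1) hv
  · exact contDiff_two_weightedNemytskii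
      (f' := ⟨oddPowerDeriv₂ g, hg.continuous_oddPowerDeriv₂ hp hp'⟩) _ h0
      (hg.hasDerivAt_oddPowerDeriv hp hp')
  · exact norm_fderiv_fderiv_weightedNemytskii_le
      (f' := ⟨oddPowerDeriv₂ g, hg.continuous_oddPowerDeriv₂ hp hp'⟩) _ h0 (by linarith) hK0.le
      (hg.hasDerivAt_oddPowerDeriv hp hp') (fun t ht => (hK t ht).2.2.2 hp') hv ξ η

theorem IsNonlinearity.exp_mul_superposition {p : ℝ} {g : ℝ → ℝ} (hg : IsNonlinearity p g)
    (hp : 0 < p) (v : ℝ →ᵇ ℝ) (x : ℝ) : Real.exp (-(1 / 4) * |x|) * hg.superposition hp v x =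
      oddPower g (Real.exp (-(1 / 4) * |x|) * v x) := by
  rw [← expWeighted_apply]
  exact mul_inv_cancel_left₀ (by rw [expWeighted_apply]; positivity) _

theorem IsProfile.add {c M M' : ℝ} {U V U' V' : ℝ → ℝ} (h : IsProfile c M U V)
    (h' : IsProfile c M' U' V') :
    IsProfile c (M + M') (fun x => U x + U' x) (fun x => V x + V' x) where
  hasDerivAt x := (h.hasDerivAt x).add (h'.hasDerivAt x)
  continuous := h.continuous.add h'.continuous
  bound x hx := (abs_add_le _ _).trans (by linarith [h.bound x hx, h'.bound x hx])
  bound_deriv x hx := (abs_add_le _ _).trans (by linarith [h.bound_deriv x hx, h'.bound_deriv x hx])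

theorem isProfile_exp (b : ℝ) : IsProfile (1 / 4) |b| (fun x => b * Real.exp (-(1 / 2) * x))
    (fun x => -(b / 2) * Real.exp (-(1 / 2) * x)) where
  hasDerivAt x := ((hasDerivAt_exp_const_mul (-(1 / 2)) x).const_mul b).congr_deriv (by ring)
  continuous := by fun_prop
  bound x hx := by
    rw [abs_mul, abs_of_pos (Real.exp_pos _)]
    gcongr
    linarith
  bound_deriv x hx := by
    rw [abs_mul, abs_of_pos (Real.exp_pos _), abs_neg, abs_div, abs_two]
    gcongr
    · linarith [abs_nonneg b]
    · linarith

/-- The profile of `φ + r(n)`, where `r(n)` is the reduced resolvent of `n`. -/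
def branchProfile (n : ℝ →ᵇ ℝ) (x : ℝ) : ℝ :=
  Real.sqrt (1 / 2) * Real.exp (-(1 / 2) * x) + resSol n x

/-- The derivative of `branchProfile`. -/
def branchProfileDeriv (n : ℝ →ᵇ ℝ) (x : ℝ) : ℝ :=
  -(Real.sqrt (1 / 2) / 2) * Real.exp (-(1 / 2) * x) + resSolDeriv n x

theorem exists_isProfile_branchProfile (n : ℝ →ᵇ ℝ) : ∃ M : ℝ,
    IsProfile (1 / 4) M (branchProfile n) (branchProfileDeriv n) ∧
    IsProfile (1 / 4) M (branchProfileDeriv n)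
      (fun x => branchProfile n x / 4 - Real.exp (-(1 / 4) * x) * expProj n x) := by
  obtain ⟨C, -, hC⟩ := exists_isProfile_resSol
  set b := Real.sqrt (1 / 2) with hb
  have hab : |-(b / 2)| ≤ |b| := by
    rw [abs_neg, abs_div, abs_two]
    linarith [abs_nonneg b]
  refine ⟨|b| + C * ‖n‖, (isProfile_exp b).add (hC n).1, ?_⟩
  have h := (isProfile_exp (-(b / 2))).add (hC n).2
  refine ⟨fun x => (h.hasDerivAt x).congr_deriv ?_, ?_, fun x hx => (h.bound x hx).trans ?_,
    fun x hx => ?_⟩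
  · simp only [branchProfile]; ring
  · refine h.continuous.congr fun x => ?_
    simp only [branchProfile]; ring
  · exact mul_le_mul_of_nonneg_right (by linarith) (Real.exp_nonneg _)
  · have e := h.bound_deriv x hx
    have e' : branchProfile n x / 4 - Real.exp (-(1 / 4) * x) * expProj n x =
        -(-(b / 2) / 2) * Real.exp (-(1 / 2) * x) +
          (resSol n x / 4 - Real.exp (-(1 / 4) * x) * expProj n x) := by
      simp only [branchProfile]; ring
    rw [e']
    exact e.trans (mul_le_mul_of_nonneg_right (by linarith) (Real.exp_nonneg _))

theorem branchProfileDeriv_zero (n : ℝ →ᵇ ℝ) :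
    branchProfileDeriv n 0 = -branchProfile n 0 / 2 := by
  simp only [branchProfile, branchProfileDeriv, resSolDeriv_zero, mul_zero, Real.exp_zero]
  ring

theorem branchProfile_abs (n : ℝ →ᵇ ℝ) (x : ℝ) : branchProfile n |x| =
    Real.exp (-(1 / 4) * |x|) * (groundProfile + reducedResolvent n) x := by
  rw [branchProfile, resSol_abs, BoundedContinuousFunction.add_apply, mul_add, groundProfile,
    BoundedContinuousFunction.smul_apply, expWeighted_apply, smul_eq_mul, mul_left_comm,
    ← Real.exp_add]
  congr 3
  ring

/-- Only φ contributes, since the reduced resolvent is orthogonal to it. The 2 from the two half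
lines cancels the square of √(1/2). -/
theorem integral_branchProfile (n : ℝ →ᵇ ℝ) :
    ∫ x, branchProfile n |x| * (Real.sqrt (1 / 2) * Real.exp (-(1 / 2) * |x|)) = 1 := by
  rw [integral_comp_abs
    (f := fun y => branchProfile n y * (Real.sqrt (1 / 2) * Real.exp (-(1 / 2) * y)))]
  have e : ∫ x in Ioi (0 : ℝ), branchProfile n x *
      (Real.sqrt (1 / 2) * Real.exp (-(1 / 2) * x)) =
      ∫ x in Ioi (0 : ℝ), Real.sqrt (1 / 2) *
        (Real.exp (-(3 / 4) * x) * (groundProfile + reducedResolvent n) x) := by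
    refine setIntegral_congr_fun measurableSet_Ioi fun x hx => ?_
    have h1 := branchProfile_abs n x
    rw [abs_of_pos hx] at h1
    have h2 : Real.exp (-(3 / 4) * x) = Real.exp (-(1 / 4) * x) * Real.exp (-(1 / 2) * x) := by
      rw [← Real.exp_add]; congr 1; ring
    simp only [h1, h2]
    ring
  rw [e, integral_const_mul, ← expPairing_apply, map_add, expPairing_reducedResolvent, add_zero,
    groundProfile, map_smul, expPairing_expWeighted, smul_eq_mul, mul_one,
    Real.mul_self_sqrt (by norm_num)]
  norm_num

/-- Projecting -N adds back its component ℓ(N) φ, while w is already orthogonal and unchanged. So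
inverting on the projected source solves the full equation, with ℓ(N) as the energy shift. -/
theorem expProj_source {G : (ℝ →ᵇ ℝ) → (ℝ →ᵇ ℝ)} {ρ : ℝ} {w : ℝ →ᵇ ℝ}
    (hw : expPairing w = 0) : expProj (source G groundProfile groundFunctional ρ w) =
      -scaled G groundProfile ρ w +
        groundFunctional (scaled G groundProfile ρ w) • (groundProfile + w) := by
  have hsq : Real.sqrt 2 * Real.sqrt (1 / 2) = 1 := by
    rw [← Real.sqrt_mul (by norm_num)]; norm_num
  set N := scaled G groundProfile ρ w with hN
  have e : expPairing N • expWeighted = groundFunctional N • groundProfile := by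
    rw [groundFunctional, groundProfile, smul_apply, smul_smul,
      smul_eq_mul, mul_right_comm, hsq, one_mul]
  rw [expProj_apply, source, ← hN, map_add, map_neg, map_smul, hw, smul_zero, add_zero,
    (neg_smul (expPairing N) expWeighted : (-expPairing N) • expWeighted = _), e]
  module

/-- The profile f satisfies f'' = f/4 - e^{-x/4} · (projected source), and `expProj_source`
identifies the last factor. Multiplying by z restores the nonlinearity because ‖z f‖² = (ρ f)². -/
theorem IsBranch.isBoundState {p : ℝ} {g : ℝ → ℝ} (hg : IsNonlinearity p g) (hp : 0 < p)
    {K s a : ℝ} {w : ℝ → ℝ →ᵇ ℝ} (hb : IsBranch (hg.superposition hp) groundProfile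
      groundFunctional reducedResolvent K s a w) {z : ℂ} (hz : ‖z‖ ∈ Ioo 0 a) {u : ℝ → ℂ}
    (hu : u =ᵐ[volume] z • evenExt (branchProfile
      (source (hg.superposition hp) groundProfile groundFunctional ‖z‖ (w ‖z‖)))) :
    IsBoundState g (-(1 / 4) +
      groundFunctional (scaled (hg.superposition hp) groundProfile ‖z‖ (w ‖z‖))) u := by
  set ρ := ‖z‖ with hρ
  set n := source (hg.superposition hp) groundProfile groundFunctional ρ (w ρ) with hn
  set N := scaled (hg.superposition hp) groundProfile ρ (w ρ) with hN
  set e := groundFunctional N with he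
  have hwn : w ρ = reducedResolvent n := hb.eq ρ hz
  obtain ⟨M, h1, h2⟩ := exists_isProfile_branchProfile n
  refine ⟨_, isDeltaHamiltonian_smul_evenExt (by norm_num) h1 h2 (branchProfileDeriv_zero n) z hu,
    ?_⟩
  filter_upwards [hu] with x hx
  have hproj : expProj n = -N + e • (groundProfile + w ρ) :=
    expProj_source (by rw [hwn]; exact expPairing_reducedResolvent n)
  set f := branchProfile n |x| with hf
  -- Everything is evaluated at |x|: the elements of the function space are not required to be even,
  -- and the even extension reads only their values there.
  have hfx : f = Real.exp (-(1 / 4) * |x|) * (groundProfile + w ρ) |x| := by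
    have := branchProfile_abs n |x|
    rwa [abs_abs, ← hwn] at this
  have hNx : Real.exp (-(1 / 4) * |x|) * N |x| = g ((ρ * f) ^ 2) * f := by
    have h3 := hg.exp_mul_superposition hp (ρ • (groundProfile + w ρ)) |x|
    rw [abs_abs] at h3
    rw [hN, scaled, BoundedContinuousFunction.smul_apply, smul_eq_mul, mul_left_comm, h3,
      BoundedContinuousFunction.smul_apply, smul_eq_mul, mul_left_comm, ← hfx, oddPower]
    have := hz.1.ne'
    field_simp
  have hpx : Real.exp (-(1 / 4) * |x|) * expProj n |x| = -(g ((ρ * f) ^ 2) * f) + e * f := by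
    rw [hproj, BoundedContinuousFunction.add_apply, BoundedContinuousFunction.neg_apply,
      BoundedContinuousFunction.smul_apply, smul_eq_mul, mul_add, mul_neg, hNx, mul_left_comm,
      ← hfx]
  have hux : u x = z * (f : ℂ) := by rw [hx]; rfl
  have hnorm : ‖u x‖ ^ 2 = (ρ * f) ^ 2 := by
    rw [hux, norm_mul, Complex.norm_real, mul_pow, mul_pow, Real.norm_eq_abs, sq_abs]
  have hval : (-(z • evenExt fun x => branchProfile n x / 4 -
      Real.exp (-(1 / 4) * x) * expProj n x)) x =
      -(z * ((f / 4 - Real.exp (-(1 / 4) * |x|) * expProj n |x| : ℝ) : ℂ)) := rfl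
  rw [hval, hpx, hnorm, hux]
  push_cast
  ring

end DeltaNLS

/-! ### Assembly of the family of bound states. -/

namespace DeltaNLS

open scoped BoundedContinuousFunction

theorem evenExt_exp_eq : evenExt (fun x => Real.sqrt (1 / 2) * Real.exp (-(1 / 2) * x)) =
    eigenfunction 1 := rfl

/-- The eigenfunction of `H_1` as an element of `H¹_{1/8}`. -/
theorem exists_weightedH1_eigenfunction :
    ∃ φ : WeightedH1 (1 / 8), φ =ᵐ[volume] eigenfunction 1 :=
  ⟨_, (isProfile_exp (Real.sqrt (1 / 2))).coe_toWeightedH1 (by norm_num : (0 : ℝ) ≤ 1 / 8)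
    (by norm_num)⟩

theorem WeightedH1.coe_smul_add_smul {γ : ℝ} (z : ℂ) {u v : WeightedH1 γ} {f h : ℝ → ℂ}
    (hu : u =ᵐ[volume] f) (hv : v =ᵐ[volume] h) :
    ⇑(z • u + z • v).toAEEqFun =ᵐ[volume] z • (f + h) := by
  filter_upwards [WeightedH1.coe_add (z • u) (z • v), WeightedH1.coe_smul z u,
    WeightedH1.coe_smul z v, hu, hv] with x h1 h2 h3 h4 h5
  rw [h1, Pi.add_apply, h2, h3, Pi.smul_apply, Pi.smul_apply, Pi.smul_apply, Pi.add_apply, h4, h5,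
    smul_add]

theorem isBoundState_zero {g : ℝ → ℝ} (E : ℝ) {u : ℝ → ℂ} (hu : u =ᵐ[volume] 0) :
    IsBoundState g E u := by
  -- Any admissible profile would do, since it is multiplied by 0.
  obtain ⟨M, h1, h2⟩ := exists_isProfile_branchProfile 0
  refine ⟨_, isDeltaHamiltonian_smul_evenExt (by norm_num) h1 h2 (branchProfileDeriv_zero 0) 0
    (u := u) ?_, ?_⟩
  · rwa [zero_smul]
  · filter_upwards [hu] with x hx
    simp [hx]

namespace IsBoundStateFamily

variable {g : ℝ → ℝ} {p γ a a' C : ℝ} {φ : WeightedH1 γ} {Q : ℂ → WeightedH1 γ}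

theorem mono (h : IsBoundStateFamily g p γ a C φ Q) (ha' : 0 ≤ a') (ha : a' ≤ a) :
    IsBoundStateFamily g p γ a' C φ Q := by
  have hs := Metric.ball_subset_ball (x := (0 : ℂ)) ha
  refine ⟨h.contDiffOn.mono hs, fun z hz => h.gauge z (hs hz), fun z hz => h.normalized z (hs hz),
    ?_, fun z hz => h.norm_sub_le z (hs hz), fun z hz => h.norm_partialD_sub_le z (hs hz)⟩
  obtain ⟨E, h1, h2⟩ := h.boundState
  exact ⟨E, h1.mono (Ico_subset_Ico_right (by gcongr)), fun z hz => h2 z (hs hz)⟩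

end IsBoundStateFamily

/-- The correction is assembled from the source rather than from w: the fixed point equation reads w
= T n, and `R` is the same resolvent with values in H¹_{1/8}. The estimates on n along the branch
therefore pass directly to Q. -/
theorem exists_isBoundStateFamily {p : ℝ} (hp : 0 < p) {g : ℝ → ℝ} (hg : IsNonlinearity p g)
    {φ : WeightedH1 (1 / 8)} (hφ : φ =ᵐ[volume] eigenfunction 1) :
    ∃ (a C : ℝ) (Q : ℂ → WeightedH1 (1 / 8)), 0 < a ∧ 0 < C ∧
      IsBoundStateFamily g p (1 / 8) a C φ Q ∧
      (1 < 2 * p → ContDiffOn ℝ 2 Q (Metric.ball 0 a) ∧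
        ∀ z ∈ Metric.ball (0 : ℂ) a, ∀ j k : Fin 2,
          ‖partialD j (partialD k Q) z‖ ≤ C * ‖z‖ ^ (2 * p - 1)) := by
  obtain ⟨K, hG, hG₂⟩ := hg.exists_hasPowerBound hp
  obtain ⟨a, w, ha, hb⟩ := hG.exists_isBranch groundProfile groundFunctional reducedResolvent
  obtain ⟨R, hR⟩ := exists_resolventH1
  obtain ⟨C₁, hC₁, p1, p2, p3, p4⟩ := hb.exists_polar_bound hG R
  set n : ℝ → ℝ →ᵇ ℝ := fun t =>
    source (hg.superposition hp) groundProfile groundFunctional t (w t) with hn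
  set e : ℝ → ℝ := fun t =>
    groundFunctional (scaled (hg.superposition hp) groundProfile t (w t)) with he
  set h : ℂ → WeightedH1 (1 / 8) := polar fun t => R (n t) with hh
  set Q : ℂ → WeightedH1 (1 / 8) := fun z => z • φ + h z with hQ
  set C₂ := ‖groundFunctional‖ * (K * (‖groundProfile‖ + 1) ^ (2 * p + 1)) with hC₂
  have hK := hG.nonneg
  have hC₂0 : 0 ≤ C₂ := by positivity
  have hQae : ∀ z, Q z =ᵐ[volume] z • evenExt (branchProfile (n ‖z‖)) := fun z => by
    refine (WeightedH1.coe_smul_add_smul z hφ (hR (n ‖z‖))).trans (Eventually.of_forall fun x => ?_)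
    simp only [Pi.smul_apply, Pi.add_apply, ← evenExt_exp_eq, evenExt, branchProfile]
    push_cast
    rfl
  have hlin : ContDiff ℝ 2 (fun z : ℂ => z • φ) := contDiff_id.smul contDiff_const
  have hfd : ∀ z ∈ Metric.ball (0 : ℂ) a, ∀ ξ : ℂ, fderiv ℝ Q z ξ = ξ • φ + fderiv ℝ h z ξ := by
    intro z hz ξ
    have h1 : HasFDerivAt (fun z : ℂ => z • φ) ((ContinuousLinearMap.id ℝ ℂ).smulRight φ) z :=
      (hasFDerivAt_id (𝕜 := ℝ) z).smul_const φ
    have h2 := ((p1.contDiffAt (Metric.isOpen_ball.mem_nhds hz)).differentiableAt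
      one_ne_zero).hasFDerivAt
    have h3 : HasFDerivAt Q _ z := h1.add h2
    rw [h3.fderiv]
    rfl
  have hI : ∀ j : Fin 2, ‖Complex.I ^ (j : ℕ)‖ = 1 := fun j => by
    rw [norm_pow, Complex.norm_I, one_pow]
  have hz0 : ∀ z ∈ Metric.ball (0 : ℂ) a, z ≠ 0 → ‖z‖ ∈ Ioo 0 a := fun z hz hz0 =>
    ⟨norm_pos_iff.2 hz0, mem_ball_zero_iff.1 hz⟩
  refine ⟨a, C₁ + C₂ + 1, Q, ha, by positivity, ⟨?_, ?_, ?_, ?_, ?_, ?_⟩, fun hp' => ⟨?_, ?_⟩⟩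
  · exact (hlin.of_le one_le_two).contDiffOn.add p1
  · intro z _ θ
    have hnorm : ‖Complex.exp (Complex.I * θ) * z‖ = ‖z‖ := by
      rw [norm_mul, Complex.norm_exp_I_mul_ofReal, one_mul]
    simp only [hQ, hh, polar, hnorm, mul_smul, smul_add]
  · intro z _
    have e1 : (fun x => Q z x * φ x) =ᵐ[volume] fun x => z * ((branchProfile (n ‖z‖) |x| *
        (Real.sqrt (1 / 2) * Real.exp (-(1 / 2) * |x|)) : ℝ) : ℂ) := by
      filter_upwards [hQae z, hφ] with x h1 h2
      rw [h1, h2, ← evenExt_exp_eq, Pi.smul_apply, smul_eq_mul, evenExt, evenExt]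
      push_cast
      ring
    rw [integral_congr_ae e1, integral_const_mul, integral_complex_ofReal, integral_branchProfile,
      Complex.ofReal_one, mul_one]
  -- The energy is a function of |z|², whereas the branch is parametrized by ρ = |z|.
  · refine ⟨fun σ => -(1 / 4) + e (Real.sqrt σ), ?_, fun z hz => ⟨?_, ?_⟩⟩
    · refine continuousOn_const.add ((hb.continuousOn_map_scaled hG).comp
        Real.continuous_sqrt.continuousOn fun σ hσ => ⟨Real.sqrt_nonneg σ, ?_⟩)
      rw [Real.sqrt_lt' ha]
      exact hσ.2
    · simp only [Real.sqrt_sq (norm_nonneg z)]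
      by_cases hz' : z = 0
      · refine isBoundState_zero _ ?_
        have := hQae z
        rwa [hz', zero_smul, ← hz'] at this
      · exact hb.isBoundState hg hp (hz0 z hz hz') (hQae z)
    · simp only [Real.sqrt_sq (norm_nonneg z)]
      have e1 : -(1 / 4) + e ‖z‖ + 1 / 4 = e ‖z‖ := by ring
      rw [e1]
      by_cases hz' : z = 0
      -- At the origin the energy is exactly -1/4, because `scaled` vanishes at scale 0.
      · have : e ‖z‖ = 0 := by simp [he, hz', scaled]
        rw [this, abs_zero]
        positivity
      · have h1 := hb.norm_map_scaled_le hG (hz0 z hz hz')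
        have h2 : |e ‖z‖| ≤ C₂ * ‖z‖ ^ (2 * p) := h1.trans (le_of_eq (by rw [smallness]; ring))
        refine h2.trans ?_
        gcongr
        linarith
  · intro z hz
    have e1 : Q z - z • φ = h z := add_sub_cancel_left _ _
    rw [e1]
    refine (p2 z hz).trans ?_
    gcongr
    linarith
  · intro z hz j
    have e1 : partialD j Q z - Complex.I ^ (j : ℕ) • φ = fderiv ℝ h z (Complex.I ^ (j : ℕ)) := by
      rw [partialD, hfd z hz, add_sub_cancel_left]
    rw [e1]
    refine (ContinuousLinearMap.le_opNorm _ _).trans ?_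
    rw [hI, mul_one]
    refine (p3 z hz).trans ?_
    gcongr
    linarith
  · exact hlin.contDiffOn.add (p4 (hG₂ hp')).1
  · intro z hz j k
    obtain ⟨q1, q2⟩ := p4 (hG₂ hp')
    have d1 : DifferentiableAt ℝ (fderiv ℝ h) z :=
      ((q1.contDiffAt (Metric.isOpen_ball.mem_nhds hz)).fderiv_right (m := 1)
        (by norm_num)).differentiableAt one_ne_zero
    have d2 : HasFDerivAt (fun y => fderiv ℝ h y (Complex.I ^ (k : ℕ)))
        ((fderiv ℝ (fderiv ℝ h) z).flip (Complex.I ^ (k : ℕ))) z := by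
      refine (d1.hasFDerivAt.clm_apply (hasFDerivAt_const _ z)).congr_fderiv ?_
      ext x
      simp
    have d3 : HasFDerivAt (partialD k Q)
        ((fderiv ℝ (fderiv ℝ h) z).flip (Complex.I ^ (k : ℕ))) z := by
      refine (d2.const_add (Complex.I ^ (k : ℕ) • φ)).congr_of_eventuallyEq ?_
      filter_upwards [Metric.isOpen_ball.mem_nhds hz] with y hy using hfd y hy _
    have e1 : partialD j (partialD k Q) z =
        fderiv ℝ (fderiv ℝ h) z (Complex.I ^ (j : ℕ)) (Complex.I ^ (k : ℕ)) := by
      rw [partialD, d3.fderiv, ContinuousLinearMap.flip_apply]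
    rw [e1]
    refine (ContinuousLinearMap.le_opNorm₂ _ _ _).trans ?_
    rw [hI, hI, mul_one, mul_one]
    refine (q2 z hz).trans ?_
    gcongr
    linarith

end DeltaNLS

end

theorem proposition1p2 (p : ℝ) (hp : 0 < p) (g : ℝ → ℝ) (hg : DeltaNLS.IsNonlinearity p g) :
    ∃ γ₀ a₀ C : ℝ, 0 < γ₀ ∧ 0 < a₀ ∧ 0 < C ∧
      ∃ φ : DeltaNLS.WeightedH1 γ₀, φ =ᵐ[volume] DeltaNLS.eigenfunction 1 ∧
      ∃ Q : ℂ → DeltaNLS.WeightedH1 γ₀,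
        DeltaNLS.IsBoundStateFamily g p γ₀ a₀ C φ Q ∧
        (∀ Q' : ℂ → DeltaNLS.WeightedH1 γ₀, DeltaNLS.IsBoundStateFamily g p γ₀ a₀ C φ Q' →
          ∀ z ∈ Metric.ball (0 : ℂ) a₀, Q' z = Q z) ∧
        (1 < 2 * p →
          ContDiffOn ℝ 2 Q (Metric.ball 0 a₀) ∧
          ∀ z ∈ Metric.ball (0 : ℂ) a₀, ∀ j k : Fin 2,
            ‖DeltaNLS.partialD j (DeltaNLS.partialD k Q) z‖ ≤ C * ‖z‖ ^ (2 * p - 1)) := by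
  obtain ⟨φ, hφ⟩ := DeltaNLS.exists_weightedH1_eigenfunction
  obtain ⟨a, C, Q, ha, hC, hQ, hQ₂⟩ := DeltaNLS.exists_isBoundStateFamily hp hg hφ
  -- The constant C is fixed by existence first and the uniqueness radius is chosen after it.
  -- Shrinking the disc keeps every estimate with the same C.
  obtain ⟨a₁, ha₁, huniq⟩ := DeltaNLS.IsBoundStateFamily.exists_eqOn hp hg
    (by norm_num : (0 : ℝ) ≤ 1 / 8) (by norm_num) φ hφ hC.le
  have hm : 0 < min a a₁ := lt_min ha ha₁
  have hQ' := hQ.mono hm.le (min_le_left a a₁)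
  have hs := Metric.ball_subset_ball (x := (0 : ℂ)) (min_le_left a a₁)
  exact ⟨1 / 8, min a a₁, C, by norm_num, hm, hC, φ, hφ, Q, hQ',
    fun Q' h' => huniq _ (min_le_right a a₁) Q Q' hQ' h',
    fun hp' => ⟨(hQ₂ hp').1.mono hs, fun z hz => (hQ₂ hp').2 z (hs hz)⟩⟩
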